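/- Let $M$ be a smooth finite-dimensional Riemannian manifold (Hausdorff, without boundary) with metric $\langle\cdot,\cdot\rangle$ and Riemannian (Levi-Civita) connection $\nabla$. Let $D/dt$ be the covariant derivative along curves, write $\frac{D^{s+1}x}{dt^{s+1}}$ for the $s$-th covariant derivative of the velocity $\frac{dx}{dt}$ along a curve $x$, and let $R(X,Y)Z=\nabla_X\nabla_YZ-\nabla_Y\nabla_XZ-\nabla_{[X,Y]}Z$ be the curvature tensor. Let $T,\sigma>0$ and $(p_0,v_0),(p_T,v_T)\in TM$. Let $\Omega$ be the set of all $C^1$ piecewise smooth curves $x:[0,T]\to M$ with $x(0)=p_0$, $x(T)=p_T$, $\frac{dx}{dt}(0)=v_0$, $\frac{dx}{dt}(T)=v_T$. (Piecewise smooth means that there is a partition of $[0,T]$ into finitely many intervals such that $x$ is smooth on each closed interval.) Let $V_q:M\to\mathbb R$ be a function that is $C^1$ on an open set $U\subseteq M$ (the complement of the obstacle), and put $$J(x)=\int_0^T\frac12\left(\Big\|\frac{D^2x}{dt^2}\Big\|^2+\sigma\Big\|\frac{dx}{dt}\Big\|^2+V_q(x)\right)dt .$$ Let $x\in\Omega$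 with $x([0,T])\subseteq U$, and let $0=t_0<t_1<\dots<t_l=T$ be a partition such that $x$ is smooth on each $[t_{i-1},t_i]$. Let $\alpha:(-\epsilon,\epsilon)\times[0,T]\to M$ be an admissible variation of $x$: $\alpha$ is $C^1$, it is smooth on each strip $(-\epsilon,\epsilon)\times[s_{j-1},s_j]$ of some partition $0=s_0<\dots<s_m=T$, $\alpha_0=x$, and $\alpha_r=\alpha(r,\cdot)\in\Omega$ for all $r\in(-\epsilon,\epsilon)$. Let $X(t)=\frac{\partial\alpha}{\partial r}(0,t)$ be its variational vector field. Then the integrand of $J(\alpha_r)$ is integrable for all $r$ near $0$, the integrand on the right-hand side below is integrable, the one-sided limits $\frac{D^2x}{dt^2}(t_i^\pm)$ and $\frac{D^3x}{dt^3}(t_i^\pm)$ exist for $1\le i\le l-1$, the function $r\mapsto J(\alpha_r)$ is differentiable at $r=0$, and $$\begin{aligned}\frac{d}{dr}J(\alpha_r)\Big|_{r=0}={}&\int_0^T\Big\langle X,\frac{D^4x}{dt^4}+R\Big(\frac{D^2x}{dt^2},\frac{dx}{dt}\Big)\frac{dx}{dt}-\sigma\frac{D^2x}{dt^2}+\frac12\operatorname{grad}V_q(x)\Big\rangle\,dt\\&-\sum_{i=1}^{l-1}\Big\langle\frac{DX}{dt}(t_i),\frac{D^2x}{dt^2}(t_i^+)-\frac{D^2x}{dt^2}(t_i^-)\Big\rangle+\sum_{i=1}^{l-1}\Big\langle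 X(t_i),\frac{D^3x}{dt^3}(t_i^+)-\frac{D^3x}{dt^3}(t_i^-)\Big\rangle .\end{aligned}$$ -/

import Mathlib

open Set Filter Bundle MeasureTheory
open scoped Manifold ContDiff Topology

noncomputable section

namespace ObstacleAvoidance

variable {E : Type*} [NormedAddCommGroup E] [NormedSpace ℝ E]
  {M : Type*} [TopologicalSpace M] [ChartedSpace E M]

/-! ### Partitions, velocity, admissible curves and admissible variations -/

/-- `t` restricted to `{0, …, l}` is a partition `0 = t 0 < t 1 < ⋯ < t l = T` of `[0, T]`. -/
structure IsPartition (T : ℝ) (l : ℕ) (t : ℕ → ℝ) : Prop where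
  zero : t 0 = 0
  last : t l = T
  lt_succ : ∀ i < l, t i < t (i + 1)

/-- The velocity `dx/dt` of the restriction of `x` to `s` (one-sided at end points of `s`). -/
def velocity (s : Set ℝ) (x : ℝ → M) (t : ℝ) : TangentSpace 𝓘(ℝ, E) (x t) :=
  mfderivWithin 𝓘(ℝ, ℝ) 𝓘(ℝ, E) x s t (1 : ℝ)

/-- The admissible set `Ω`: the `C¹` piecewise smooth curves `x : [0, T] → M` with
`(x 0, dx/dt 0) = P₀` and `(x T, dx/dt T) = P₁`, where `P₀` and `P₁` are points of `TM`.
A curve is represented by a function on `ℝ`, of which only the restriction to `[0, T]` is used. -/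
structure IsAdmissibleCurve (T : ℝ) (P₀ P₁ : TangentBundle 𝓘(ℝ, E) M) (x : ℝ → M) : Prop where
  contMDiffOn_one : ContMDiffOn 𝓘(ℝ, ℝ) 𝓘(ℝ, E) 1 x (Icc 0 T)
  piecewise_smooth : ∃ (l : ℕ) (t : ℕ → ℝ), IsPartition T l t ∧
    ∀ i < l, ContMDiffOn 𝓘(ℝ, ℝ) 𝓘(ℝ, E) ∞ x (Icc (t i) (t (i + 1)))
  left_end : (⟨x 0, velocity (Icc 0 T) x 0⟩ : TangentBundle 𝓘(ℝ, E) M) = P₀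
  right_end : (⟨x T, velocity (Icc 0 T) x T⟩ : TangentBundle 𝓘(ℝ, E) M) = P₁

/-- `α : (-ε, ε) × [0, T] → M`, `(r, t) ↦ α r t`, is a `C¹` piecewise smooth one-parameter
admissible variation of `x`: it is `C¹`, smooth on each strip `(-ε, ε) × [t i, t (i + 1)]` of some
partition of `[0, T]`, `α 0 = x` on `[0, T]`, and every `α r` belongs to the admissible set. -/
structure IsAdmissibleVariation (T : ℝ) (P₀ P₁ : TangentBundle 𝓘(ℝ, E) M) (ε : ℝ) (x : ℝ → M)
    (α : ℝ → ℝ → M) : Prop where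
  pos : 0 < ε
  contMDiffOn_one : ContMDiffOn 𝓘(ℝ, ℝ × ℝ) 𝓘(ℝ, E) 1 (fun p : ℝ × ℝ => α p.1 p.2)
    (Ioo (-ε) ε ×ˢ Icc 0 T)
  piecewise_smooth : ∃ (l : ℕ) (t : ℕ → ℝ), IsPartition T l t ∧
    ∀ i < l, ContMDiffOn 𝓘(ℝ, ℝ × ℝ) 𝓘(ℝ, E) ∞ (fun p : ℝ × ℝ => α p.1 p.2)
      (Ioo (-ε) ε ×ˢ Icc (t i) (t (i + 1)))
  zero : ∀ t ∈ Icc 0 T, α 0 t = x t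
  mem : ∀ r ∈ Ioo (-ε) ε, IsAdmissibleCurve T P₀ P₁ (α r)

/-- `X` is the variational vector field of the variation `α` of `x`:
`X t = ∂α/∂r (0, t)` for `t ∈ [0, T]`, as an equality in the tangent bundle. -/
def IsVariationalField (T : ℝ) (x : ℝ → M) (α : ℝ → ℝ → M)
    (X : ∀ t, TangentSpace 𝓘(ℝ, E) (x t)) : Prop :=
  ∀ t ∈ Icc 0 T, (⟨x t, X t⟩ : TangentBundle 𝓘(ℝ, E) M) =
    ⟨α 0 t, mfderiv 𝓘(ℝ, ℝ) 𝓘(ℝ, E) (fun r => α r t) 0 (1 : ℝ)⟩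

/-! ### Riemannian connection, covariant derivative along a curve, curvature, gradient -/

section Connection

variable [IsManifold 𝓘(ℝ, E) ∞ M]

/-- A smooth connection on `TM` is the Riemannian (Levi-Civita) connection of the metric if it is
compatible with the metric, `u⟨Y, Z⟩ = ⟨∇_u Y, Z⟩ + ⟨Y, ∇_u Z⟩`, and torsion-free,
`∇_Y Z - ∇_Z Y = [Y, Z]`. In Mathlib's notation `∇_u Y` at `p` is `nabla Y p u`. -/
structure IsRiemannianConnection [FiniteDimensional ℝ E]
    [RiemannianBundle (fun p : M => TangentSpace 𝓘(ℝ, E) p)]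
    [IsContMDiffRiemannianBundle 𝓘(ℝ, E) ∞ E (fun p : M => TangentSpace 𝓘(ℝ, E) p)]
    (nabla : CovariantDerivative 𝓘(ℝ, E) E (fun p : M => TangentSpace 𝓘(ℝ, E) p)) : Prop where
  smooth : nabla.ContMDiffCovariantDerivative ∞
  metric : ∀ (p : M) (Y Z : ∀ y : M, TangentSpace 𝓘(ℝ, E) y),
    MDifferentiableAt 𝓘(ℝ, E) 𝓘(ℝ, E).tangent
      (fun y => (⟨y, Y y⟩ : TangentBundle 𝓘(ℝ, E) M)) p →
    MDifferentiableAt 𝓘(ℝ, E) 𝓘(ℝ, E).tangent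
      (fun y => (⟨y, Z y⟩ : TangentBundle 𝓘(ℝ, E) M)) p →
    ∀ u : TangentSpace 𝓘(ℝ, E) p,
      mfderiv 𝓘(ℝ, E) 𝓘(ℝ, ℝ) (fun y => (inner ℝ (Y y) (Z y) : ℝ)) p u =
        (inner ℝ (nabla Y p u) (Z p) + inner ℝ (Y p) (nabla Z p u) : ℝ)
  torsion_free : nabla.torsion = 0

variable (nabla : CovariantDerivative 𝓘(ℝ, E) E (fun p : M => TangentSpace 𝓘(ℝ, E) p))

/-- The covariant derivative `DW/dt` of a vector field `W` along `x : s → M`.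
In the coordinate frame `∂₁, …, ∂ₙ` of the chart at `x t`, with `W = ∑ Wʲ ∂ⱼ`, it is
`∑ (dWʲ/dt) ∂ⱼ + ∑ Wʲ ∇_{dx/dt} ∂ⱼ`; here `FiberBundle.extend E (W t)` is the local field with
constant coefficients `Wʲ(t)` in that frame. -/
def covDeriv (s : Set ℝ) (x : ℝ → M) (W : ∀ t, TangentSpace 𝓘(ℝ, E) (x t)) (t : ℝ) :
    TangentSpace 𝓘(ℝ, E) (x t) :=
  letI e := trivializationAt E (fun p : M => TangentSpace 𝓘(ℝ, E) p) (x t)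
  e.symm (x t)
      (derivWithin (fun τ => (e (⟨x τ, W τ⟩ : TangentBundle 𝓘(ℝ, E) M)).2) s t)
    + nabla (FiberBundle.extend E (W t)) (x t) (velocity s x t)

/-- `curveDeriv nabla s x k` is `D^{k+1}x/dt^{k+1}`, the covariant derivative of order `k` along
`x` of the velocity of `x`. -/
def curveDeriv (s : Set ℝ) (x : ℝ → M) : ℕ → ∀ t, TangentSpace 𝓘(ℝ, E) (x t)
  | 0 => velocity s x
  | k + 1 => covDeriv nabla s x (curveDeriv s x k)

/-- `R(X, Y)Z = ∇_X ∇_Y Z - ∇_Y ∇_X Z - ∇_{[X, Y]} Z` for vector fields `X`, `Y`, `Z` on `M`. -/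
def curvatureField (X Y Z : ∀ p : M, TangentSpace 𝓘(ℝ, E) p) (p : M) : TangentSpace 𝓘(ℝ, E) p :=
  nabla (fun y => nabla Z y (Y y)) p (X p) - nabla (fun y => nabla Z y (X y)) p (Y p)
    - nabla Z p (VectorField.mlieBracket 𝓘(ℝ, E) X Y p)

/-- The curvature tensor on tangent vectors: `R(u, v)w` is the value at `p` of `R(X, Y)Z` for
fields that are smooth near `p` and extend `u`, `v`, `w` (those with constant coefficients in the
chart at `p`); as `R` is a tensor, the choice of the extensions is immaterial. -/
def curvature {p : M} (u v w : TangentSpace 𝓘(ℝ, E) p) : TangentSpace 𝓘(ℝ, E) p :=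
  curvatureField nabla (FiberBundle.extend E u) (FiberBundle.extend E v) (FiberBundle.extend E w) p

end Connection

section Metric

variable [FiniteDimensional ℝ E] [RiemannianBundle (fun p : M => TangentSpace 𝓘(ℝ, E) p)]

/-- The gradient of `V` at `p`: the vector representing `dV_p` for the inner product of `T_pM`. -/
def grad (V : M → ℝ) (p : M) : TangentSpace 𝓘(ℝ, E) p :=
  letI : FiniteDimensional ℝ (TangentSpace 𝓘(ℝ, E) p) := inferInstanceAs (FiniteDimensional ℝ E)
  letI : CompleteSpace (TangentSpace 𝓘(ℝ, E) p) := FiniteDimensional.complete ℝ _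
  (InnerProductSpace.toDual ℝ (TangentSpace 𝓘(ℝ, E) p)).symm (mfderiv 𝓘(ℝ, E) 𝓘(ℝ, ℝ) V p)

variable [IsManifold 𝓘(ℝ, E) ∞ M]
  (nabla : CovariantDerivative 𝓘(ℝ, E) E (fun p : M => TangentSpace 𝓘(ℝ, E) p))

/-- The integrand `½ (‖D²x/dt²‖² + σ ‖dx/dt‖² + V(x))` of the functional `J`, for curves on
`[0, T]`. -/
def energyDensity (σ : ℝ) (V : M → ℝ) (T : ℝ) (x : ℝ → M) (t : ℝ) : ℝ :=
  (1 / 2 : ℝ) * (‖curveDeriv nabla (Icc 0 T) x 1 t‖ ^ 2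
    + σ * ‖curveDeriv nabla (Icc 0 T) x 0 t‖ ^ 2 + V (x t))

/-- The functional `J(x) = ∫₀ᵀ ½ (‖D²x/dt²‖² + σ ‖dx/dt‖² + V(x)) dt`. -/
def J (σ : ℝ) (V : M → ℝ) (T : ℝ) (x : ℝ → M) : ℝ :=
  ∫ t in (0 : ℝ)..T, energyDensity nabla σ V T x t

/-- The field `D⁴x/dt⁴ + R(D²x/dt², dx/dt)dx/dt - σ D²x/dt² + ½ grad V(x)` along `x`. -/
def eulerField (σ : ℝ) (V : M → ℝ) (T : ℝ) (x : ℝ → M) (t : ℝ) : TangentSpace 𝓘(ℝ, E) (x t) :=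
  letI D := fun k => curveDeriv nabla (Icc 0 T) x k t
  D 3 + curvature nabla (D 1) (D 0) (D 0) - σ • D 1 + (1 / 2 : ℝ) • grad V (x t)

end Metric

end ObstacleAvoidance

end

/-! Write `Y = ∂α/∂r` and let `e` be the energy density of `α_r`, a function of `(r, t)`. On a strip
where `α` is smooth, `∂e/∂r` contains `D_r D_t ∂α/∂t` and `D_r ∂α/∂t`. Vanishing torsion gives `D_r
∂α/∂t = D_t Y` (`covDerivAlong_dirVelocity_comm`), and commuting `D_r` with `D_t` costs a curvature
term (`covDerivAlong_comm`). The pair symmetry `inner_curvature_symm` turns `⟨R(Y, ẋ)ẋ, D²x⟩` into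
`⟨Y, R(D²x, ẋ)ẋ⟩`. By the product rule for the metric, `∂e/∂r = ∂B/∂t + ⟨Y, Euler field⟩` with `B =
⟨D_t Y, D²x⟩ - ⟨Y, D³x⟩ + σ⟨Y, ẋ⟩`; this is `fderivWithin_stripEnergy`. Differentiating under the
integral and integrating `∂B/∂t` gives the formula on one strip, `hasDerivAt_integral_stripEnergy`.

Summing over the strips leaves the values of `B` at the nodes. At `0` and `T` position and velocity
are prescribed, so `Y` and `D_t Y` vanish there (`variationField_eq_zero`). At an interior node `Y`
and `ẋ` have no jump, and neither has `D_t Y`: both one-sided values equal `D_r` of the velocity of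
`α_r`, which is defined there because `α_r` is `C¹` (`covDeriv_variationField`). Only the jumps of
`D²x` and `D³x` survive. They vanish wherever `x` is smooth, so the break points of the variation
may be exchanged for those of the given partition of `x` (`IsPartition.sum_eq_sum`).

The geometry is derived in charts. `coord_nabla` and `coord_covDerivAlong` express the connection
and the derivative along maps by Christoffel symbols in an arbitrary fixed chart; commutation and
curvature identities then reduce to symmetry of second derivatives. All derivatives are taken within
sets, so that the closed edges of the strips are included. -/

set_option linter.unusedSectionVars false

noncomputable section

namespace ObstacleAvoidance

/-! ### Tangent vectors in the coordinates of a chart -/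

section Coordinates

variable {E : Type*} [NormedAddCommGroup E] [NormedSpace ℝ E]
  {M : Type*} [TopologicalSpace M] [ChartedSpace E M] [IsManifold 𝓘(ℝ, E) ∞ M]

/-- The coordinates of a tangent vector at `y` in the chart at `q`. -/
def coord (q y : M) (v : TangentSpace 𝓘(ℝ, E) y) : E :=
  (trivializationAt E (fun p : M => TangentSpace 𝓘(ℝ, E) p) q
    (⟨y, v⟩ : TangentBundle 𝓘(ℝ, E) M)).2

/-- The coordinates in the chart at `q`, as a continuous linear map. -/
def coordL (q y : M) : TangentSpace 𝓘(ℝ, E) y →L[ℝ] E :=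
  (trivializationAt E (fun p : M => TangentSpace 𝓘(ℝ, E) p) q).continuousLinearMapAt ℝ y

/-- The tangent vector at `y` with given coordinates in the chart at `q`. -/
def frameL (q y : M) : E →L[ℝ] TangentSpace 𝓘(ℝ, E) y :=
  (trivializationAt E (fun p : M => TangentSpace 𝓘(ℝ, E) p) q).symmL ℝ y

variable {q y : M}

lemma coordL_apply (hy : y ∈ (chartAt E q).source) (v : TangentSpace 𝓘(ℝ, E) y) :
    coordL q y v = coord q y v := by
  have hy' : y ∈ (trivializationAt E (fun p : M => TangentSpace 𝓘(ℝ, E) p) q).baseSet := hy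
  simp only [coordL, coord]
  rw [Trivialization.continuousLinearMapAt_apply, Trivialization.coe_linearMapAt_of_mem _ hy']

lemma coord_add (hy : y ∈ (chartAt E q).source) (v w : TangentSpace 𝓘(ℝ, E) y) :
    coord q y (v + w) = coord q y v + coord q y w := by
  simp only [← coordL_apply hy, map_add]

lemma coord_sub (hy : y ∈ (chartAt E q).source) (v w : TangentSpace 𝓘(ℝ, E) y) :
    coord q y (v - w) = coord q y v - coord q y w := by
  simp only [← coordL_apply hy, map_sub]

lemma coord_smul (hy : y ∈ (chartAt E q).source) (c : ℝ) (v : TangentSpace 𝓘(ℝ, E) y) :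
    coord q y (c • v) = c • coord q y v := by
  simp only [← coordL_apply hy, map_smul]

lemma frameL_coord (hy : y ∈ (chartAt E q).source) (v : TangentSpace 𝓘(ℝ, E) y) :
    frameL q y (coord q y v) = v := by
  have hy' : y ∈ (trivializationAt E (fun p : M => TangentSpace 𝓘(ℝ, E) p) q).baseSet := hy
  rw [← coordL_apply hy]
  exact Trivialization.symmL_continuousLinearMapAt _ hy' v

lemma coord_frameL (hy : y ∈ (chartAt E q).source) (v : E) :
    coord q y (frameL q y v) = v := by
  have hy' : y ∈ (trivializationAt E (fun p : M => TangentSpace 𝓘(ℝ, E) p) q).baseSet := hy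
  rw [← coordL_apply hy]
  exact Trivialization.continuousLinearMapAt_symmL _ hy' v

lemma coord_injective (hy : y ∈ (chartAt E q).source) :
    Function.Injective (coord (E := E) q y) :=
  fun v w h => by rw [← frameL_coord hy v, h, frameL_coord hy]

lemma symm_eq_frameL (hy : y ∈ (chartAt E q).source) (v : E) :
    (trivializationAt E (fun p : M => TangentSpace 𝓘(ℝ, E) p) q).symm y v = frameL q y v :=
  (Trivialization.symmL_apply _ hy v).symm

lemma extend_apply_eq_frameL (hy : y ∈ (chartAt E q).source) (v : TangentSpace 𝓘(ℝ, E) q) :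
    FiberBundle.extend E v y = frameL q y (coord q q v) :=
  symm_eq_frameL hy _

lemma coordL_eq_mfderiv (hy : y ∈ (chartAt E q).source) :
    coordL (E := E) q y = mfderiv 𝓘(ℝ, E) 𝓘(ℝ, E) (extChartAt 𝓘(ℝ, E) q) y :=
  TangentBundle.continuousLinearMapAt_trivializationAt hy

lemma coord_eq_mfderiv (hy : y ∈ (chartAt E q).source) (v : TangentSpace 𝓘(ℝ, E) y) :
    coord (E := E) q y v = mfderiv 𝓘(ℝ, E) 𝓘(ℝ, E) (extChartAt 𝓘(ℝ, E) q) y v := by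
  rw [← coordL_apply hy]
  exact congr($(coordL_eq_mfderiv hy) v)

lemma contMDiffOn_frameL (q : M) (v : E) :
    ContMDiffOn 𝓘(ℝ, E) 𝓘(ℝ, E).tangent ∞
      (fun y => (⟨y, frameL q y v⟩ : TangentBundle 𝓘(ℝ, E) M)) (chartAt E q).source := by
  intro y hy
  rw [(trivializationAt E (fun p : M => TangentSpace 𝓘(ℝ, E) p) q).contMDiffWithinAt_section _ hy]
  exact (contMDiffWithinAt_const (c := v)).congr (fun z hz => coord_frameL hz v) (coord_frameL hy v)

lemma mdifferentiableAt_frameL (hy : y ∈ (chartAt E q).source) (v : E) :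
    MDifferentiableAt 𝓘(ℝ, E) 𝓘(ℝ, E).tangent
      (fun y => (⟨y, frameL q y v⟩ : TangentBundle 𝓘(ℝ, E) M)) y :=
  ((contMDiffOn_frameL q v y hy).contMDiffAt ((chartAt E q).open_source.mem_nhds hy)).mdifferentiableAt
    (by simp)

lemma mdifferentiableWithinAt_tangent_iff {F : Type*} [NormedAddCommGroup F] [NormedSpace ℝ F]
    {f : F → M} {W : ∀ z, TangentSpace 𝓘(ℝ, E) (f z)} {S : Set F} {z : F}
    (hz : f z ∈ (chartAt E q).source) :
    MDifferentiableWithinAt 𝓘(ℝ, F) 𝓘(ℝ, E).tangent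
      (fun z => (⟨f z, W z⟩ : TangentBundle 𝓘(ℝ, E) M)) S z ↔
    MDifferentiableWithinAt 𝓘(ℝ, F) 𝓘(ℝ, E) f S z ∧
      DifferentiableWithinAt ℝ (fun z => coord q (f z) (W z)) S z := by
  rw [← mdifferentiableWithinAt_iff_differentiableWithinAt]
  exact (trivializationAt E (fun p : M => TangentSpace 𝓘(ℝ, E) p) q).mdifferentiableWithinAt_totalSpace_iff _ _ hz

lemma contMDiffWithinAt_tangent_iff {F : Type*} [NormedAddCommGroup F] [NormedSpace ℝ F]
    {f : F → M} {W : ∀ z, TangentSpace 𝓘(ℝ, E) (f z)} {S : Set F} {z : F}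
    (hz : f z ∈ (chartAt E q).source) :
    ContMDiffWithinAt 𝓘(ℝ, F) 𝓘(ℝ, E).tangent ∞
      (fun z => (⟨f z, W z⟩ : TangentBundle 𝓘(ℝ, E) M)) S z ↔
    ContMDiffWithinAt 𝓘(ℝ, F) 𝓘(ℝ, E) ∞ f S z ∧
      ContDiffWithinAt ℝ ∞ (fun z => coord q (f z) (W z)) S z := by
  rw [← contMDiffWithinAt_iff_contDiffWithinAt]
  exact (trivializationAt E (fun p : M => TangentSpace 𝓘(ℝ, E) p) q).contMDiffWithinAt_iff hz

lemma mdifferentiableAt_coord {Y : ∀ y : M, TangentSpace 𝓘(ℝ, E) y}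
    (hy : y ∈ (chartAt E q).source)
    (hY : MDifferentiableAt 𝓘(ℝ, E) 𝓘(ℝ, E).tangent
      (fun y => (⟨y, Y y⟩ : TangentBundle 𝓘(ℝ, E) M)) y) :
    MDifferentiableAt 𝓘(ℝ, E) 𝓘(ℝ, E) (fun z => coord q z (Y z)) y :=
  ((trivializationAt E (fun p : M => TangentSpace 𝓘(ℝ, E) p) q).mdifferentiableAt_totalSpace_iff _ _
    hy).1 hY |>.2

end Coordinates

/-- Shortcut instance: the search for it is slow in the presence of tangent spaces. -/
instance bilinNormedAddCommGroup {E : Type*} [NormedAddCommGroup E] [NormedSpace ℝ E] :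
    NormedAddCommGroup (E →L[ℝ] E →L[ℝ] E) :=
  ContinuousLinearMap.toNormedAddCommGroup

/-- Shortcut instance: the search for it is slow in the presence of tangent spaces. -/
instance bilinNormedSpace {E : Type*} [NormedAddCommGroup E] [NormedSpace ℝ E] :
    NormedSpace ℝ (E →L[ℝ] E →L[ℝ] E) :=
  ContinuousLinearMap.toNormedSpace

/-! ### Christoffel symbols -/

section Christoffel

variable {E : Type*} [NormedAddCommGroup E] [NormedSpace ℝ E] [FiniteDimensional ℝ E]
  {M : Type*} [TopologicalSpace M] [ChartedSpace E M] [IsManifold 𝓘(ℝ, E) ∞ M]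
  (nabla : CovariantDerivative 𝓘(ℝ, E) E (fun p : M => TangentSpace 𝓘(ℝ, E) p))

/-- The endomorphism `u ↦ ∇_u ∂_v` in the coordinates of the chart at `q`. -/
def frameDeriv (q y : M) (v : E) : E →L[ℝ] E :=
  coordL q y ∘L nabla (fun z => frameL q z v) y ∘L frameL q y

/-- The Christoffel symbols of `nabla` in the chart at `q`: `christoffel nabla q y v u` are the
coordinates of `∇_u ∂_v` at `y`. -/
def christoffel (q y : M) : E →L[ℝ] E →L[ℝ] E :=
  ∑ j, (LinearMap.toContinuousLinearMap ((Module.finBasis ℝ E).coord j)).smulRight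
    (frameDeriv nabla q y (Module.finBasis ℝ E j))

variable {q y : M} {nabla}

lemma nabla_sum {ι : Type*} (s : Finset ι) (c : ι → M → ℝ)
    (Y : ι → ∀ y : M, TangentSpace 𝓘(ℝ, E) y)
    (hc : ∀ i ∈ s, MDifferentiableAt 𝓘(ℝ, E) 𝓘(ℝ, ℝ) (c i) y)
    (hY : ∀ i ∈ s, MDifferentiableAt 𝓘(ℝ, E) 𝓘(ℝ, E).tangent
      (fun y => (⟨y, Y i y⟩ : TangentBundle 𝓘(ℝ, E) M)) y) (u : TangentSpace 𝓘(ℝ, E) y) :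
    nabla (fun z => ∑ i ∈ s, c i z • Y i z) y u =
      ∑ i ∈ s, (c i y • nabla (Y i) y u + (mvfderiv 𝓘(ℝ, E) (c i) y u) • Y i y) := by
  classical
  induction s using Finset.induction_on with
  | empty =>
    have : nabla (fun z : M => (0 : TangentSpace 𝓘(ℝ, E) z)) = 0 := nabla.zero
    simp [this]
  | insert a s ha ih =>
    simp only [Finset.sum_insert ha]
    have h1 := hc a (Finset.mem_insert_self a s)
    have h2 := hY a (Finset.mem_insert_self a s)
    have h3 : MDifferentiableAt 𝓘(ℝ, E) 𝓘(ℝ, E).tangent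
      (fun y => (⟨y, ∑ i ∈ s, c i y • Y i y⟩ : TangentBundle 𝓘(ℝ, E) M)) y :=
      MDifferentiableAt.sum_section fun i hi =>
        (hc i (Finset.mem_insert_of_mem hi)).smul_section (hY i (Finset.mem_insert_of_mem hi))
    have h4 := nabla.isCovariantDerivativeOnUniv.add (h1.smul_section h2) h3
    have h5 := nabla.isCovariantDerivativeOnUniv.leibniz h2 h1
    have h6 := congr($h4 u)
    have h7 := congr($h5 u)
    change nabla (c a • Y a + fun z => ∑ i ∈ s, c i z • Y i z) y u = _
    rw [← ih (fun i hi => hc i (Finset.mem_insert_of_mem hi))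
      (fun i hi => hY i (Finset.mem_insert_of_mem hi))]
    refine h6.trans ?_
    rw [add_apply]
    congr 1

lemma coord_sum {ι : Type*} (s : Finset ι) (hy : y ∈ (chartAt E q).source)
    (v : ι → TangentSpace 𝓘(ℝ, E) y) :
    coord q y (∑ i ∈ s, v i) = ∑ i ∈ s, coord q y (v i) := by
  simp only [← coordL_apply hy, map_sum]

/-- Near `y` the field is a combination of the coordinate frame with differentiable coefficients.
Locality and the Leibniz rule then give the derivative of the coefficients plus the values of
`nabla` on the frame, which `christoffel` collects. -/
lemma coord_nabla (hy : y ∈ (chartAt E q).source) {Y : ∀ y : M, TangentSpace 𝓘(ℝ, E) y}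
    (hY : MDifferentiableAt 𝓘(ℝ, E) 𝓘(ℝ, E).tangent
      (fun y => (⟨y, Y y⟩ : TangentBundle 𝓘(ℝ, E) M)) y) (u : TangentSpace 𝓘(ℝ, E) y) :
    coord q y (nabla Y y u) = mvfderiv 𝓘(ℝ, E) (fun z => coord q z (Y z)) y u +
      christoffel nabla q y (coord q y (Y y)) (coord q y u) := by
  set b := Module.finBasis ℝ E with hb
  have hcd := mdifferentiableAt_coord hy hY
  let L : ∀ j, E →L[ℝ] ℝ := fun j => LinearMap.toContinuousLinearMap (b.coord j)
  let c : _ → M → ℝ := fun j z => L j (coord q z (Y z))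
  have hc : ∀ j, HasMFDerivAt 𝓘(ℝ, E) 𝓘(ℝ, ℝ) (c j) y
      ((L j) ∘L mfderiv 𝓘(ℝ, E) 𝓘(ℝ, E) (fun z => coord q z (Y z)) y) := fun j =>
    ((L j).hasMFDerivAt).comp y hcd.hasMFDerivAt
  have hF : ∀ j, MDifferentiableAt 𝓘(ℝ, E) 𝓘(ℝ, E).tangent
      (fun y => (⟨y, frameL q y (b j)⟩ : TangentBundle 𝓘(ℝ, E) M)) y :=
    fun j => mdifferentiableAt_frameL hy (b j)
  have hev : ∀ᶠ z in 𝓝 y, Y z = ∑ j, c j z • frameL q z (b j) := by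
    filter_upwards [(chartAt E q).open_source.mem_nhds hy] with z hz
    apply coord_injective hz
    rw [coord_sum _ hz]
    simp only [coord_smul hz, coord_frameL hz]
    exact (b.sum_repr _).symm
  have hS : MDifferentiableAt 𝓘(ℝ, E) 𝓘(ℝ, E).tangent
      (fun y => (⟨y, ∑ j, c j y • frameL q y (b j)⟩ : TangentBundle 𝓘(ℝ, E) M)) y :=
    MDifferentiableAt.sum_section fun i _ => (hc i).mdifferentiableAt.smul_section (hF i)
  have h1 := nabla.isCovariantDerivativeOnUniv.congr_of_eventuallyEq hY hS univ_mem hev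
  have h2 := nabla_sum (nabla := nabla) Finset.univ c (fun j z => frameL q z (b j))
    (fun j _ => (hc j).mdifferentiableAt) (fun j _ => hF j) u
  rw [congr($h1 u), h2, coord_sum _ hy]
  simp only [coord_add hy, coord_smul hy, coord_frameL hy, Finset.sum_add_distrib]
  rw [add_comm]
  congr 1
  · refine Eq.trans ?_ (b.sum_repr _)
    refine Finset.sum_congr rfl fun j _ => ?_
    congr 1
    exact congr($((hc j).mfderiv) u)
  · simp only [christoffel, sum_apply, ContinuousLinearMap.smulRight_apply,
      frameDeriv, smul_apply, ContinuousLinearMap.comp_apply, frameL_coord hy,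
      coordL_apply hy]
    rfl

/-- A frame field has constant coordinates, so only the Christoffel term of `coord_nabla` remains.
Hence the definition through a basis has the expected meaning for every `v`. -/
lemma christoffel_apply (hy : y ∈ (chartAt E q).source) (v : E) (u : TangentSpace 𝓘(ℝ, E) y) :
    christoffel nabla q y v (coord q y u) = coord q y (nabla (fun z => frameL q z v) y u) := by
  rw [coord_nabla hy (mdifferentiableAt_frameL hy v), coord_frameL hy]
  have : (fun z => coord q z (frameL q z v)) =ᶠ[𝓝 y] fun _ => v := by
    filter_upwards [(chartAt E q).open_source.mem_nhds hy] with z hz using coord_frameL hz v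
  have h2 : mvfderiv 𝓘(ℝ, E) (fun z => coord q z (frameL q z v)) y = 0 := by
    unfold mvfderiv
    rw [this.mfderiv_eq]
    ext1 u
    rw [mfderiv_const]
    rfl
  rw [h2]
  simp

variable [T2Space M]

/-- By finite dimension it is enough to treat `nabla` on one frame field. Smoothness of `nabla` is
applied to global smooth fields, so the frame field is first cut off; by locality this changes
nothing near the point. -/
lemma contMDiffOn_christoffel (hn : nabla.ContMDiffCovariantDerivative ∞) (q : M) :
    ContMDiffOn 𝓘(ℝ, E) 𝓘(ℝ, E →L[ℝ] E →L[ℝ] E) ∞ (christoffel nabla q) (chartAt E q).source := by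
  suffices h : ∀ v, ContMDiffOn 𝓘(ℝ, E) 𝓘(ℝ, E →L[ℝ] E) ∞ (fun y => frameDeriv nabla q y v)
      (chartAt E q).source by
    intro y hy
    unfold christoffel
    refine ContMDiffWithinAt.sum fun j _ => ?_
    have hL : ContDiff ℝ ∞ fun A : E →L[ℝ] E =>
        (LinearMap.toContinuousLinearMap ((Module.finBasis ℝ E).coord j)).smulRight A :=
      contDiff_const.smulRight contDiff_id
    exact hL.contDiffAt.comp_contMDiffWithinAt (h (Module.finBasis ℝ E j) y hy)
  intro v y hy
  apply ContMDiffAt.contMDiffWithinAt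
  -- A bump function equal to `1` near `y` and supported in the chart domain makes the frame field
  -- globally smooth.
  obtain ⟨χ, -, hχ⟩ := (SmoothBumpFunction.nhds_basis_tsupport (I := 𝓘(ℝ, E)) y).mem_iff.1
    ((chartAt E q).open_source.mem_nhds hy)
  have hsm : ContMDiff 𝓘(ℝ, E) 𝓘(ℝ, E).tangent ∞
      (fun z => (⟨z, χ z • frameL q z v⟩ : TangentBundle 𝓘(ℝ, E) M)) :=
    ContMDiffOn.smul_section_of_tsupport χ.contMDiff.contMDiffOn (chartAt E q).open_source hχ
      (contMDiffOn_frameL q v)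
  have hD := hn.contMDiff.contMDiff (σ := fun z => χ z • frameL q z v) hsm.contMDiffOn
  have hDy := (hD y (mem_univ y)).contMDiffAt univ_mem
  have hty : y ∈ (trivializationAt (E →L[ℝ] E)
      (fun p : M => TangentSpace 𝓘(ℝ, E) p →L[ℝ] TangentSpace 𝓘(ℝ, E) p) q).baseSet := ⟨hy, hy⟩
  have hc := ((trivializationAt (E →L[ℝ] E)
    (fun p : M => TangentSpace 𝓘(ℝ, E) p →L[ℝ] TangentSpace 𝓘(ℝ, E) p) q).contMDiffAt_iff
      ((Trivialization.mem_source _).2 hty)).1 hDy |>.2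
  refine hc.congr_of_eventuallyEq ?_
  filter_upwards [(chartAt E q).open_source.mem_nhds hy,
    χ.eventuallyEq_one.eventually_nhds] with z hz hχz
  have h1 : nabla (fun z => χ z • frameL q z v) z = nabla (fun z => frameL q z v) z :=
    nabla.isCovariantDerivativeOnUniv.congr_of_eventuallyEq
      (hsm.contMDiffAt.mdifferentiableAt (by simp)) (mdifferentiableAt_frameL hz v) univ_mem
      (hχz.mono fun w hw => by simp [hw])
  rw [hom_trivializationAt_apply]
  change _ = coordL q z ∘L nabla (fun z => χ z • frameL q z v) z ∘L frameL q z
  rw [h1]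
  rfl

end Christoffel

/-! ### Symmetry of the Christoffel symbols and the coordinate formula for curvature -/

section CurvatureCoordinates

variable {E : Type*} [NormedAddCommGroup E] [NormedSpace ℝ E] [FiniteDimensional ℝ E]
  {M : Type*} [TopologicalSpace M] [ChartedSpace E M] [IsManifold 𝓘(ℝ, E) ∞ M]
  {nabla : CovariantDerivative 𝓘(ℝ, E) E (fun p : M => TangentSpace 𝓘(ℝ, E) p)} {q y : M}

lemma frameL_eventuallyEq_mpullback (hy : y ∈ (chartAt E q).source) (a : E) :
    (fun z => frameL q z a) =ᶠ[𝓝 y]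
      VectorField.mpullback 𝓘(ℝ, E) 𝓘(ℝ, E) (extChartAt 𝓘(ℝ, E) q) (fun _ => a) := by
  filter_upwards [(chartAt E q).open_source.mem_nhds hy] with z hz
  have hinv := isInvertible_mfderiv_extChartAt (I := 𝓘(ℝ, E)) (x := q) (y := z)
    (by simpa using hz)
  have h1 := coord_frameL hz a
  rw [coord_eq_mfderiv hz] at h1
  exact (hinv.inverse_apply_eq.2 h1.symm).symm

/-- The frame fields are pullbacks of constant fields under the chart. Pullback commutes with the
Lie bracket, and constant fields commute. -/
lemma mlieBracket_frameL (hy : y ∈ (chartAt E q).source) (a b : E) :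
    VectorField.mlieBracket 𝓘(ℝ, E) (fun z => frameL q z a) (fun z => frameL q z b) y = 0 := by
  have : CompleteSpace E := FiniteDimensional.complete ℝ E
  have : IsManifold 𝓘(ℝ, E) (minSmoothness ℝ 2) M := by
    rw [minSmoothness_of_isRCLikeNormedField]; infer_instance
  rw [(frameL_eventuallyEq_mpullback hy a).mlieBracket_vectorField_eq
    (frameL_eventuallyEq_mpullback hy b)]
  have hc : ∀ a : E, MDifferentiableAt 𝓘(ℝ, E) 𝓘(ℝ, E).tangent
      (fun z : E => (⟨z, a⟩ : TangentBundle 𝓘(ℝ, E) E)) (extChartAt 𝓘(ℝ, E) q y) := fun a =>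
    ((contMDiffAt_vectorSpace_iff_contDiffAt (V := fun _ : E => a) (n := 1)).2
      contDiffAt_const).mdifferentiableAt (by simp)
  rw [← VectorField.mpullback_mlieBracket (n := 2) (hc a) (hc b)
    ((contMDiffOn_extChartAt.contMDiffAt ((chartAt E q).open_source.mem_nhds hy))) (by simp)]
  have h0 : VectorField.mlieBracketWithin 𝓘(ℝ, E) (fun _ : E => a) (fun _ : E => b) univ
      (extChartAt 𝓘(ℝ, E) q y) = 0 := by
    refine (congrFun (VectorField.mlieBracketWithin_eq_lieBracketWithin) _).trans ?_
    have h : VectorField.lieBracketWithin ℝ (fun _ : E => a) (fun _ : E => b) univ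
        (extChartAt 𝓘(ℝ, E) q y) = 0 := by
      simp [VectorField.lieBracketWithin]
    exact h
  rw [VectorField.mpullback_apply]
  refine (congrArg _ ((congrFun VectorField.mlieBracketWithin_univ _).symm.trans h0)).trans ?_
  exact map_zero _

/-- The bracket in the torsion of two frame fields is zero, so vanishing torsion is exactly this
symmetry. -/
lemma christoffel_symm (hy : y ∈ (chartAt E q).source) (ht : nabla.torsion = 0) (a b : E) :
    christoffel nabla q y a b = christoffel nabla q y b a := by
  have : CompleteSpace E := FiniteDimensional.complete ℝ E
  have h := nabla.torsion_eq_zero_iff.1 ht (mdifferentiableAt_frameL hy b)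
    (mdifferentiableAt_frameL hy a)
  rw [mlieBracket_frameL hy, sub_eq_zero] at h
  have h1 := christoffel_apply (nabla := nabla) hy a (frameL q y b)
  have h2 := christoffel_apply (nabla := nabla) hy b (frameL q y a)
  rw [coord_frameL hy] at h1 h2
  rw [h1, h2, h]

lemma extend_eventuallyEq_frameL (hy : y ∈ (chartAt E q).source) (w : TangentSpace 𝓘(ℝ, E) q) :
    ∀ᶠ z in 𝓝 y, FiberBundle.extend E w z = frameL q z (coord q q w) := by
  filter_upwards [(chartAt E q).open_source.mem_nhds hy] with z hz
    using extend_apply_eq_frameL hz w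

lemma mdifferentiableAt_extend (hy : y ∈ (chartAt E q).source) (w : TangentSpace 𝓘(ℝ, E) q) :
    MDifferentiableAt 𝓘(ℝ, E) 𝓘(ℝ, E).tangent
      (fun z => (⟨z, FiberBundle.extend E w z⟩ : TangentBundle 𝓘(ℝ, E) M)) y :=
  (mdifferentiableAt_frameL hy (coord q q w)).congr_of_eventuallyEq
    ((extend_eventuallyEq_frameL hy w).mono fun z hz => by simp [hz])

lemma nabla_extend (hy : y ∈ (chartAt E q).source) (w : TangentSpace 𝓘(ℝ, E) q) :
    nabla (FiberBundle.extend E w) y = nabla (fun z => frameL q z (coord q q w)) y :=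
  nabla.isCovariantDerivativeOnUniv.congr_of_eventuallyEq (mdifferentiableAt_extend hy w)
    (mdifferentiableAt_frameL hy _) univ_mem (extend_eventuallyEq_frameL hy w)

variable [T2Space M]

/-- Throughout the chart domain the inner field has coordinates `Γ(w, v)` with `w`, `v` constant; a
second use of `coord_nabla` differentiates `Γ`. -/
lemma coord_nabla_nabla_extend (hn : nabla.ContMDiffCovariantDerivative ∞) {p : M}
    (u v w : TangentSpace 𝓘(ℝ, E) p) :
    coord p p (nabla (fun y => nabla (FiberBundle.extend E w) y (FiberBundle.extend E v y)) p u) =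
      mvfderiv 𝓘(ℝ, E) (christoffel nabla p) p u (coord p p w) (coord p p v) +
      christoffel nabla p p (christoffel nabla p p (coord p p w) (coord p p v)) (coord p p u) := by
  have hp : p ∈ (chartAt E p).source := mem_chart_source E p
  have hC := (contMDiffOn_christoffel hn p).contMDiffAt ((chartAt E p).open_source.mem_nhds hp)
  have hCd := hC.mdifferentiableAt (by simp)
  have hloc : ∀ z ∈ (chartAt E p).source,
      coord p z (nabla (FiberBundle.extend E w) z (FiberBundle.extend E v z)) =
        christoffel nabla p z (coord p p w) (coord p p v) := by
    intro z hz
    rw [nabla_extend hz, ← christoffel_apply hz, extend_apply_eq_frameL hz, coord_frameL hz]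
  have hev : (fun z => coord p z (nabla (FiberBundle.extend E w) z (FiberBundle.extend E v z)))
      =ᶠ[𝓝 p] fun z => christoffel nabla p z (coord p p w) (coord p p v) := by
    filter_upwards [(chartAt E p).open_source.mem_nhds hp] with z hz using hloc z hz
  let ev : (E →L[ℝ] E →L[ℝ] E) →L[ℝ] E :=
    (ContinuousLinearMap.apply ℝ E (coord p p v)) ∘L
      (ContinuousLinearMap.apply ℝ (E →L[ℝ] E) (coord p p w))
  have hd : HasMFDerivAt 𝓘(ℝ, E) 𝓘(ℝ, E)
      (fun z => christoffel nabla p z (coord p p w) (coord p p v)) p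
      (ev ∘L mfderiv 𝓘(ℝ, E) 𝓘(ℝ, E →L[ℝ] E →L[ℝ] E) (christoffel nabla p) p) :=
    ev.hasMFDerivAt.comp p hCd.hasMFDerivAt
  have hY : MDifferentiableAt 𝓘(ℝ, E) 𝓘(ℝ, E).tangent (fun y => (⟨y, nabla (FiberBundle.extend E w)
      y (FiberBundle.extend E v y)⟩ : TangentBundle 𝓘(ℝ, E) M)) p := by
    rw [mdifferentiableAt_section]
    exact (hd.congr_of_eventuallyEq hev).mdifferentiableAt
  rw [coord_nabla hp hY, hloc p hp]
  congr 1
  exact congr($((hd.congr_of_eventuallyEq hev).mfderiv) u)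

/-- The extensions have constant coefficients, so their bracket vanishes and only the two second
covariant derivatives contribute. -/
lemma coord_curvature (hn : nabla.ContMDiffCovariantDerivative ∞) {p : M}
    (u v w : TangentSpace 𝓘(ℝ, E) p) :
    coord p p (curvature nabla u v w) =
      mvfderiv 𝓘(ℝ, E) (christoffel nabla p) p u (coord p p w) (coord p p v) -
      mvfderiv 𝓘(ℝ, E) (christoffel nabla p) p v (coord p p w) (coord p p u) +
      christoffel nabla p p (christoffel nabla p p (coord p p w) (coord p p v)) (coord p p u) -
      christoffel nabla p p (christoffel nabla p p (coord p p w) (coord p p u)) (coord p p v) := by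
  have hp : p ∈ (chartAt E p).source := mem_chart_source E p
  have hb : VectorField.mlieBracket 𝓘(ℝ, E) (FiberBundle.extend E u) (FiberBundle.extend E v) p
      = 0 := by
    rw [Filter.EventuallyEq.mlieBracket_vectorField_eq (extend_eventuallyEq_frameL hp u)
      (extend_eventuallyEq_frameL hp v), mlieBracket_frameL hp]
  unfold curvature curvatureField
  rw [hb, map_zero, sub_zero, FiberBundle.extend_apply_self, FiberBundle.extend_apply_self,
    coord_sub hp, coord_nabla_nabla_extend hn, coord_nabla_nabla_extend hn]
  abel

end CurvatureCoordinates

/-! ### Covariant differentiation of vector fields along a map -/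

section Along

variable {E : Type*} [NormedAddCommGroup E] [NormedSpace ℝ E]
  {M : Type*} [TopologicalSpace M] [ChartedSpace E M] [IsManifold 𝓘(ℝ, E) ∞ M]
  {F : Type*} [NormedAddCommGroup F] [NormedSpace ℝ F]

/-- The derivative of `f` within `S`, as a linear map into the tangent space at `f z`. -/
def dirVelocityL (S : Set F) (f : F → M) (z : F) : F →L[ℝ] TangentSpace 𝓘(ℝ, E) (f z) :=
  mfderivWithin 𝓘(ℝ, F) 𝓘(ℝ, E) f S z

/-- The derivative of `f` within `S` in the direction `h`, a vector field along `f`. -/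
def dirVelocity (S : Set F) (f : F → M) (h z : F) : TangentSpace 𝓘(ℝ, E) (f z) :=
  dirVelocityL S f z h

/-- The covariant derivative in the direction `h`, within `S`, of a vector field `W` along a map
`f : F → M` from a normed space. -/
def covDerivAlong (nabla : CovariantDerivative 𝓘(ℝ, E) E (fun p : M => TangentSpace 𝓘(ℝ, E) p))
    (S : Set F) (f : F → M) (W : ∀ z, TangentSpace 𝓘(ℝ, E) (f z)) (h z : F) :
    TangentSpace 𝓘(ℝ, E) (f z) :=
  frameL (f z) (f z) (fderivWithin ℝ (fun ζ => coord (f z) (f ζ) (W ζ)) S z h) +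
    nabla (FiberBundle.extend E (W z)) (f z) (dirVelocity S f h z)

/-- `W` is a smooth vector field along `f` on `S`. -/
def SmoothAlong (S : Set F) (f : F → M) (W : ∀ z, TangentSpace 𝓘(ℝ, E) (f z)) : Prop :=
  ContMDiffOn 𝓘(ℝ, F) 𝓘(ℝ, E).tangent ∞ (fun z => (⟨f z, W z⟩ : TangentBundle 𝓘(ℝ, E) M)) S

variable {nabla : CovariantDerivative 𝓘(ℝ, E) E (fun p : M => TangentSpace 𝓘(ℝ, E) p)}
  {S : Set F} {f : F → M} {W : ∀ z, TangentSpace 𝓘(ℝ, E) (f z)} {z : F} {q : M}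

lemma SmoothAlong.base (hW : SmoothAlong S f W) : ContMDiffOn 𝓘(ℝ, F) 𝓘(ℝ, E) ∞ f S :=
  fun z hz => ((contMDiffWithinAt_tangent_iff (mem_chart_source E (f z))).1 (hW z hz)).1

lemma SmoothAlong.mdifferentiableWithinAt (hW : SmoothAlong S f W) (hz : z ∈ S) :
    MDifferentiableWithinAt 𝓘(ℝ, F) 𝓘(ℝ, E).tangent
      (fun z => (⟨f z, W z⟩ : TangentBundle 𝓘(ℝ, E) M)) S z :=
  (hW z hz).mdifferentiableWithinAt (by simp)

lemma SmoothAlong.coord (hW : SmoothAlong S f W) (hz : z ∈ S) (hq : f z ∈ (chartAt E q).source) :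
    ContDiffWithinAt ℝ ∞ (fun ζ => coord q (f ζ) (W ζ)) S z :=
  ((contMDiffWithinAt_tangent_iff hq).1 (hW z hz)).2

lemma hasFDerivWithinAt_comp_mvfderiv {G : Type*} [NormedAddCommGroup G] [NormedSpace ℝ G]
    {K : M → G} (hK : MDifferentiableAt 𝓘(ℝ, E) 𝓘(ℝ, G) K (f z))
    (hf : MDifferentiableWithinAt 𝓘(ℝ, F) 𝓘(ℝ, E) f S z) :
    HasFDerivWithinAt (fun ζ => K (f ζ))
      (mvfderiv 𝓘(ℝ, E) K (f z) ∘L dirVelocityL S f z) S z :=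
  hasMFDerivWithinAt_iff_hasFDerivWithinAt.1
    (hK.hasMFDerivAt.comp_hasMFDerivWithinAt z hf.hasMFDerivWithinAt)

lemma fderivWithin_comp_eq {G : Type*} [NormedAddCommGroup G] [NormedSpace ℝ G]
    {K : M → G} (hK : MDifferentiableAt 𝓘(ℝ, E) 𝓘(ℝ, G) K (f z))
    (hf : MDifferentiableWithinAt 𝓘(ℝ, F) 𝓘(ℝ, E) f S z) (hS : UniqueDiffWithinAt ℝ S z) (h : F) :
    fderivWithin ℝ (fun ζ => K (f ζ)) S z h = mvfderiv 𝓘(ℝ, E) K (f z) (dirVelocity S f h z) := by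
  rw [(hasFDerivWithinAt_comp_mvfderiv hK hf).fderivWithin hS]
  rfl

lemma eventually_mem_source (hf : ContinuousWithinAt f S z) (hq : f z ∈ (chartAt E q).source) :
    ∀ᶠ ζ in 𝓝[S] z, f ζ ∈ (chartAt E q).source :=
  hf.eventually ((chartAt E q).open_source.mem_nhds hq)

lemma coord_dirVelocity (hf : MDifferentiableWithinAt 𝓘(ℝ, F) 𝓘(ℝ, E) f S z)
    (hS : UniqueDiffWithinAt ℝ S z) (hq : f z ∈ (chartAt E q).source) (h : F) :
    coord q (f z) (dirVelocity S f h z) =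
      fderivWithin ℝ (fun ζ => extChartAt 𝓘(ℝ, E) q (f ζ)) S z h := by
  rw [fderivWithin_comp_eq (mdifferentiableAt_extChartAt hq) hf hS, coord_eq_mfderiv hq]
  rfl

lemma contDiffWithinAt_extChartAt_comp (hf : ContMDiffWithinAt 𝓘(ℝ, F) 𝓘(ℝ, E) ∞ f S z)
    (hq : f z ∈ (chartAt E q).source) :
    ContDiffWithinAt ℝ ∞ (fun ζ => extChartAt 𝓘(ℝ, E) q (f ζ)) S z := by
  rw [← contMDiffWithinAt_iff_contDiffWithinAt]
  exact (contMDiffOn_extChartAt.contMDiffAt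
    ((chartAt E q).open_source.mem_nhds hq)).comp_contMDiffWithinAt z hf

lemma coord_dirVelocity_eventuallyEq (hf : ContMDiffOn 𝓘(ℝ, F) 𝓘(ℝ, E) ∞ f S)
    (hS : UniqueDiffOn ℝ S) (hz : z ∈ S) (hq : f z ∈ (chartAt E q).source) (h : F) :
    (fun ζ => coord q (f ζ) (dirVelocity S f h ζ)) =ᶠ[𝓝[S] z]
      fun ζ => fderivWithin ℝ (fun ζ => extChartAt 𝓘(ℝ, E) q (f ζ)) S ζ h := by
  filter_upwards [self_mem_nhdsWithin, eventually_mem_source (hf z hz).continuousWithinAt hq]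
    with ζ hζ hqζ
  exact coord_dirVelocity ((hf ζ hζ).mdifferentiableWithinAt (by simp)) (hS ζ hζ) hqζ h

lemma smoothAlong_dirVelocity (hf : ContMDiffOn 𝓘(ℝ, F) 𝓘(ℝ, E) ∞ f S)
    (hS : UniqueDiffOn ℝ S) (h : F) : SmoothAlong S f (dirVelocity (E := E) S f h) := by
  intro z hz
  have hq := mem_chart_source E (f z)
  refine (contMDiffWithinAt_tangent_iff hq).2 ⟨hf z hz, ?_⟩
  refine ContDiffWithinAt.congr_of_eventuallyEq ?_
    (coord_dirVelocity_eventuallyEq hf hS hz hq h)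
    (coord_dirVelocity ((hf z hz).mdifferentiableWithinAt (by simp)) (hS z hz) hq h)
  exact ((contDiffWithinAt_extChartAt_comp (hf z hz) hq).fderivWithin_right hS (by simp) hz).clm_apply
    contDiffWithinAt_const

variable [FiniteDimensional ℝ E]

/-- The definition of `covDerivAlong` uses the chart at `f z`, which moves with `z`. To
differentiate the result once more, a formula in one fixed chart `q` is needed. The derivative of
the coordinate change occurs on both sides and matches. -/
lemma coord_covDerivAlong
    (hW : MDifferentiableWithinAt 𝓘(ℝ, F) 𝓘(ℝ, E).tangent
      (fun z => (⟨f z, W z⟩ : TangentBundle 𝓘(ℝ, E) M)) S z)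
    (hS : UniqueDiffWithinAt ℝ S z) (hq : f z ∈ (chartAt E q).source) (h : F) :
    coord q (f z) (covDerivAlong nabla S f W h z) =
      fderivWithin ℝ (fun ζ => coord q (f ζ) (W ζ)) S z h +
        christoffel nabla q (f z) (coord q (f z) (W z))
          (coord q (f z) (dirVelocity S f h z)) := by
  have hp := mem_chart_source E (f z)
  obtain ⟨hf, hWp⟩ := (mdifferentiableWithinAt_tangent_iff hp).1 hW
  let ep := trivializationAt E (fun p : M => TangentSpace 𝓘(ℝ, E) p) (f z)
  let eq := trivializationAt E (fun p : M => TangentSpace 𝓘(ℝ, E) p) q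
  let K : M → E →L[ℝ] E := fun y => (ep.coordChangeL ℝ eq y : E →L[ℝ] E)
  have hK : MDifferentiableAt 𝓘(ℝ, E) 𝓘(ℝ, E →L[ℝ] E) K (f z) :=
    mdifferentiableAt_coordChangeL (e := ep) (e' := eq) hp hq
  have hKapp : ∀ y ∈ (chartAt E (f z)).source, y ∈ (chartAt E q).source → ∀ v,
      K y v = coord q y (frameL (f z) y v) := by
    intro y hy hy' v
    refine (Trivialization.coordChangeL_apply ep eq (b := y) ⟨hy, hy'⟩ v).trans ?_
    rw [symm_eq_frameL hy]
    rfl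
  have hKf := hasFDerivWithinAt_comp_mvfderiv hK hf
  have hprod := hKf.clm_apply hWp.hasFDerivWithinAt
  have hev : (fun ζ => coord q (f ζ) (W ζ)) =ᶠ[𝓝[S] z]
      fun ζ => K (f ζ) (coord (f z) (f ζ) (W ζ)) := by
    filter_upwards [eventually_mem_source hf.continuousWithinAt hp,
      eventually_mem_source hf.continuousWithinAt hq] with ζ h1 h2
    rw [hKapp _ h1 h2, frameL_coord h1]
  have hz : coord q (f z) (W z) = K (f z) (coord (f z) (f z) (W z)) := by
    rw [hKapp _ hp hq, frameL_coord hp]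
  rw [(hprod.congr_of_eventuallyEq hev hz).fderivWithin hS, covDerivAlong, coord_add hq,
    coord_nabla hq (mdifferentiableAt_extend hp _), FiberBundle.extend_apply_self]
  -- In the chart at `q` the extension no longer has constant coordinates; the derivative of `K` it
  -- contributes is the one produced by the product rule in `hprod`.
  have hev2 : (fun y => coord q y (FiberBundle.extend E (W z) y)) =ᶠ[𝓝 (f z)]
      fun y => K y (coord (f z) (f z) (W z)) := by
    filter_upwards [(chartAt E (f z)).open_source.mem_nhds hp,
      (chartAt E q).open_source.mem_nhds hq] with y h1 h2
    rw [hKapp y h1 h2, extend_apply_eq_frameL h1]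
  let ev : (E →L[ℝ] E) →L[ℝ] E := ContinuousLinearMap.apply ℝ E (coord (f z) (f z) (W z))
  have hd : HasMFDerivAt 𝓘(ℝ, E) 𝓘(ℝ, E) (fun y => K y (coord (f z) (f z) (W z))) (f z)
      (ev ∘L mfderiv 𝓘(ℝ, E) 𝓘(ℝ, E →L[ℝ] E) K (f z)) :=
    ev.hasMFDerivAt.comp (f z) hK.hasMFDerivAt
  have h1 : mvfderiv 𝓘(ℝ, E) (fun y => coord q y (FiberBundle.extend E (W z) y)) (f z)
      (dirVelocity S f h z) = mvfderiv 𝓘(ℝ, E) K (f z) (dirVelocity S f h z)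
        (coord (f z) (f z) (W z)) :=
    congr($((hd.congr_of_eventuallyEq hev2).mfderiv) (dirVelocity S f h z))
  rw [h1, ← hKapp _ hp hq, ← add_assoc]
  rfl

variable [T2Space M]

lemma contDiffWithinAt_christoffel_comp (hn : nabla.ContMDiffCovariantDerivative ∞)
    (hf : ContMDiffWithinAt 𝓘(ℝ, F) 𝓘(ℝ, E) ∞ f S z) (hq : f z ∈ (chartAt E q).source) :
    ContDiffWithinAt ℝ ∞ (fun ζ => christoffel nabla q (f ζ)) S z := by
  rw [← contMDiffWithinAt_iff_contDiffWithinAt]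
  exact ((contMDiffOn_christoffel hn q).contMDiffAt
    ((chartAt E q).open_source.mem_nhds hq)).comp_contMDiffWithinAt z hf

/-- An identity near `z` within `S`, rather than at `z` only, so that both sides may be
differentiated there. -/
lemma coord_covDerivAlong_eventuallyEq (hW : SmoothAlong S f W) (hS : UniqueDiffOn ℝ S)
    (hz : z ∈ S) (hq : f z ∈ (chartAt E q).source) (h : F) :
    (fun ζ => coord q (f ζ) (covDerivAlong nabla S f W h ζ)) =ᶠ[𝓝[S] z]
      fun ζ => fderivWithin ℝ (fun ζ => coord q (f ζ) (W ζ)) S ζ h +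
        christoffel nabla q (f ζ) (coord q (f ζ) (W ζ))
          (fderivWithin ℝ (fun ζ => extChartAt 𝓘(ℝ, E) q (f ζ)) S ζ h) := by
  filter_upwards [self_mem_nhdsWithin, eventually_mem_source (hW.base z hz).continuousWithinAt hq]
    with ζ hζ hqζ
  rw [coord_covDerivAlong (hW.mdifferentiableWithinAt hζ) (hS ζ hζ) hqζ,
    coord_dirVelocity ((hW.base ζ hζ).mdifferentiableWithinAt (by simp)) (hS ζ hζ) hqζ]

lemma smoothAlong_covDerivAlong (hn : nabla.ContMDiffCovariantDerivative ∞)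
    (hW : SmoothAlong S f W) (hS : UniqueDiffOn ℝ S) (h : F) :
    SmoothAlong S f (covDerivAlong nabla S f W h) := by
  intro z hz
  have hq := mem_chart_source E (f z)
  refine (contMDiffWithinAt_tangent_iff hq).2 ⟨hW.base z hz, ?_⟩
  have hev := coord_covDerivAlong_eventuallyEq (nabla := nabla) hW hS hz hq h
  refine ContDiffWithinAt.congr_of_eventuallyEq ?_ hev (hev.self_of_nhdsWithin hz)
  refine ContDiffWithinAt.add ?_ ?_
  · exact ((hW.coord hz hq).fderivWithin_right hS (by simp) hz).clm_apply contDiffWithinAt_const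
  · exact ((contDiffWithinAt_christoffel_comp hn (hW.base z hz) hq).clm_apply
      (hW.coord hz hq)).clm_apply
      (((contDiffWithinAt_extChartAt_comp (hW.base z hz) hq).fderivWithin_right hS (by simp)
        hz).clm_apply contDiffWithinAt_const)

/-- The covariant derivatives of the two partial velocities of a map agree, as the connection is
torsion-free. -/
lemma covDerivAlong_dirVelocity_comm (ht : nabla.torsion = 0)
    (hf : ContMDiffOn 𝓘(ℝ, F) 𝓘(ℝ, E) ∞ f S) (hS : UniqueDiffOn ℝ S) (hz : z ∈ S)
    (hz' : z ∈ closure (interior S)) (h k : F) :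
    covDerivAlong nabla S f (dirVelocity S f k) h z =
      covDerivAlong nabla S f (dirVelocity S f h) k z := by
  have hq := mem_chart_source E (f z)
  apply coord_injective hq
  have hd := fun h => (smoothAlong_dirVelocity hf hS h).mdifferentiableWithinAt hz
  have hc := contDiffWithinAt_extChartAt_comp (hf z hz) hq
  -- Second derivatives within `S` are symmetric even at boundary points, provided these are limits
  -- of interior points; this is the role of `hz'`.
  have hsymm := hc.isSymmSndFDerivWithinAt (by simpa using ENat.LEInfty.out) hS hz' hz
  have hdiff : DifferentiableWithinAt ℝ
      (fderivWithin ℝ (fun ζ => extChartAt 𝓘(ℝ, E) (f z) (f ζ)) S) S z :=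
    (hc.fderivWithin_right (m := 1) hS (by rw [one_add_one_eq_two]; exact ENat.LEInfty.out) hz).differentiableWithinAt (by simp)
  have hsnd : ∀ h k, fderivWithin ℝ (fun ζ => coord (f z) (f ζ) (dirVelocity S f k ζ)) S z h =
      fderivWithin ℝ (fderivWithin ℝ (fun ζ => extChartAt 𝓘(ℝ, E) (f z) (f ζ)) S) S z h k := by
    intro h k
    rw [(coord_dirVelocity_eventuallyEq hf hS hz hq k).fderivWithin_eq
      ((coord_dirVelocity_eventuallyEq hf hS hz hq k).self_of_nhdsWithin hz)]
    rw [(hdiff.hasFDerivWithinAt.clm_apply (hasFDerivWithinAt_const k z S)).fderivWithin (hS z hz)]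
    simp
  rw [coord_covDerivAlong (hd k) (hS z hz) hq, coord_covDerivAlong (hd h) (hS z hz) hq,
    hsnd, hsnd, christoffel_symm hq ht]
  congr 1
  exact hsymm.eq h k

/-- The commutator of covariant derivatives along a map is the curvature. -/
lemma covDerivAlong_comm (hn : nabla.ContMDiffCovariantDerivative ∞)
    (hW : SmoothAlong S f W) (hS : UniqueDiffOn ℝ S) (hz : z ∈ S)
    (hz' : z ∈ closure (interior S)) (h k : F) :
    covDerivAlong nabla S f (covDerivAlong nabla S f W k) h z =
      covDerivAlong nabla S f (covDerivAlong nabla S f W h) k z +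
        curvature nabla (dirVelocity S f h z) (dirVelocity S f k z) (W z) := by
  have hq := mem_chart_source E (f z)
  apply coord_injective hq
  have hf := hW.base
  have hd := fun h => (smoothAlong_covDerivAlong hn hW hS h).mdifferentiableWithinAt hz
  have hc := contDiffWithinAt_extChartAt_comp (hf z hz) hq
  have hw := hW.coord hz hq
  have hcsymm := hc.isSymmSndFDerivWithinAt (by simpa using ENat.LEInfty.out) hS hz' hz
  have hwsymm := hw.isSymmSndFDerivWithinAt (by simpa using ENat.LEInfty.out) hS hz' hz
  have hcd := ((hc.fderivWithin_right (m := 1) hS (by rw [one_add_one_eq_two]; exact ENat.LEInfty.out) hz).differentiableWithinAt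
    (by simp)).hasFDerivWithinAt
  have hwd := ((hw.fderivWithin_right (m := 1) hS (by rw [one_add_one_eq_two]; exact ENat.LEInfty.out) hz).differentiableWithinAt
    (by simp)).hasFDerivWithinAt
  have hw1 := (hw.differentiableWithinAt (by simp)).hasFDerivWithinAt
  have hfd := (hf z hz).mdifferentiableWithinAt (n := ∞) (by simp)
  have hC := ((contMDiffOn_christoffel hn (f z)).contMDiffAt
    ((chartAt E (f z)).open_source.mem_nhds hq)).mdifferentiableAt (n := ∞) (by simp)
  have hA := hasFDerivWithinAt_comp_mvfderiv hC hfd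
  -- The second derivatives of `W` and `f` are symmetric in `h`, `k`, and so is the sum of the two
  -- terms with one derivative of `W`. The antisymmetric rest is the expression in
  -- `coord_curvature`.
  have hsnd : ∀ h k, coord (f z) (f z) (covDerivAlong nabla S f (covDerivAlong nabla S f W k) h z)
      = fderivWithin ℝ (fderivWithin ℝ (fun ζ => coord (f z) (f ζ) (W ζ)) S) S z h k +
        (mvfderiv 𝓘(ℝ, E) (christoffel nabla (f z)) (f z) (dirVelocity S f h z)
          (coord (f z) (f z) (W z)) (coord (f z) (f z) (dirVelocity S f k z)) +
        christoffel nabla (f z) (f z)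
          (fderivWithin ℝ (fun ζ => coord (f z) (f ζ) (W ζ)) S z h)
          (coord (f z) (f z) (dirVelocity S f k z)) +
        christoffel nabla (f z) (f z) (coord (f z) (f z) (W z))
          (fderivWithin ℝ (fderivWithin ℝ (fun ζ => extChartAt 𝓘(ℝ, E) (f z) (f ζ)) S) S z h k)) +
        (christoffel nabla (f z) (f z)
          (fderivWithin ℝ (fun ζ => coord (f z) (f ζ) (W ζ)) S z k)
          (coord (f z) (f z) (dirVelocity S f h z)) +
        christoffel nabla (f z) (f z) (christoffel nabla (f z) (f z) (coord (f z) (f z) (W z))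
          (coord (f z) (f z) (dirVelocity S f k z)))
          (coord (f z) (f z) (dirVelocity S f h z))) := by
    intro h k
    have hev := coord_covDerivAlong_eventuallyEq (nabla := nabla) hW hS hz hq k
    rw [coord_covDerivAlong (hd k) (hS z hz) hq, hev.fderivWithin_eq (hev.self_of_nhdsWithin hz),
      coord_covDerivAlong (hW.mdifferentiableWithinAt hz) (hS z hz) hq, map_add, add_apply]
    congr 1
    have hder := (hwd.clm_apply (hasFDerivWithinAt_const k z S)).add
      ((hA.clm_apply hw1).clm_apply (hcd.clm_apply (hasFDerivWithinAt_const k z S)))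
    refine congr($(hder.fderivWithin (hS z hz)) h).trans ?_
    simp only [coord_dirVelocity hfd (hS z hz) hq]
    simp [dirVelocity]
    abel
  rw [coord_add hq, coord_curvature hn, hsnd, hsnd, hcsymm.eq h k, hwsymm.eq h k]
  abel

end Along

/-- Shortcut instance: the search for it is slow in the presence of tangent spaces. -/
instance bilinFormNormedAddCommGroup {E : Type*} [NormedAddCommGroup E] [NormedSpace ℝ E] :
    NormedAddCommGroup (E →L[ℝ] E →L[ℝ] ℝ) :=
  ContinuousLinearMap.toNormedAddCommGroup

/-- Shortcut instance: the search for it is slow in the presence of tangent spaces. -/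
instance bilinFormNormedSpace {E : Type*} [NormedAddCommGroup E] [NormedSpace ℝ E] :
    NormedSpace ℝ (E →L[ℝ] E →L[ℝ] ℝ) :=
  ContinuousLinearMap.toNormedSpace

/-! ### Metric compatibility and the symmetries of the curvature tensor -/

section Metric

variable {E : Type*} [NormedAddCommGroup E] [NormedSpace ℝ E] [FiniteDimensional ℝ E]
  {M : Type*} [TopologicalSpace M] [ChartedSpace E M] [IsManifold 𝓘(ℝ, E) ∞ M]
  [RiemannianBundle (fun p : M => TangentSpace 𝓘(ℝ, E) p)]
  [IsContMDiffRiemannianBundle 𝓘(ℝ, E) ∞ E (fun p : M => TangentSpace 𝓘(ℝ, E) p)]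
  {F : Type*} [NormedAddCommGroup F] [NormedSpace ℝ F]
  {nabla : CovariantDerivative 𝓘(ℝ, E) E (fun p : M => TangentSpace 𝓘(ℝ, E) p)}
  {S : Set F} {f : F → M} {W Z : ∀ z, TangentSpace 𝓘(ℝ, E) (f z)} {z : F} {q : M}

/-- The metric is a smooth section of the bundle of bilinear forms; `g` is its expression in the
trivialization at `q`. It turns an inner product along a map into a product of three differentiable
factors. -/
lemma exists_gram (q : M) : ∃ g : M → E →L[ℝ] E →L[ℝ] ℝ,
    MDifferentiableAt 𝓘(ℝ, E) 𝓘(ℝ, E →L[ℝ] E →L[ℝ] ℝ) g q ∧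
    ∀ y ∈ (chartAt E q).source, ∀ a b, g y a b = inner ℝ (frameL q y a) (frameL q y b) := by
  obtain ⟨g, hg, hgi⟩ := IsContMDiffRiemannianBundle.exists_contMDiff (IB := 𝓘(ℝ, E)) (n := ∞)
    (F := E) (E := fun p : M => TangentSpace 𝓘(ℝ, E) p)
  have h := (contMDiffAt_section q).1 (hg q)
  refine ⟨_, h.mdifferentiableAt (by simp), fun y hy a b => ?_⟩
  rw [hgi, hom_trivializationAt_apply]
  refine (inCoordinates_apply_eq₂ (F₁ := E) (F₂ := E) (F₃ := ℝ)
    (E₁ := fun p : M => TangentSpace 𝓘(ℝ, E) p) (E₂ := fun p : M => TangentSpace 𝓘(ℝ, E) p)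
    (E₃ := fun _ : M => ℝ) hy hy (mem_univ _)).trans ?_
  rw [symm_eq_frameL hy, symm_eq_frameL hy]
  simp

lemma SmoothAlong.contDiffOn_inner (hW : SmoothAlong S f W) (hZ : SmoothAlong S f Z) :
    ContDiffOn ℝ ∞ (fun ζ => inner ℝ (W ζ) (Z ζ)) S := by
  have h : ContMDiffOn 𝓘(ℝ, F) 𝓘(ℝ, ℝ) ∞ (fun ζ => inner ℝ (W ζ) (Z ζ)) S :=
    ContMDiffOn.inner_bundle (IB := 𝓘(ℝ, E)) (b := f) (v := W) (w := Z) hW hZ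
  exact h.contDiffOn

/-- The product rule for the inner product of two vector fields along a map. -/
lemma fderivWithin_inner (hnabla : IsRiemannianConnection nabla)
    (hW : MDifferentiableWithinAt 𝓘(ℝ, F) 𝓘(ℝ, E).tangent
      (fun z => (⟨f z, W z⟩ : TangentBundle 𝓘(ℝ, E) M)) S z)
    (hZ : MDifferentiableWithinAt 𝓘(ℝ, F) 𝓘(ℝ, E).tangent
      (fun z => (⟨f z, Z z⟩ : TangentBundle 𝓘(ℝ, E) M)) S z)
    (hS : UniqueDiffWithinAt ℝ S z) (h : F) :
    fderivWithin ℝ (fun ζ => inner ℝ (W ζ) (Z ζ)) S z h =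
      inner ℝ (covDerivAlong nabla S f W h z) (Z z) +
        inner ℝ (W z) (covDerivAlong nabla S f Z h z) := by
  have hp := mem_chart_source E (f z)
  obtain ⟨hf, hw⟩ := (mdifferentiableWithinAt_tangent_iff hp).1 hW
  obtain ⟨-, hz⟩ := (mdifferentiableWithinAt_tangent_iff hp).1 hZ
  obtain ⟨g, hg, hgi⟩ := exists_gram (E := E) (f z)
  have hev : (fun ζ => inner ℝ (W ζ) (Z ζ)) =ᶠ[𝓝[S] z] fun ζ =>
      g (f ζ) (coord (f z) (f ζ) (W ζ)) (coord (f z) (f ζ) (Z ζ)) := by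
    filter_upwards [eventually_mem_source hf.continuousWithinAt hp] with ζ hζ
    rw [hgi _ hζ, frameL_coord hζ, frameL_coord hζ]
  have hev0 : inner ℝ (W z) (Z z) = g (f z) (coord (f z) (f z) (W z)) (coord (f z) (f z) (Z z)) := by
    rw [hgi _ hp, frameL_coord hp, frameL_coord hp]
  have hder := ((hasFDerivWithinAt_comp_mvfderiv hg hf).clm_apply hw.hasFDerivWithinAt).clm_apply
    hz.hasFDerivWithinAt
  -- Metric compatibility for frame fields gives the derivative of the Gram form, whose two terms
  -- are the connection terms of `covDerivAlong` for `W` and `Z`.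
  have hgd : ∀ a b, ∀ u : TangentSpace 𝓘(ℝ, E) (f z), mvfderiv 𝓘(ℝ, E) g (f z) u a b =
      inner ℝ (nabla (fun y => frameL (f z) y a) (f z) u) (frameL (f z) (f z) b) +
      inner ℝ (frameL (f z) (f z) a) (nabla (fun y => frameL (f z) y b) (f z) u) := by
    intro a b u
    rw [← hnabla.metric (f z) _ _ (mdifferentiableAt_frameL hp a) (mdifferentiableAt_frameL hp b)]
    let ev : (E →L[ℝ] E →L[ℝ] ℝ) →L[ℝ] ℝ :=
      (ContinuousLinearMap.apply ℝ ℝ b) ∘L (ContinuousLinearMap.apply ℝ (E →L[ℝ] ℝ) a)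
    have hd : HasMFDerivAt 𝓘(ℝ, E) 𝓘(ℝ, ℝ) (fun y => g y a b) (f z)
        (ev ∘L mfderiv 𝓘(ℝ, E) 𝓘(ℝ, E →L[ℝ] E →L[ℝ] ℝ) g (f z)) :=
      ev.hasMFDerivAt.comp (f z) hg.hasMFDerivAt
    have he : (fun y => inner ℝ (frameL (f z) y a) (frameL (f z) y b)) =ᶠ[𝓝 (f z)]
        fun y => g y a b := by
      filter_upwards [(chartAt E (f z)).open_source.mem_nhds hp] with y hy
      rw [hgi y hy]
    exact congr($((hd.congr_of_eventuallyEq he).mfderiv) u).symm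
  rw [(hder.congr_of_eventuallyEq hev hev0).fderivWithin hS]
  have h2 := hgd (coord (f z) (f z) (W z)) (coord (f z) (f z) (Z z)) (dirVelocity S f h z)
  rw [← nabla_extend hp, ← nabla_extend hp, frameL_coord hp, frameL_coord hp] at h2
  have h3 := hgi _ hp (fderivWithin ℝ (fun ζ => coord (f z) (f ζ) (W ζ)) S z h)
    (coord (f z) (f z) (Z z))
  have h4 := hgi _ hp (coord (f z) (f z) (W z))
    (fderivWithin ℝ (fun ζ => coord (f z) (f ζ) (Z ζ)) S z h)
  rw [frameL_coord hp] at h3 h4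
  rw [covDerivAlong, covDerivAlong, inner_add_left, inner_add_right, ← h3, ← h4]
  have h5 : mvfderiv 𝓘(ℝ, E) g (f z) (dirVelocityL S f z h) (coord (f z) (f z) (W z))
    (coord (f z) (f z) (Z z)) = _ := h2
  simp only [add_apply, ContinuousLinearMap.comp_apply, ContinuousLinearMap.flip_apply, h5]
  ring

variable [T2Space M]

/-- The second derivative of the function `⟨W, Z⟩` is symmetric. Expanding it by the product rule,
the mixed terms cancel under exchange of `h` and `k`, and the commutators on `W` and on `Z` leave
the two curvature terms. -/
lemma inner_curvature_skew_of_smoothAlong (hnabla : IsRiemannianConnection nabla)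
    (hW : SmoothAlong S f W) (hZ : SmoothAlong S f Z) (hS : UniqueDiffOn ℝ S) (hz : z ∈ S)
    (hz' : z ∈ closure (interior S)) (h k : F) :
    inner ℝ (curvature nabla (dirVelocity S f h z) (dirVelocity S f k z) (W z)) (Z z) +
      inner ℝ (W z) (curvature nabla (dirVelocity S f h z) (dirVelocity S f k z) (Z z)) = 0 := by
  have hn := hnabla.smooth
  have hDW := fun k => smoothAlong_covDerivAlong hn hW hS k
  have hDZ := fun k => smoothAlong_covDerivAlong hn hZ hS k
  have hg := hW.contDiffOn_inner hZ z hz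
  have hsymm := hg.isSymmSndFDerivWithinAt (by simpa using ENat.LEInfty.out) hS hz' hz
  have hdiff : DifferentiableWithinAt ℝ
      (fderivWithin ℝ (fun ζ => inner ℝ (W ζ) (Z ζ)) S) S z :=
    (hg.fderivWithin_right (m := 1) hS (by rw [one_add_one_eq_two]; exact ENat.LEInfty.out)
      hz).differentiableWithinAt (by simp)
  have key : ∀ h k, fderivWithin ℝ (fderivWithin ℝ (fun ζ => inner ℝ (W ζ) (Z ζ)) S) S z h k =
      inner ℝ (covDerivAlong nabla S f (covDerivAlong nabla S f W k) h z) (Z z) +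
      inner ℝ (covDerivAlong nabla S f W k z) (covDerivAlong nabla S f Z h z) +
      (inner ℝ (covDerivAlong nabla S f W h z) (covDerivAlong nabla S f Z k z) +
      inner ℝ (W z) (covDerivAlong nabla S f (covDerivAlong nabla S f Z k) h z)) := by
    intro h k
    have h1 : fderivWithin ℝ (fderivWithin ℝ (fun ζ => inner ℝ (W ζ) (Z ζ)) S) S z h k =
        fderivWithin ℝ (fun ζ => fderivWithin ℝ (fun ζ => inner ℝ (W ζ) (Z ζ)) S ζ k) S z h := by
      rw [(hdiff.hasFDerivWithinAt.clm_apply (hasFDerivWithinAt_const k z S)).fderivWithin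
        (hS z hz)]
      simp
    have h2 : EqOn (fun ζ => fderivWithin ℝ (fun ζ => inner ℝ (W ζ) (Z ζ)) S ζ k)
        (fun ζ => inner ℝ (covDerivAlong nabla S f W k ζ) (Z ζ) +
          inner ℝ (W ζ) (covDerivAlong nabla S f Z k ζ)) S := fun ζ hζ =>
      fderivWithin_inner hnabla (hW.mdifferentiableWithinAt hζ) (hZ.mdifferentiableWithinAt hζ)
        (hS ζ hζ) k
    rw [h1, fderivWithin_congr h2 (h2 hz), fderivWithin_fun_add (hS z hz)
      (((hDW k).contDiffOn_inner hZ z hz).differentiableWithinAt (by simp))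
      ((hW.contDiffOn_inner (hDZ k) z hz).differentiableWithinAt (by simp)), add_apply,
      fderivWithin_inner hnabla ((hDW k).mdifferentiableWithinAt hz)
        (hZ.mdifferentiableWithinAt hz) (hS z hz),
      fderivWithin_inner hnabla (hW.mdifferentiableWithinAt hz)
        ((hDZ k).mdifferentiableWithinAt hz) (hS z hz)]
  have h1 := hsymm.eq h k
  rw [key, key, covDerivAlong_comm hn hW hS hz hz' h k, covDerivAlong_comm hn hZ hS hz hz' h k,
    inner_add_left, inner_add_right] at h1
  linarith

section Pointwise

variable {p : M}

lemma curvature_self_swap (hn : nabla.ContMDiffCovariantDerivative ∞)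
    (u v w : TangentSpace 𝓘(ℝ, E) p) :
    curvature nabla u v w = - curvature nabla v u w := by
  have hp := mem_chart_source E p
  rw [eq_neg_iff_add_eq_zero]
  apply coord_injective hp
  rw [coord_add hp, coord_curvature hn, coord_curvature hn, ← coordL_apply hp 0, map_zero]
  abel

/-- Vanishing torsion makes `Γ`, and hence also its derivative, symmetric in the two lower
arguments; in the cyclic sum of `coord_curvature` all terms then cancel in pairs. -/
lemma curvature_bianchi (hnabla : IsRiemannianConnection nabla) (u v w : TangentSpace 𝓘(ℝ, E) p) :
    curvature nabla u v w + curvature nabla v w u + curvature nabla w u v = 0 := by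
  have hn := hnabla.smooth
  have hp := mem_chart_source E p
  have hC := ((contMDiffOn_christoffel hn p).contMDiffAt
    ((chartAt E p).open_source.mem_nhds hp)).mdifferentiableAt (n := ∞) (by simp)
  have hsymm : ∀ (u : TangentSpace 𝓘(ℝ, E) p) (a b : E),
      mvfderiv 𝓘(ℝ, E) (christoffel nabla p) p u a b =
        mvfderiv 𝓘(ℝ, E) (christoffel nabla p) p u b a := by
    intro u a b
    have hd : ∀ a b : E, HasMFDerivAt 𝓘(ℝ, E) 𝓘(ℝ, E) (fun y => christoffel nabla p y a b) p
        (((ContinuousLinearMap.apply ℝ E b) ∘L (ContinuousLinearMap.apply ℝ (E →L[ℝ] E) a)) ∘L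
          mfderiv 𝓘(ℝ, E) 𝓘(ℝ, E →L[ℝ] E →L[ℝ] E) (christoffel nabla p) p) := fun a b =>
      ((ContinuousLinearMap.apply ℝ E b) ∘L
        (ContinuousLinearMap.apply ℝ (E →L[ℝ] E) a)).hasMFDerivAt.comp p hC.hasMFDerivAt
    have he : (fun y => christoffel nabla p y a b) =ᶠ[𝓝 p] fun y => christoffel nabla p y b a := by
      filter_upwards [(chartAt E p).open_source.mem_nhds hp] with y hy
        using christoffel_symm hy hnabla.torsion_free a b
    exact congr($(hasMFDerivAt_unique (hd a b) ((hd b a).congr_of_eventuallyEq he)) u)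
  apply coord_injective hp
  have hs := christoffel_symm hp hnabla.torsion_free
  rw [coord_add hp, coord_add hp, coord_curvature hn, coord_curvature hn, coord_curvature hn,
    ← coordL_apply hp 0, map_zero, hsymm u (coord p p w), hsymm v (coord p p u),
    hsymm w (coord p p v), hs (coord p p w) (coord p p v), hs (coord p p w) (coord p p u),
    hs (coord p p u) (coord p p v)]
  abel

/-- The inverse chart, viewed as a map from an open set of `E`, has the coordinate frame as its
partial velocities. The identity along maps thus reaches arbitrary vectors at `p`, extended with
constant coefficients. -/
lemma inner_curvature_skew (hnabla : IsRiemannianConnection nabla)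
    (u v w x : TangentSpace 𝓘(ℝ, E) p) :
    inner ℝ (curvature nabla u v w) x = - inner ℝ (curvature nabla u v x) w := by
  have hn := hnabla.smooth
  have hp := mem_chart_source E p
  let φ := extChartAt 𝓘(ℝ, E) p
  have hopen : IsOpen φ.target := isOpen_extChartAt_target p
  have hz : φ p ∈ φ.target := mem_extChartAt_target p
  have hφ : φ.symm (φ p) = p := φ.left_inv (mem_extChartAt_source p)
  have hsrc : ∀ z ∈ φ.target, φ.symm z ∈ (chartAt E p).source := fun z hz => by
    simpa [φ] using φ.map_target hz
  have hf : ContMDiffOn 𝓘(ℝ, E) 𝓘(ℝ, E) ∞ φ.symm φ.target := contMDiffOn_extChartAt_symm p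
  have hW : ∀ a : E, SmoothAlong φ.target φ.symm fun z => frameL p (φ.symm z) a := fun a z hz =>
    ((contMDiffOn_frameL p a).contMDiffAt
      ((chartAt E p).open_source.mem_nhds (hsrc z hz))).comp_contMDiffWithinAt z (hf z hz)
  have hvel : ∀ h : E, dirVelocity φ.target φ.symm h (φ p) = frameL p (φ.symm (φ p)) h := by
    intro h
    have hq := hsrc _ hz
    apply coord_injective hq
    rw [coord_dirVelocity ((hf _ hz).mdifferentiableWithinAt (by simp))
      (hopen.uniqueDiffWithinAt hz) hq, coord_frameL hq]
    have he : EqOn (fun ζ => φ (φ.symm ζ)) id φ.target := fun ζ hζ => φ.right_inv hζ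
    rw [fderivWithin_congr he (he hz), fderivWithin_id (hopen.uniqueDiffWithinAt hz)]
    rfl
  have main := inner_curvature_skew_of_smoothAlong hnabla (hW (coord p p w)) (hW (coord p p x))
    hopen.uniqueDiffOn hz (by rw [hopen.interior_eq]; exact subset_closure hz)
    (coord p p u) (coord p p v)
  rw [hvel, hvel] at main
  -- The point `φ.symm (φ p)` equals `p` only propositionally, so it is replaced by a variable
  -- before the equality is used.
  have main' : ∀ y : M, y = p →
      inner ℝ (curvature nabla (frameL p y (coord p p u)) (frameL p y (coord p p v))
        (frameL p y (coord p p w))) (frameL p y (coord p p x)) +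
      inner ℝ (frameL p y (coord p p w)) (curvature nabla (frameL p y (coord p p u))
        (frameL p y (coord p p v)) (frameL p y (coord p p x))) = 0 →
      inner ℝ (curvature nabla u v w) x = - inner ℝ (curvature nabla u v x) w := by
    rintro y rfl hy
    simp only [frameL_coord hp] at hy
    rw [real_inner_comm _ w] at hy
    linarith
  exact main' _ hφ main

/-- The pair symmetry of the curvature tensor. -/
lemma inner_curvature_symm (hnabla : IsRiemannianConnection nabla)
    (u v w : TangentSpace 𝓘(ℝ, E) p) :
    inner ℝ (curvature nabla u v v) w = inner ℝ (curvature nabla w v v) u := by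
  have hn := hnabla.smooth
  have a1 := inner_curvature_skew hnabla w v v u
  have a2 := inner_curvature_skew hnabla u v v w
  -- This says `⟨R(u, w)v, v⟩ = 0`. With `v` repeated, a single Bianchi identity paired with `v` is
  -- enough.
  have a3 := inner_curvature_skew hnabla u w v v
  have b1 := congr(inner ℝ $(curvature_bianchi hnabla u w v) v)
  rw [inner_add_left, inner_add_left, inner_zero_left, curvature_self_swap hn v u,
    inner_neg_left] at b1
  linarith

end Pointwise

end Metric

/-! ### Covariant derivatives along curves and their relation to maps of two variables -/

section CurveDeriv

variable {E : Type*} [NormedAddCommGroup E] [NormedSpace ℝ E]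
  {M : Type*} [TopologicalSpace M] [ChartedSpace E M] [IsManifold 𝓘(ℝ, E) ∞ M]
  {F : Type*} [NormedAddCommGroup F] [NormedSpace ℝ F]
  {nabla : CovariantDerivative 𝓘(ℝ, E) E (fun p : M => TangentSpace 𝓘(ℝ, E) p)}

lemma covDeriv_eq_covDerivAlong (s : Set ℝ) (x : ℝ → M) (W : ∀ t, TangentSpace 𝓘(ℝ, E) (x t))
    (t : ℝ) : covDeriv nabla s x W t = covDerivAlong nabla s x W 1 t := by
  unfold covDeriv covDerivAlong
  rw [symm_eq_frameL (mem_chart_source E (x t))]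
  rfl

lemma velocity_comp {S : Set F} {f : F → M} {γ : ℝ → F} {I : Set ℝ} {h : F} {t : ℝ}
    (hγ : HasDerivWithinAt γ h I t) (hmaps : MapsTo γ I S) (hI : UniqueDiffWithinAt ℝ I t)
    (hf : MDifferentiableWithinAt 𝓘(ℝ, F) 𝓘(ℝ, E) f S (γ t)) :
    velocity (E := E) I (fun τ => f (γ τ)) t = dirVelocity S f h (γ t) := by
  have h1 : HasMFDerivWithinAt 𝓘(ℝ, ℝ) 𝓘(ℝ, F) γ I t (ContinuousLinearMap.toSpanSingleton ℝ h) :=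
    hγ.hasFDerivWithinAt.hasMFDerivWithinAt
  have h2 := hf.hasMFDerivWithinAt.comp t h1 hmaps
  have h3 := h2.mfderivWithin hI.uniqueMDiffWithinAt
  refine (congr($h3 (1 : ℝ))).trans ?_
  change mfderivWithin 𝓘(ℝ, F) 𝓘(ℝ, E) f S (γ t) ((1 : ℝ) • h) = _
  rw [one_smul]
  rfl

/-- Covariant differentiation commutes with restriction to a curve in the domain. It is used for
horizontal and vertical lines in a strip, and with `γ = id` for passing to a smaller interval. -/
lemma covDeriv_comp {S : Set F} {f : F → M} {W : ∀ z, TangentSpace 𝓘(ℝ, E) (f z)}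
    {γ : ℝ → F} {I : Set ℝ} {h : F} {t : ℝ}
    (hγ : HasDerivWithinAt γ h I t) (hmaps : MapsTo γ I S) (hI : UniqueDiffWithinAt ℝ I t)
    (hW : MDifferentiableWithinAt 𝓘(ℝ, F) 𝓘(ℝ, E).tangent
      (fun z => (⟨f z, W z⟩ : TangentBundle 𝓘(ℝ, E) M)) S (γ t)) :
    covDeriv nabla I (fun τ => f (γ τ)) (fun τ => W (γ τ)) t =
      covDerivAlong nabla S f W h (γ t) := by
  obtain ⟨hf, hw⟩ := (mdifferentiableWithinAt_tangent_iff (mem_chart_source E (f (γ t)))).1 hW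
  have h1 := hw.hasFDerivWithinAt.comp_hasDerivWithinAt t hγ hmaps
  have h2 : fderivWithin ℝ (fun τ => coord (f (γ t)) (f (γ τ)) (W (γ τ))) I t 1 =
      fderivWithin ℝ (fun ζ => coord (f (γ t)) (f ζ) (W ζ)) S (γ t) h := h1.derivWithin hI
  have h3 : dirVelocity I (fun τ => f (γ τ)) 1 t = dirVelocity S f h (γ t) :=
    velocity_comp hγ hmaps hI hf
  rw [covDeriv_eq_covDerivAlong, covDerivAlong, covDerivAlong, h2, h3]

lemma velocity_congr_set {s s' : Set ℝ} {x : ℝ → M} {t : ℝ} (h : s =ᶠ[𝓝 t] s') :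
    velocity (E := E) s x t = velocity s' x t := by
  unfold velocity
  rw [mfderivWithin_congr_set h]

lemma covDeriv_congr {s s' : Set ℝ} {x : ℝ → M} {W W' : ∀ t, TangentSpace 𝓘(ℝ, E) (x t)} {t : ℝ}
    (h : s =ᶠ[𝓝 t] s') (hW : ∀ᶠ τ in 𝓝[s] t, W τ = W' τ) (ht : W t = W' t) :
    covDeriv nabla s x W t = covDeriv nabla s' x W' t := by
  unfold covDeriv
  rw [velocity_congr_set h, ht, ← derivWithin_congr_set h]
  congr 2
  refine Filter.EventuallyEq.derivWithin_eq ?_ (by rw [ht])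
  filter_upwards [hW] with τ hτ
  rw [hτ]

lemma curveDeriv_congr_set {s s' : Set ℝ} {x : ℝ → M} (k : ℕ) {t : ℝ} (h : s =ᶠ[𝓝 t] s') :
    curveDeriv nabla s x k t = curveDeriv nabla s' x k t := by
  induction k generalizing t with
  | zero => exact velocity_congr_set h
  | succ k ih =>
    refine covDeriv_congr h ?_ (ih h)
    exact ((eventually_eventually_nhds.2 h).mono fun τ hτ => ih hτ).filter_mono nhdsWithin_le_nhds

/-- Curves that agree on `s` have tangent spaces that are not definitionally equal, so the
comparison is made in the total space. With the base points as variables the equalities can be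
eliminated. -/
lemma totalSpace_covDeriv_congr {y y' : M} {w u : TangentSpace 𝓘(ℝ, E) y}
    {w' u' : TangentSpace 𝓘(ℝ, E) y'} (d : M → E)
    (hw : (⟨y, w⟩ : TangentBundle 𝓘(ℝ, E) M) = ⟨y', w'⟩)
    (hu : (⟨y, u⟩ : TangentBundle 𝓘(ℝ, E) M) = ⟨y', u'⟩) :
    (⟨y, (trivializationAt E (fun p : M => TangentSpace 𝓘(ℝ, E) p) y).symm y (d y) +
      nabla (FiberBundle.extend E w) y u⟩ : TangentBundle 𝓘(ℝ, E) M) =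
    ⟨y', (trivializationAt E (fun p : M => TangentSpace 𝓘(ℝ, E) p) y').symm y' (d y') +
      nabla (FiberBundle.extend E w') y' u'⟩ := by
  obtain rfl : y = y' := congrArg TotalSpace.proj hw
  obtain rfl := (TotalSpace.mk_inj).1 hw
  obtain rfl := (TotalSpace.mk_inj).1 hu
  rfl

lemma totalSpace_velocity_congr {s : Set ℝ} {x x' : ℝ → M} (h : EqOn x x' s) {t : ℝ}
    (ht : t ∈ s) : (⟨x t, velocity s x t⟩ : TangentBundle 𝓘(ℝ, E) M) = ⟨x' t, velocity s x' t⟩ := by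
  have h1 : ∀ y y' : M, ∀ A : ℝ →L[ℝ] TangentSpace 𝓘(ℝ, E) y,
      ∀ B : ℝ →L[ℝ] TangentSpace 𝓘(ℝ, E) y', y = y' → HEq A B →
      (⟨y, A 1⟩ : TangentBundle 𝓘(ℝ, E) M) = ⟨y', B 1⟩ := by
    rintro y _ A B rfl hAB
    rw [eq_of_heq hAB]
  exact h1 _ _ (mfderivWithin 𝓘(ℝ, ℝ) 𝓘(ℝ, E) x s t) (mfderivWithin 𝓘(ℝ, ℝ) 𝓘(ℝ, E) x' s t) (h ht)
    (heq_of_eq (mfderivWithin_congr (fun τ hτ => h hτ) (h ht)))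

/-- The covariant derivatives of a curve on `s` depend only on its restriction to `s`. -/
lemma totalSpace_curveDeriv_congr {s : Set ℝ} {x x' : ℝ → M} (h : EqOn x x' s) (k : ℕ) {t : ℝ}
    (ht : t ∈ s) : (⟨x t, curveDeriv nabla s x k t⟩ : TangentBundle 𝓘(ℝ, E) M) =
      ⟨x' t, curveDeriv nabla s x' k t⟩ := by
  induction k generalizing t with
  | zero => exact totalSpace_velocity_congr h ht
  | succ k ih =>
    have h1 : ∀ q : M, derivWithin (fun τ => (trivializationAt E
        (fun p : M => TangentSpace 𝓘(ℝ, E) p) q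
          (⟨x τ, curveDeriv nabla s x k τ⟩ : TangentBundle 𝓘(ℝ, E) M)).2) s t =
        derivWithin (fun τ => (trivializationAt E
        (fun p : M => TangentSpace 𝓘(ℝ, E) p) q
          (⟨x' τ, curveDeriv nabla s x' k τ⟩ : TangentBundle 𝓘(ℝ, E) M)).2) s t := fun q =>
      derivWithin_congr (fun τ hτ => by simp only [ih hτ]) (by simp only [ih ht])
    have h2 := totalSpace_covDeriv_congr (nabla := nabla) (fun q => derivWithin (fun τ =>
      (trivializationAt E (fun p : M => TangentSpace 𝓘(ℝ, E) p) q
          (⟨x τ, curveDeriv nabla s x k τ⟩ : TangentBundle 𝓘(ℝ, E) M)).2) s t) (ih ht)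
      (totalSpace_velocity_congr h ht)
    refine h2.trans ?_
    simp only [h1]
    rfl

variable [FiniteDimensional ℝ E] [T2Space M]

lemma smoothAlong_curveDeriv (hn : nabla.ContMDiffCovariantDerivative ∞) {S : Set ℝ} {x : ℝ → M}
    (hx : ContMDiffOn 𝓘(ℝ, ℝ) 𝓘(ℝ, E) ∞ x S) (hS : UniqueDiffOn ℝ S) (k : ℕ) :
    SmoothAlong S x (curveDeriv nabla S x k) := by
  induction k with
  | zero => exact smoothAlong_dirVelocity hx hS 1
  | succ k ih =>
    have : curveDeriv nabla S x (k + 1) = covDerivAlong nabla S x (curveDeriv nabla S x k) 1 :=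
      funext fun t => covDeriv_eq_covDerivAlong S x _ t
    rw [this]
    exact smoothAlong_covDerivAlong hn ih hS 1

/-- The covariant derivatives along a smooth curve do not change when the interval shrinks. -/
lemma curveDeriv_mono (hn : nabla.ContMDiffCovariantDerivative ∞) {s S : Set ℝ} {x : ℝ → M}
    (hx : ContMDiffOn 𝓘(ℝ, ℝ) 𝓘(ℝ, E) ∞ x S) (hS : UniqueDiffOn ℝ S) (hs : UniqueDiffOn ℝ s)
    (hsS : s ⊆ S) (k : ℕ) {t : ℝ} (ht : t ∈ s) :
    curveDeriv nabla s x k t = curveDeriv nabla S x k t := by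
  induction k generalizing t with
  | zero =>
    exact velocity_comp (γ := id) (hasDerivWithinAt_id t s) (fun τ hτ => hsS hτ) (hs t ht)
      ((hx t (hsS ht)).mdifferentiableWithinAt (by simp))
  | succ k ih =>
    have h1 : curveDeriv nabla s x (k + 1) t = covDeriv nabla s x (curveDeriv nabla S x k) t :=
      covDeriv_congr Filter.EventuallyEq.rfl
        (eventually_nhdsWithin_of_forall fun τ hτ => ih hτ) (ih ht)
    rw [h1]
    refine (covDeriv_comp (γ := id) (hasDerivWithinAt_id t s) (fun τ hτ => hsS hτ) (hs t ht)
      ((smoothAlong_curveDeriv hn hx hS k).mdifferentiableWithinAt (hsS ht))).trans ?_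
    exact (covDeriv_eq_covDerivAlong S x _ t).symm

/-- The `k`-th covariant derivative in the second variable of `∂f/∂t`, for a map `f` of two real
variables. -/
def timeDeriv (nabla : CovariantDerivative 𝓘(ℝ, E) E (fun p : M => TangentSpace 𝓘(ℝ, E) p))
    (S : Set (ℝ × ℝ)) (f : ℝ × ℝ → M) : ℕ → ∀ z, TangentSpace 𝓘(ℝ, E) (f z)
  | 0 => dirVelocity S f (0, 1)
  | k + 1 => covDerivAlong nabla S f (timeDeriv nabla S f k) (0, 1)

lemma smoothAlong_timeDeriv (hn : nabla.ContMDiffCovariantDerivative ∞) {S : Set (ℝ × ℝ)}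
    {f : ℝ × ℝ → M} (hf : ContMDiffOn 𝓘(ℝ, ℝ × ℝ) 𝓘(ℝ, E) ∞ f S) (hS : UniqueDiffOn ℝ S) (k : ℕ) :
    SmoothAlong S f (timeDeriv nabla S f k) := by
  induction k with
  | zero => exact smoothAlong_dirVelocity hf hS _
  | succ k ih => exact smoothAlong_covDerivAlong hn ih hS _

lemma hasDerivWithinAt_mk_left (r t : ℝ) (I : Set ℝ) :
    HasDerivWithinAt (fun τ : ℝ => ((r, τ) : ℝ × ℝ)) (0, 1) I t :=
  (hasDerivWithinAt_const t I r).prodMk (hasDerivWithinAt_id t I)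

lemma hasDerivWithinAt_mk_right (r t : ℝ) (I : Set ℝ) :
    HasDerivWithinAt (fun ρ : ℝ => ((ρ, t) : ℝ × ℝ)) (1, 0) I r :=
  (hasDerivWithinAt_id r I).prodMk (hasDerivWithinAt_const r I t)

/-- For fixed `r` the curve is the restriction of `f` to the line `t ↦ (r, t)`, and `covDeriv_comp`
applies at each order. -/
lemma curveDeriv_eq_timeDeriv (hn : nabla.ContMDiffCovariantDerivative ∞) {R I : Set ℝ}
    {f : ℝ × ℝ → M} (hf : ContMDiffOn 𝓘(ℝ, ℝ × ℝ) 𝓘(ℝ, E) ∞ f (R ×ˢ I))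
    (hR : UniqueDiffOn ℝ R) (hI : UniqueDiffOn ℝ I) {r : ℝ} (hr : r ∈ R) (k : ℕ) {t : ℝ}
    (ht : t ∈ I) :
    curveDeriv nabla I (fun τ => f (r, τ)) k t = timeDeriv nabla (R ×ˢ I) f k (r, t) := by
  have hmaps : MapsTo (fun τ : ℝ => ((r, τ) : ℝ × ℝ)) I (R ×ˢ I) := fun τ hτ => ⟨hr, hτ⟩
  induction k generalizing t with
  | zero =>
    exact velocity_comp (hasDerivWithinAt_mk_left r t I) hmaps (hI t ht)
      ((hf _ ⟨hr, ht⟩).mdifferentiableWithinAt (by simp))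
  | succ k ih =>
    have h1 : curveDeriv nabla I (fun τ => f (r, τ)) (k + 1) t =
        covDeriv nabla I (fun τ => f (r, τ)) (fun τ => timeDeriv nabla (R ×ˢ I) f k (r, τ)) t :=
      covDeriv_congr Filter.EventuallyEq.rfl
        (eventually_nhdsWithin_of_forall fun τ hτ => ih hτ) (ih ht)
    rw [h1]
    exact covDeriv_comp (hasDerivWithinAt_mk_left r t I) hmaps (hI t ht)
      ((smoothAlong_timeDeriv hn hf (hR.prod hI) k).mdifferentiableWithinAt ⟨hr, ht⟩)

end CurveDeriv

/-! ### The first variation on a single smooth strip -/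

section Strip

/-- The partial derivative in `r` is continuous on the strip, hence bounded on a compact part of it,
and the constant bound is an integrable dominating function. -/
lemma hasDerivAt_integral_of_contDiffOn {δ a b : ℝ} (hδ : 0 < δ) (hab : a < b) {e : ℝ × ℝ → ℝ}
    (he : ContDiffOn ℝ 1 e (Ioo (-δ) δ ×ˢ Icc a b)) :
    HasDerivAt (fun r => ∫ t in a..b, e (r, t))
      (∫ t in a..b, fderivWithin ℝ e (Ioo (-δ) δ ×ˢ Icc a b) (0, t) (1, 0)) 0 := by
  set S := Ioo (-δ) δ ×ˢ Icc a b with hSdef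
  have hS : UniqueDiffOn ℝ S := (uniqueDiffOn_Ioo _ _).prod (uniqueDiffOn_Icc hab)
  have hI : uIoc a b ⊆ Icc a b := by rw [uIoc_of_le hab.le]; exact Ioc_subset_Icc_self
  have hF : ContinuousOn (fun z => fderivWithin ℝ e S z (1, 0)) S :=
    (he.continuousOn_fderivWithin hS le_rfl).clm_apply continuousOn_const
  -- Halving `δ` gives a compact strip inside the open one.
  have hK : Icc (-(δ / 2)) (δ / 2) ×ˢ Icc a b ⊆ S := by
    rintro ⟨r, t⟩ ⟨⟨h1, h2⟩, h3⟩
    exact ⟨⟨by linarith, by linarith⟩, h3⟩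
  obtain ⟨C, hC⟩ := (isCompact_Icc.prod isCompact_Icc).exists_bound_of_continuousOn (hF.mono hK)
  have hball : Metric.ball (0 : ℝ) (δ / 2) ∈ 𝓝 (0 : ℝ) := Metric.ball_mem_nhds _ (by linarith)
  have hsub : ∀ r ∈ Metric.ball (0 : ℝ) (δ / 2), r ∈ Icc (-(δ / 2)) (δ / 2) := fun r hr => by
    rw [Metric.mem_ball, dist_zero_right, Real.norm_eq_abs, abs_lt] at hr
    exact ⟨hr.1.le, hr.2.le⟩
  have hmaps : ∀ r ∈ Icc (-(δ / 2)) (δ / 2), MapsTo (fun t : ℝ => ((r, t) : ℝ × ℝ)) (Icc a b) S :=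
    fun r hr t ht => hK ⟨hr, ht⟩
  have hcont : ∀ r ∈ Icc (-(δ / 2)) (δ / 2), ContinuousOn (fun t => e (r, t)) (Icc a b) :=
    fun r hr => he.continuousOn.comp (by fun_prop) (hmaps r hr)
  have h0 : (0 : ℝ) ∈ Icc (-(δ / 2)) (δ / 2) := ⟨by linarith, by linarith⟩
  refine (intervalIntegral.hasDerivAt_integral_of_dominated_loc_of_deriv_le (bound := fun _ => C)
    (F := fun r t => e (r, t)) (F' := fun r t => fderivWithin ℝ e S (r, t) (1, 0))
    hball ?_ ?_ ?_ ?_ ?_ ?_).2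
  · filter_upwards [hball] with r hr
    exact ((hcont r (hsub r hr)).mono hI).aestronglyMeasurable measurableSet_uIoc
  · exact (hcont 0 h0).intervalIntegrable_of_Icc hab.le
  · exact ((hF.comp (by fun_prop) (hmaps 0 h0)).mono hI).aestronglyMeasurable measurableSet_uIoc
  · exact ae_of_all _ fun t ht r hr => hC (r, t) ⟨hsub r hr, hI ht⟩
  · exact intervalIntegrable_const
  · refine ae_of_all _ fun t ht r hr => ?_
    have hz : ((r, t) : ℝ × ℝ) ∈ S := hK ⟨hsub r hr, hI ht⟩
    have h1 := (he.differentiableOn one_ne_zero _ hz).hasFDerivWithinAt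
    have h2 := h1.comp_hasDerivWithinAt r (hasDerivWithinAt_mk_right r t (Ioo (-δ) δ))
      (fun ρ hρ => (⟨hρ, hI ht⟩ : ((ρ, t) : ℝ × ℝ) ∈ S))
    exact h2.hasDerivAt (Ioo_mem_nhds hz.1.1 hz.1.2)

variable {E : Type*} [NormedAddCommGroup E] [NormedSpace ℝ E]
  {M : Type*} [TopologicalSpace M] [ChartedSpace E M] [IsManifold 𝓘(ℝ, E) ∞ M]

/-- The tube lemma, by compactness of `[a, b]`. The potential is controlled only on `U`, so the
variation must stay in `U` for all small `r` simultaneously. -/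
lemma exists_strip_mapsTo {ε a b : ℝ} (hε : 0 < ε) {f : ℝ × ℝ → M}
    (hf : ContinuousOn f (Ioo (-ε) ε ×ˢ Icc a b)) {U : Set M} (hU : IsOpen U)
    (h0 : ∀ t ∈ Icc a b, f (0, t) ∈ U) :
    ∃ δ, 0 < δ ∧ δ ≤ ε ∧ MapsTo f (Ioo (-δ) δ ×ˢ Icc a b) U := by
  obtain ⟨O, hO, hOeq⟩ := continuousOn_iff'.1 hf U hU
  have hsub : ({0} : Set ℝ) ×ˢ Icc a b ⊆ O := by
    rintro ⟨r, t⟩ ⟨hr, ht⟩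
    obtain rfl : r = 0 := hr
    have : ((0, t) : ℝ × ℝ) ∈ f ⁻¹' U ∩ Ioo (-ε) ε ×ˢ Icc a b :=
      ⟨h0 t ht, ⟨⟨by linarith, hε⟩, ht⟩⟩
    rw [hOeq] at this
    exact this.1
  obtain ⟨u, v, hu, -, h0u, hv, huv⟩ :=
    generalized_tube_lemma isCompact_singleton isCompact_Icc hO hsub
  obtain ⟨η, hη, hηu⟩ := Metric.isOpen_iff.1 hu 0 (h0u rfl)
  refine ⟨min η ε, lt_min hη hε, min_le_right _ _, ?_⟩
  rintro ⟨r, t⟩ ⟨hr, ht⟩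
  have hr1 : r ∈ u := hηu (by
    rw [Metric.mem_ball, dist_zero_right, Real.norm_eq_abs, abs_lt]
    exact ⟨(neg_le_neg (min_le_left η ε)).trans_lt hr.1, hr.2.trans_le (min_le_left _ _)⟩)
  have hr2 : r ∈ Ioo (-ε) ε :=
    ⟨(neg_le_neg (min_le_right η ε)).trans_lt hr.1, hr.2.trans_le (min_le_right _ _)⟩
  have : ((r, t) : ℝ × ℝ) ∈ f ⁻¹' U ∩ Ioo (-ε) ε ×ˢ Icc a b := by
    rw [hOeq]; exact ⟨huv ⟨hr1, hv ht⟩, hr2, ht⟩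
  exact this.1

lemma covDerivAlong_congr
    {nabla : CovariantDerivative 𝓘(ℝ, E) E (fun p : M => TangentSpace 𝓘(ℝ, E) p)}
    {F : Type*} [NormedAddCommGroup F] [NormedSpace ℝ F]
    {S : Set F} {f : F → M} {W W' : ∀ z, TangentSpace 𝓘(ℝ, E) (f z)} (hW : ∀ z ∈ S, W z = W' z)
    {z : F} (hz : z ∈ S) (h : F) :
    covDerivAlong nabla S f W h z = covDerivAlong nabla S f W' h z := by
  unfold covDerivAlong
  rw [hW z hz, fderivWithin_congr (fun ζ hζ => by rw [hW ζ hζ]) (by rw [hW z hz])]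

variable [FiniteDimensional ℝ E] [T2Space M]
  [RiemannianBundle (fun p : M => TangentSpace 𝓘(ℝ, E) p)]

lemma inner_grad (V : M → ℝ) (p : M) (u : TangentSpace 𝓘(ℝ, E) p) :
    inner ℝ u (grad V p) = mvfderiv 𝓘(ℝ, E) V p u := by
  let _ : FiniteDimensional ℝ (TangentSpace 𝓘(ℝ, E) p) := inferInstanceAs (FiniteDimensional ℝ E)
  let _ : CompleteSpace (TangentSpace 𝓘(ℝ, E) p) := FiniteDimensional.complete ℝ _
  rw [real_inner_comm]
  unfold grad
  exact InnerProductSpace.toDual_symm_apply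

variable [IsContMDiffRiemannianBundle 𝓘(ℝ, E) ∞ E (fun p : M => TangentSpace 𝓘(ℝ, E) p)]
  (nabla : CovariantDerivative 𝓘(ℝ, E) E (fun p : M => TangentSpace 𝓘(ℝ, E) p))

/-- The integrand of the functional, for a map `f (r, t)` of two variables. -/
def stripEnergy (σ : ℝ) (V : M → ℝ) (S : Set (ℝ × ℝ)) (f : ℝ × ℝ → M) (z : ℝ × ℝ) : ℝ :=
  (1 / 2 : ℝ) * (‖timeDeriv nabla S f 1 z‖ ^ 2 + σ * ‖timeDeriv nabla S f 0 z‖ ^ 2 + V (f z))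

/-- The Euler field, for a map `f (r, t)` of two variables. -/
def stripEuler (σ : ℝ) (V : M → ℝ) (S : Set (ℝ × ℝ)) (f : ℝ × ℝ → M) (z : ℝ × ℝ) :
    TangentSpace 𝓘(ℝ, E) (f z) :=
  timeDeriv nabla S f 3 z +
    curvature nabla (timeDeriv nabla S f 1 z) (timeDeriv nabla S f 0 z) (timeDeriv nabla S f 0 z) -
    σ • timeDeriv nabla S f 1 z + (1 / 2 : ℝ) • grad V (f z)

/-- The boundary term in the first variation formula. -/
def stripBoundary (σ : ℝ) (S : Set (ℝ × ℝ)) (f : ℝ × ℝ → M) (z : ℝ × ℝ) : ℝ :=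
  inner ℝ (covDerivAlong nabla S f (dirVelocity S f (1, 0)) (0, 1) z) (timeDeriv nabla S f 1 z) -
    inner ℝ (dirVelocity S f (1, 0) z) (timeDeriv nabla S f 2 z) +
    σ * inner ℝ (dirVelocity S f (1, 0) z) (timeDeriv nabla S f 0 z)

variable {nabla}

lemma contDiffOn_stripBoundary (hn : nabla.ContMDiffCovariantDerivative ∞) (σ : ℝ)
    {S : Set (ℝ × ℝ)} {f : ℝ × ℝ → M} (hf : ContMDiffOn 𝓘(ℝ, ℝ × ℝ) 𝓘(ℝ, E) ∞ f S)
    (hS : UniqueDiffOn ℝ S) : ContDiffOn ℝ ∞ (stripBoundary nabla σ S f) S := by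
  have hT := smoothAlong_timeDeriv hn hf hS
  have hY := smoothAlong_dirVelocity hf hS (1, 0)
  have hY1 := smoothAlong_covDerivAlong hn hY hS (0, 1)
  exact ((hY1.contDiffOn_inner (hT 1)).sub (hY.contDiffOn_inner (hT 2))).add
    (contDiffOn_const.mul (hY.contDiffOn_inner (hT 0)))

/-- The regularity is limited to `C¹` by the potential. Covariant derivatives are taken in the full
strip `S`, while only on `S'` does `f` take values in `U`. -/
lemma contDiffOn_stripEnergy (hn : nabla.ContMDiffCovariantDerivative ∞) (σ : ℝ)
    {S S' : Set (ℝ × ℝ)} {f : ℝ × ℝ → M} (hf : ContMDiffOn 𝓘(ℝ, ℝ × ℝ) 𝓘(ℝ, E) ∞ f S)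
    (hS : UniqueDiffOn ℝ S) (hS' : S' ⊆ S) {U : Set M} {V : M → ℝ}
    (hV : ContMDiffOn 𝓘(ℝ, E) 𝓘(ℝ, ℝ) 1 V U) (hU : MapsTo f S' U) :
    ContDiffOn ℝ 1 (stripEnergy nabla σ V S f) S' := by
  have hT := fun k => (((smoothAlong_timeDeriv hn hf hS k).contDiffOn_inner
    (smoothAlong_timeDeriv hn hf hS k)).of_le (m := 1) (by simp)).mono hS'
  have hVf : ContDiffOn ℝ 1 (fun z => V (f z)) S' :=
    (hV.comp ((hf.of_le (by simp)).mono hS') hU).contDiffOn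
  refine ((contDiffOn_const (c := (1 / 2 : ℝ))).mul
    (((hT 1).add ((contDiffOn_const (c := σ)).mul (hT 0))).add hVf)).congr ?_
  intro z hz
  simp only [stripEnergy, real_inner_self_eq_norm_sq]

/-- The pointwise first variation formula. -/
lemma fderivWithin_stripEnergy (hnabla : IsRiemannianConnection nabla) (σ : ℝ)
    {S : Set (ℝ × ℝ)} {f : ℝ × ℝ → M} (hf : ContMDiffOn 𝓘(ℝ, ℝ × ℝ) 𝓘(ℝ, E) ∞ f S)
    (hS : UniqueDiffOn ℝ S) (hS' : S ⊆ closure (interior S)) {V : M → ℝ} {z : ℝ × ℝ} (hz : z ∈ S)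
    (hV : MDifferentiableAt 𝓘(ℝ, E) 𝓘(ℝ, ℝ) V (f z)) :
    fderivWithin ℝ (stripEnergy nabla σ V S f) S z (1, 0) =
      fderivWithin ℝ (stripBoundary nabla σ S f) S z (0, 1) +
        inner ℝ (dirVelocity S f (1, 0) z) (stripEuler nabla σ V S f z) := by
  have hn := hnabla.smooth
  have hT := smoothAlong_timeDeriv hn hf hS
  have hY := smoothAlong_dirVelocity hf hS (1, 0)
  have hY1 := smoothAlong_covDerivAlong hn hY hS (0, 1)
  have hu := hS z hz
  have hd : ∀ {W Z : ∀ z, TangentSpace 𝓘(ℝ, E) (f z)}, SmoothAlong S f W → SmoothAlong S f Z →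
      DifferentiableWithinAt ℝ (fun ζ => inner ℝ (W ζ) (Z ζ)) S z := fun hW hZ =>
    (hW.contDiffOn_inner hZ z hz).differentiableWithinAt (by simp)
  have hi : ∀ {W Z : ∀ z, TangentSpace 𝓘(ℝ, E) (f z)}, SmoothAlong S f W → SmoothAlong S f Z →
      ∀ h, fderivWithin ℝ (fun ζ => inner ℝ (W ζ) (Z ζ)) S z h =
        inner ℝ (covDerivAlong nabla S f W h z) (Z z) +
        inner ℝ (W z) (covDerivAlong nabla S f Z h z) := fun hW hZ h =>
    fderivWithin_inner hnabla (hW.mdifferentiableWithinAt hz) (hZ.mdifferentiableWithinAt hz) hu h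
  have hfz := (hf z hz).mdifferentiableWithinAt (n := ∞) (by simp)
  have hVd := (hasFDerivWithinAt_comp_mvfderiv hV hfz).differentiableWithinAt
  have hE : fderivWithin ℝ (stripEnergy nabla σ V S f) S z (1, 0) =
      (1 / 2 : ℝ) * ((fderivWithin ℝ (fun ζ => inner ℝ (timeDeriv nabla S f 1 ζ)
          (timeDeriv nabla S f 1 ζ)) S z (1, 0) +
        σ * fderivWithin ℝ (fun ζ => inner ℝ (timeDeriv nabla S f 0 ζ)
          (timeDeriv nabla S f 0 ζ)) S z (1, 0)) +
        fderivWithin ℝ (fun ζ => V (f ζ)) S z (1, 0)) := by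
    have hfun : stripEnergy nabla σ V S f = fun ζ => (1 / 2 : ℝ) *
        ((inner ℝ (timeDeriv nabla S f 1 ζ) (timeDeriv nabla S f 1 ζ) +
          σ * inner ℝ (timeDeriv nabla S f 0 ζ) (timeDeriv nabla S f 0 ζ)) + V (f ζ)) := by
      ext ζ
      simp only [stripEnergy, real_inner_self_eq_norm_sq]
    rw [hfun]
    have h1 := ((((hd (hT 1) (hT 1)).hasFDerivWithinAt.add
      ((hd (hT 0) (hT 0)).hasFDerivWithinAt.const_mul σ)).add hVd.hasFDerivWithinAt).const_mul
        (1 / 2 : ℝ)).fderivWithin hu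
    exact congr($h1 (1, 0))
  have hB : fderivWithin ℝ (stripBoundary nabla σ S f) S z (0, 1) =
      fderivWithin ℝ (fun ζ => inner ℝ (covDerivAlong nabla S f (dirVelocity S f (1, 0)) (0, 1) ζ)
        (timeDeriv nabla S f 1 ζ)) S z (0, 1) -
      fderivWithin ℝ (fun ζ => inner ℝ (dirVelocity S f (1, 0) ζ)
        (timeDeriv nabla S f 2 ζ)) S z (0, 1) +
      σ * fderivWithin ℝ (fun ζ => inner ℝ (dirVelocity S f (1, 0) ζ)
        (timeDeriv nabla S f 0 ζ)) S z (0, 1) := by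
    have h1 := (((hd hY1 (hT 1)).hasFDerivWithinAt.sub (hd hY (hT 2)).hasFDerivWithinAt).add
      ((hd hY (hT 0)).hasFDerivWithinAt.const_mul σ)).fderivWithin hu
    exact congr($h1 (0, 1))
  -- Needed on all of `S` and not only at `z`, because `c1` differentiates it again.
  have c0 : ∀ ζ ∈ S, covDerivAlong nabla S f (timeDeriv nabla S f 0) (1, 0) ζ =
      covDerivAlong nabla S f (dirVelocity S f (1, 0)) (0, 1) ζ := fun ζ hζ =>
    covDerivAlong_dirVelocity_comm hnabla.torsion_free hf hS hζ (hS' hζ) (1, 0) (0, 1)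
  have c1 : covDerivAlong nabla S f (timeDeriv nabla S f 1) (1, 0) z =
      covDerivAlong nabla S f (covDerivAlong nabla S f (dirVelocity S f (1, 0)) (0, 1)) (0, 1) z +
      curvature nabla (dirVelocity S f (1, 0) z) (timeDeriv nabla S f 0 z)
        (timeDeriv nabla S f 0 z) := by
    rw [← covDerivAlong_congr c0 hz]
    exact covDerivAlong_comm hn (hT 0) hS hz (hS' hz) (1, 0) (0, 1)
  have c2 : ∀ k, covDerivAlong nabla S f (timeDeriv nabla S f k) (0, 1) z =
      timeDeriv nabla S f (k + 1) z := fun k => rfl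
  rw [hE, hB, hi (hT 1) (hT 1), hi (hT 0) (hT 0), hi hY1 (hT 1), hi hY (hT 2), hi hY (hT 0),
    fderivWithin_comp_eq hV hfz hu, ← inner_grad, c0 z hz, c1, c2, c2, c2, stripEuler]
  -- The variational field stands inside the curvature in `c1`; pair symmetry exchanges it with
  -- `D²x`.
  have h1 := inner_curvature_symm hnabla (dirVelocity S f (1, 0) z) (timeDeriv nabla S f 0 z)
    (timeDeriv nabla S f 1 z)
  have h2 := real_inner_comm (dirVelocity S f (1, 0) z) (curvature nabla
    (timeDeriv nabla S f 1 z) (timeDeriv nabla S f 0 z) (timeDeriv nabla S f 0 z))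
  have h3 := fun W => real_inner_comm W (timeDeriv nabla S f 1 z)
  have h4 := fun W => real_inner_comm W (timeDeriv nabla S f 0 z)
  have h5 : timeDeriv nabla S f (0 + 1) z = timeDeriv nabla S f 1 z := rfl
  have h6 : timeDeriv nabla S f (1 + 1) z = timeDeriv nabla S f 2 z := rfl
  have h7 : timeDeriv nabla S f (2 + 1) z = timeDeriv nabla S f 3 z := rfl
  simp only [inner_add_left, inner_add_right, inner_sub_right, real_inner_smul_right, h5, h6, h7]
  rw [h3, h3, h4]
  linarith

/-- This is what allows second derivatives to be interchanged on the closed edges `t = a` and `t =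
b`. -/
lemma subset_closure_interior_strip {ε a b : ℝ} (hab : a < b) :
    Ioo (-ε) ε ×ˢ Icc a b ⊆ closure (interior (Ioo (-ε) ε ×ˢ Icc a b)) := by
  rw [interior_prod_eq, closure_prod_eq, isOpen_Ioo.interior_eq, interior_Icc,
    closure_Ioo hab.ne]
  exact prod_mono subset_closure subset_rfl

/-- The first variation formula on a strip where the variation is smooth. -/
lemma hasDerivAt_integral_stripEnergy (hnabla : IsRiemannianConnection nabla) (σ : ℝ)
    {ε a b : ℝ} (hε : 0 < ε) (hab : a < b) {f : ℝ × ℝ → M}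
    (hf : ContMDiffOn 𝓘(ℝ, ℝ × ℝ) 𝓘(ℝ, E) ∞ f (Ioo (-ε) ε ×ˢ Icc a b))
    {U : Set M} (hU : IsOpen U) {V : M → ℝ} (hV : ContMDiffOn 𝓘(ℝ, E) 𝓘(ℝ, ℝ) 1 V U)
    (h0 : ∀ t ∈ Icc a b, f (0, t) ∈ U) :
    (∀ᶠ r in 𝓝 (0 : ℝ), IntervalIntegrable
      (fun t => stripEnergy nabla σ V (Ioo (-ε) ε ×ˢ Icc a b) f (r, t)) volume a b) ∧
    IntervalIntegrable (fun t => inner ℝ (dirVelocity (Ioo (-ε) ε ×ˢ Icc a b) f (1, 0) (0, t))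
      (stripEuler nabla σ V (Ioo (-ε) ε ×ˢ Icc a b) f (0, t))) volume a b ∧
    HasDerivAt (fun r => ∫ t in a..b, stripEnergy nabla σ V (Ioo (-ε) ε ×ˢ Icc a b) f (r, t))
      ((∫ t in a..b, inner ℝ (dirVelocity (Ioo (-ε) ε ×ˢ Icc a b) f (1, 0) (0, t))
        (stripEuler nabla σ V (Ioo (-ε) ε ×ˢ Icc a b) f (0, t))) +
        (stripBoundary nabla σ (Ioo (-ε) ε ×ˢ Icc a b) f (0, b) -
          stripBoundary nabla σ (Ioo (-ε) ε ×ˢ Icc a b) f (0, a))) 0 := by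
  set S := Ioo (-ε) ε ×ˢ Icc a b with hSdef
  have hn := hnabla.smooth
  have hS : UniqueDiffOn ℝ S := (uniqueDiffOn_Ioo _ _).prod (uniqueDiffOn_Icc hab)
  obtain ⟨δ, hδ, hδε, hmaps⟩ := exists_strip_mapsTo hε hf.continuousOn hU h0
  set S' := Ioo (-δ) δ ×ˢ Icc a b with hS'def
  have hS' : UniqueDiffOn ℝ S' := (uniqueDiffOn_Ioo _ _).prod (uniqueDiffOn_Icc hab)
  have hsub : S' ⊆ S := prod_mono (Ioo_subset_Ioo (by linarith) hδε) subset_rfl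
  have he := contDiffOn_stripEnergy hn σ hf hS hsub hV hmaps
  have hB := contDiffOn_stripBoundary hn σ hf hS
  have hder := hasDerivAt_integral_of_contDiffOn hδ hab he
  have hδ0 : (0 : ℝ) ∈ Ioo (-δ) δ := ⟨by linarith, hδ⟩
  -- Shrinking the range of `r` does not change derivatives within the strip at `r = 0`.
  have hnhds : ∀ t, S' =ᶠ[𝓝 ((0, t) : ℝ × ℝ)] S := fun t => by
    have h1 : ∀ᶠ z : ℝ × ℝ in 𝓝 ((0, t) : ℝ × ℝ), z.1 ∈ Ioo (-δ) δ :=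
      continuous_fst.continuousAt.eventually (Ioo_mem_nhds hδ0.1 hδ0.2)
    filter_upwards [h1] with z hz
    exact propext ⟨fun h => hsub h, fun h => ⟨hz, h.2⟩⟩
  have hline : ∀ r ∈ Ioo (-δ) δ, MapsTo (fun t : ℝ => ((r, t) : ℝ × ℝ)) (Icc a b) S' :=
    fun r hr t ht => ⟨hr, ht⟩
  have hEB : ∀ t ∈ Icc a b, fderivWithin ℝ (stripEnergy nabla σ V S f) S' (0, t) (1, 0) =
      fderivWithin ℝ (stripBoundary nabla σ S f) S (0, t) (0, 1) +
        inner ℝ (dirVelocity S f (1, 0) (0, t)) (stripEuler nabla σ V S f (0, t)) := fun t ht => by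
    rw [fderivWithin_congr_set (hnhds t)]
    exact fderivWithin_stripEnergy hnabla σ hf hS (subset_closure_interior_strip hab)
      (hsub (hline 0 hδ0 ht))
      ((hV.contMDiffAt (hU.mem_nhds (h0 t ht))).mdifferentiableAt one_ne_zero)
  have hcE : ContinuousOn
      (fun t => fderivWithin ℝ (stripEnergy nabla σ V S f) S' (0, t) (1, 0)) (Icc a b) :=
    ((he.continuousOn_fderivWithin hS' le_rfl).clm_apply continuousOn_const).comp
      (g := fun z => fderivWithin ℝ (stripEnergy nabla σ V S f) S' z (1, 0))
      (by fun_prop) (hline 0 hδ0)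
  have hcB : ContinuousOn
      (fun t => fderivWithin ℝ (stripBoundary nabla σ S f) S (0, t) (0, 1)) (Icc a b) :=
    ((hB.continuousOn_fderivWithin hS (by simp)).clm_apply continuousOn_const).comp
      (g := fun z => fderivWithin ℝ (stripBoundary nabla σ S f) S z (0, 1))
      (by fun_prop) ((hline 0 hδ0).mono_right hsub)
  have hiE := hcE.intervalIntegrable_of_Icc (μ := volume) hab.le
  have hiB := hcB.intervalIntegrable_of_Icc (μ := volume) hab.le
  have huI : uIcc a b = Icc a b := uIcc_of_le hab.le
  -- By `hEB` the integrand is the difference of two continuous functions on `[a, b]`, so continuity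
  -- of the Euler field need not be examined.
  have hiX : IntervalIntegrable (fun t => inner ℝ (dirVelocity S f (1, 0) (0, t))
      (stripEuler nabla σ V S f (0, t))) volume a b := by
    refine (hiE.sub hiB).congr_uIoo fun t ht => ?_
    rw [uIoo_of_le hab.le] at ht
    simp only [hEB t (Ioo_subset_Icc_self ht)]
    ring
  refine ⟨?_, hiX, ?_⟩
  · filter_upwards [Ioo_mem_nhds hδ0.1 hδ0.2] with r hr
    exact (he.continuousOn.comp (by fun_prop) (hline r hr)).intervalIntegrable_of_Icc hab.le
  · have hFTC : ∫ t in a..b, fderivWithin ℝ (stripBoundary nabla σ S f) S (0, t) (0, 1) =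
        stripBoundary nabla σ S f (0, b) - stripBoundary nabla σ S f (0, a) := by
      refine intervalIntegral.integral_eq_sub_of_hasDerivAt_of_le hab.le
        (f := fun t => stripBoundary nabla σ S f (0, t)) ?_ ?_ hiB
      · exact hB.continuousOn.comp (by fun_prop) ((hline 0 hδ0).mono_right hsub)
      · intro t ht
        have hz : ((0, t) : ℝ × ℝ) ∈ S := hsub (hline 0 hδ0 (Ioo_subset_Icc_self ht))
        have h1 := ((hB _ hz).differentiableWithinAt (by simp)).hasFDerivWithinAt
        have h2 := h1.comp_hasDerivWithinAt t (hasDerivWithinAt_mk_left 0 t (Icc a b))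
          ((hline 0 hδ0).mono_right hsub)
        exact h2.hasDerivAt (Icc_mem_nhds ht.1 ht.2)
    rw [← hFTC, ← intervalIntegral.integral_add hiX hiB]
    refine hder.congr_deriv (intervalIntegral.integral_congr_uIoo fun t ht => ?_)
    rw [uIoo_of_le hab.le] at ht
    refine (hEB t (Ioo_subset_Icc_self ht)).trans ?_
    ring

end Strip

/-! ### Partitions and sums over their nodes -/

section Partition

variable {T : ℝ} {l : ℕ} {t : ℕ → ℝ}

lemma IsPartition.lt (ht : IsPartition T l t) {i j : ℕ} (hij : i < j) (hj : j ≤ l) :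
    t i < t j := by
  induction j, hij using Nat.le_induction with
  | base => exact ht.lt_succ i hj
  | succ j _ ih => exact (ih (by omega)).trans (ht.lt_succ j hj)

lemma IsPartition.le (ht : IsPartition T l t) {i j : ℕ} (hij : i ≤ j) (hj : j ≤ l) :
    t i ≤ t j := by
  rcases hij.eq_or_lt with rfl | h
  · exact le_rfl
  · exact (ht.lt h hj).le

lemma IsPartition.nonneg (ht : IsPartition T l t) {i : ℕ} (hi : i ≤ l) : 0 ≤ t i :=
  ht.zero ▸ ht.le (Nat.zero_le i) hi

lemma IsPartition.le_last (ht : IsPartition T l t) {i : ℕ} (hi : i ≤ l) : t i ≤ T :=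
  (ht.le hi le_rfl).trans_eq ht.last

lemma IsPartition.mem_Ioo (ht : IsPartition T l t) {i : ℕ} (hi : i ∈ Finset.Ico 1 l) :
    t i ∈ Ioo 0 T := by
  rw [Finset.mem_Ico] at hi
  exact ⟨ht.zero ▸ ht.lt hi.1 hi.2.le, (ht.lt hi.2 le_rfl).trans_eq ht.last⟩

lemma IsPartition.eq_or_mem_Ioo (ht : IsPartition T l t) {u : ℝ} (hu : u ∈ Ioo 0 T) :
    (∃ i ∈ Finset.Ico 1 l, t i = u) ∨ ∃ i < l, u ∈ Ioo (t i) (t (i + 1)) := by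
  classical
  have hex : ∃ i, u ≤ t i := ⟨l, hu.2.le.trans_eq ht.last.symm⟩
  -- The first node at or beyond `u` has positive index since `t 0 = 0 < u`; the node before it lies
  -- strictly below `u`.
  obtain ⟨k, hk⟩ : ∃ k, Nat.find hex = k + 1 := by
    refine Nat.exists_eq_succ_of_ne_zero fun h => ?_
    have := Nat.find_spec hex
    rw [h, ht.zero] at this
    exact absurd hu.1 this.not_gt
  have h1 : u ≤ t (k + 1) := hk ▸ Nat.find_spec hex
  have h2 : t k < u := not_le.1 (Nat.find_min hex (by omega))
  have h3 : k + 1 ≤ l := hk ▸ Nat.find_min' hex (hu.2.le.trans_eq ht.last.symm)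
  rcases h1.eq_or_lt with h | h
  · refine Or.inl ⟨k + 1, Finset.mem_Ico.2 ⟨by omega, lt_of_le_of_ne h3 ?_⟩, h.symm⟩
    rintro rfl
    exact hu.2.ne (h.trans ht.last)
  · exact Or.inr ⟨k, by omega, h2, h⟩

lemma IsPartition.sum_image (ht : IsPartition T l t) (g : ℝ → ℝ) :
    ∑ u ∈ (Finset.Ico 1 l).image t, g u = ∑ i ∈ Finset.Ico 1 l, g (t i) := by
  refine Finset.sum_image fun i hi j hj hij => ?_
  have hi := (Finset.mem_Ico.1 hi).2
  have hj := (Finset.mem_Ico.1 hj).2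
  rcases lt_trichotomy i j with h | h | h
  · exact absurd hij (ht.lt h hj.le).ne
  · exact h
  · exact absurd hij (ht.lt h hi.le).ne'

/-- A function that vanishes off the interior break points of each of two partitions has the same
sum over the break points of both. -/
lemma IsPartition.sum_eq_sum {m : ℕ} {s : ℕ → ℝ} (ht : IsPartition T l t) (hs : IsPartition T m s)
    {g : ℝ → ℝ} (hgt : ∀ i < l, ∀ u ∈ Ioo (t i) (t (i + 1)), g u = 0)
    (hgs : ∀ i < m, ∀ u ∈ Ioo (s i) (s (i + 1)), g u = 0) :
    ∑ i ∈ Finset.Ico 1 l, g (t i) = ∑ i ∈ Finset.Ico 1 m, g (s i) := by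
  -- Either sum equals the sum over the union of the two node sets: an extra node lies in an open
  -- subinterval of the other partition, where `g` vanishes.
  have key : ∀ {l m : ℕ} {t s : ℕ → ℝ}, IsPartition T l t → IsPartition T m s →
      (∀ i < m, ∀ u ∈ Ioo (s i) (s (i + 1)), g u = 0) →
      ∑ u ∈ (Finset.Ico 1 m).image s, g u =
        ∑ u ∈ (Finset.Ico 1 l).image t ∪ (Finset.Ico 1 m).image s, g u := by
    intro l m t s ht hs hgs
    refine Finset.sum_subset Finset.subset_union_right fun u hu hu' => ?_
    obtain ⟨i, hi, rfl⟩ := Finset.mem_image.1 ((Finset.mem_union.1 hu).resolve_right hu')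
    rcases hs.eq_or_mem_Ioo (ht.mem_Ioo hi) with ⟨j, hj, h⟩ | ⟨j, hj, h⟩
    · exact absurd (Finset.mem_image.2 ⟨j, hj, h⟩) hu'
    · exact hgs j hj _ h
  rw [← ht.sum_image, ← hs.sum_image, key ht hs hgs, key hs ht hgt, Finset.union_comm]

/-- Regroups boundary values by node instead of by piece: `q` belongs to the right end of a piece,
`p` to the left end of the next, and the two outer values are zero. -/
lemma sum_range_sub_eq_sum_Ico {m : ℕ} (hm : 0 < m) (p q : ℕ → ℝ) (h0 : p 0 = 0)
    (hqm : q m = 0) :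
    ∑ j ∈ Finset.range m, (q (j + 1) - p j) = ∑ j ∈ Finset.Ico 1 m, (q j - p j) := by
  obtain ⟨k, rfl⟩ := Nat.exists_eq_succ_of_ne_zero hm.ne'
  rw [Finset.sum_sub_distrib, Finset.sum_sub_distrib, Finset.sum_range_succ,
    Finset.sum_range_succ' p, h0, hqm, Finset.sum_Ico_eq_sum_range, Finset.sum_Ico_eq_sum_range]
  simp [add_comm]

end Partition

/-! ### One-sided derivatives and limits at break points -/

section OneSided

lemma Icc_eventuallyEq_of_lt_right {a b d u : ℝ} (hb : u < b) (hd : u < d) :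
    Icc a b =ᶠ[𝓝 u] Icc a d := by
  filter_upwards [Iio_mem_nhds hb, Iio_mem_nhds hd] with τ h1 h2
  exact propext ⟨fun h => ⟨h.1, le_of_lt h2⟩, fun h => ⟨h.1, le_of_lt h1⟩⟩

lemma Icc_eventuallyEq_of_lt_left {a b c u : ℝ} (ha : a < u) (hc : c < u) :
    Icc a b =ᶠ[𝓝 u] Icc c b := by
  filter_upwards [Ioi_mem_nhds ha, Ioi_mem_nhds hc] with τ h1 h2
  exact propext ⟨fun h => ⟨le_of_lt h2, h.2⟩, fun h => ⟨le_of_lt h1, h.2⟩⟩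

variable {E : Type*} [NormedAddCommGroup E] [NormedSpace ℝ E]
  {M : Type*} [TopologicalSpace M] [ChartedSpace E M] [IsManifold 𝓘(ℝ, E) ∞ M]
  {nabla : CovariantDerivative 𝓘(ℝ, E) E (fun p : M => TangentSpace 𝓘(ℝ, E) p)}

lemma curveDeriv_Icc_of_mem_Ioo {a b c d u : ℝ} (x : ℝ → M) (k : ℕ) (h : u ∈ Ioo a b)
    (h' : u ∈ Ioo c d) : curveDeriv nabla (Icc a b) x k u = curveDeriv nabla (Icc c d) x k u :=
  curveDeriv_congr_set k ((Icc_eventuallyEq_of_lt_right h.2 h'.2).trans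
    (Icc_eventuallyEq_of_lt_left h.1 h'.1))

lemma velocity_mono {s S : Set ℝ} {x : ℝ → M} {u : ℝ}
    (hx : MDifferentiableWithinAt 𝓘(ℝ, ℝ) 𝓘(ℝ, E) x S u)
    (hs : UniqueDiffWithinAt ℝ s u) (hsS : s ⊆ S) :
    velocity (E := E) s x u = velocity S x u :=
  velocity_comp (γ := id) (hasDerivWithinAt_id u s) (fun _ hτ => hsS hτ) hs hx

/-- A constant point of the tangent bundle has constant base point and constant coordinates. It
serves for the prescribed end data, with `r` as the parameter. -/
lemma covDeriv_eq_zero_of_const {s : Set ℝ} {y : ℝ → M} {W : ∀ r, TangentSpace 𝓘(ℝ, E) (y r)}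
    {P : TangentBundle 𝓘(ℝ, E) M}
    (h : ∀ r ∈ s, (⟨y r, W r⟩ : TangentBundle 𝓘(ℝ, E) M) = P) {r : ℝ} (hr : r ∈ s) :
    velocity (E := E) s y r = 0 ∧ covDeriv nabla s y W r = 0 := by
  have hy : ∀ ρ ∈ s, y ρ = y r := fun ρ hρ =>
    congrArg TotalSpace.proj ((h ρ hρ).trans (h r hr).symm)
  have hv : velocity (E := E) s y r = 0 := by
    unfold velocity
    rw [mfderivWithin_congr (f := fun _ => y r) hy rfl, mfderivWithin_const]
    rfl
  refine ⟨hv, ?_⟩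
  unfold covDeriv
  rw [hv, map_zero, add_zero, derivWithin_congr (f := fun _ => _)
    (fun ρ hρ => by rw [h ρ hρ]) (by rw [h r hr])]
  refine (congrArg _ (congrFun (derivWithin_fun_const _ _) r)).trans ?_
  rw [symm_eq_frameL (mem_chart_source E (y r))]
  exact map_zero _

variable [FiniteDimensional ℝ E] [T2Space M]

/-- The derivative within `[a, b]` is continuous up to `a`. It agrees with the one within `[0, T]`
on the open interval, and at `a` with the one within `[a, T]`, which therefore represents the right
limit. -/
lemma tendsto_curveDeriv_right (hn : nabla.ContMDiffCovariantDerivative ∞) {a b T : ℝ}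
    {x : ℝ → M} (hab : a < b) (ha : 0 ≤ a) (hb : b ≤ T)
    (hx : ContMDiffOn 𝓘(ℝ, ℝ) 𝓘(ℝ, E) ∞ x (Icc a b)) (k : ℕ) :
    Tendsto (fun τ => (⟨x τ, curveDeriv nabla (Icc 0 T) x k τ⟩ : TangentBundle 𝓘(ℝ, E) M))
      (𝓝[>] a) (𝓝 ⟨x a, curveDeriv nabla (Icc a T) x k a⟩) := by
  have h1 := (smoothAlong_curveDeriv hn hx (uniqueDiffOn_Icc hab) k).continuousOn a
    (left_mem_Icc.2 hab.le)
  have h2 := h1.mono_left ((nhdsWithin_Ioo_eq_nhdsGT hab).ge.trans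
    (nhdsWithin_mono a Ioo_subset_Icc_self))
  rw [← curveDeriv_congr_set k (Icc_eventuallyEq_of_lt_right hab (hab.trans_le hb))]
  refine h2.congr' ?_
  filter_upwards [Ioo_mem_nhdsGT hab] with τ hτ
  rw [curveDeriv_Icc_of_mem_Ioo x k hτ ⟨ha.trans_lt hτ.1, hτ.2.trans_le hb⟩]

lemma tendsto_curveDeriv_left (hn : nabla.ContMDiffCovariantDerivative ∞) {a b T : ℝ}
    {x : ℝ → M} (hab : a < b) (ha : 0 ≤ a) (hb : b ≤ T)
    (hx : ContMDiffOn 𝓘(ℝ, ℝ) 𝓘(ℝ, E) ∞ x (Icc a b)) (k : ℕ) :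
    Tendsto (fun τ => (⟨x τ, curveDeriv nabla (Icc 0 T) x k τ⟩ : TangentBundle 𝓘(ℝ, E) M))
      (𝓝[<] b) (𝓝 ⟨x b, curveDeriv nabla (Icc 0 b) x k b⟩) := by
  have h1 := (smoothAlong_curveDeriv hn hx (uniqueDiffOn_Icc hab) k).continuousOn b
    (right_mem_Icc.2 hab.le)
  have h2 := h1.mono_left ((nhdsWithin_Ioo_eq_nhdsLT hab).ge.trans
    (nhdsWithin_mono b Ioo_subset_Icc_self))
  rw [← curveDeriv_congr_set k (Icc_eventuallyEq_of_lt_left hab (ha.trans_lt hab))]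
  refine h2.congr' ?_
  filter_upwards [Ioo_mem_nhdsLT hab] with τ hτ
  rw [curveDeriv_Icc_of_mem_Ioo x k hτ ⟨ha.trans_lt hτ.1, hτ.2.trans_le hb⟩]

/-- The covariant derivatives of a curve do not jump where the curve is smooth. -/
lemma curveDeriv_right_eq_left (hn : nabla.ContMDiffCovariantDerivative ∞) {a b u T : ℝ}
    {x : ℝ → M} (hu : u ∈ Ioo a b) (ha : 0 ≤ a) (hb : b ≤ T)
    (hx : ContMDiffOn 𝓘(ℝ, ℝ) 𝓘(ℝ, E) ∞ x (Icc a b)) (k : ℕ) :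
    curveDeriv nabla (Icc u T) x k u = curveDeriv nabla (Icc 0 u) x k u := by
  have hab := hu.1.trans hu.2
  rw [curveDeriv_congr_set k (Icc_eventuallyEq_of_lt_right (hu.2.trans_le hb) hu.2),
    curveDeriv_congr_set k (Icc_eventuallyEq_of_lt_left (ha.trans_lt hu.1) hu.1),
    curveDeriv_mono hn hx (uniqueDiffOn_Icc hab) (uniqueDiffOn_Icc hu.2)
      (Icc_subset_Icc_left hu.1.le) k (left_mem_Icc.2 hu.2.le),
    curveDeriv_mono hn hx (uniqueDiffOn_Icc hab) (uniqueDiffOn_Icc hu.1)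
      (Icc_subset_Icc_right hu.2.le) k (right_mem_Icc.2 hu.1.le)]

/-- If the two one-sided covariant derivatives of a field agree, then the field has this two-sided
covariant derivative. -/
lemma covDeriv_eq_of_left_right {a b u : ℝ} (hu : u ∈ Ioo a b) {x : ℝ → M}
    {W : ∀ t, TangentSpace 𝓘(ℝ, E) (x t)} {v : TangentSpace 𝓘(ℝ, E) (x u)}
    (hx : MDifferentiableWithinAt 𝓘(ℝ, ℝ) 𝓘(ℝ, E) x (Icc a b) u)
    (hWl : MDifferentiableWithinAt 𝓘(ℝ, ℝ) 𝓘(ℝ, E).tangent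
      (fun t => (⟨x t, W t⟩ : TangentBundle 𝓘(ℝ, E) M)) (Icc a u) u)
    (hWr : MDifferentiableWithinAt 𝓘(ℝ, ℝ) 𝓘(ℝ, E).tangent
      (fun t => (⟨x t, W t⟩ : TangentBundle 𝓘(ℝ, E) M)) (Icc u b) u)
    (hl : covDeriv nabla (Icc a u) x W u = v) (hr : covDeriv nabla (Icc u b) x W u = v) :
    covDeriv nabla (Icc a b) x W u = v := by
  have hul : UniqueDiffWithinAt ℝ (Icc a u) u := uniqueDiffOn_Icc hu.1 u (right_mem_Icc.2 hu.1.le)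
  have hur : UniqueDiffWithinAt ℝ (Icc u b) u := uniqueDiffOn_Icc hu.2 u (left_mem_Icc.2 hu.2.le)
  have hvl := velocity_mono hx hul (Icc_subset_Icc_right hu.2.le)
  have hvr := velocity_mono hx hur (Icc_subset_Icc_left hu.1.le)
  have hcl := ((mdifferentiableWithinAt_tangent_iff
    (mem_chart_source E (x u))).1 hWl).2.hasFDerivWithinAt.hasDerivWithinAt
  have hcr := ((mdifferentiableWithinAt_tangent_iff
    (mem_chart_source E (x u))).1 hWr).2.hasFDerivWithinAt.hasDerivWithinAt
  have hl' : frameL (x u) (x u) (fderivWithin ℝ (fun ζ => coord (x u) (x ζ) (W ζ)) (Icc a u) u 1) +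
      nabla (FiberBundle.extend E (W u)) (x u) (velocity (Icc a b) x u) = v := by
    rw [← hvl, ← hl, covDeriv_eq_covDerivAlong]
    rfl
  have hr' : frameL (x u) (x u) (fderivWithin ℝ (fun ζ => coord (x u) (x ζ) (W ζ)) (Icc u b) u 1) +
      nabla (FiberBundle.extend E (W u)) (x u) (velocity (Icc a b) x u) = v := by
    rw [← hvr, ← hr, covDeriv_eq_covDerivAlong]
    rfl
  -- Since `x` is differentiable at `u` within `[a, b]`, the connection terms on the two sides are
  -- equal. Hence the one-sided coordinate derivatives agree and can be glued.
  have heq : fderivWithin ℝ (fun ζ => coord (x u) (x ζ) (W ζ)) (Icc a u) u 1 =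
      fderivWithin ℝ (fun ζ => coord (x u) (x ζ) (W ζ)) (Icc u b) u 1 := by
    have h1 := congrArg (coord (x u) (x u)) (add_right_cancel (hl'.trans hr'.symm))
    rwa [coord_frameL (mem_chart_source E (x u)), coord_frameL (mem_chart_source E (x u))] at h1
  rw [heq] at hcl
  have hc := hcl.union hcr
  rw [Icc_union_Icc_eq_Icc hu.1.le hu.2.le] at hc
  rw [covDeriv_eq_covDerivAlong, ← hr']
  have h2 := hc.derivWithin (uniqueDiffOn_Icc (hu.1.trans hu.2) u ⟨hu.1.le, hu.2.le⟩)
  unfold covDerivAlong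
  exact congrArg₂ (· + ·) (congrArg (frameL (x u) (x u)) h2) rfl

end OneSided

/-! ### The variational field and the boundary terms -/

section Variation

variable {E : Type*} [NormedAddCommGroup E] [NormedSpace ℝ E]
  {M : Type*} [TopologicalSpace M] [ChartedSpace E M]

/-- The variational vector field of `α`, as a vector field along `α 0`. -/
def variationField (α : ℝ → ℝ → M) (τ : ℝ) : TangentSpace 𝓘(ℝ, E) (α 0 τ) :=
  mfderiv 𝓘(ℝ, ℝ) 𝓘(ℝ, E) (fun r => α r τ) 0 (1 : ℝ)

variable [IsManifold 𝓘(ℝ, E) ∞ M]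

/-- The covariant derivative at `r = 0` of the velocity of `α r` at time `τ`. -/
def velocityVariation (nabla : CovariantDerivative 𝓘(ℝ, E) E (fun p : M => TangentSpace 𝓘(ℝ, E) p))
    (T ε : ℝ) (α : ℝ → ℝ → M) (τ : ℝ) : TangentSpace 𝓘(ℝ, E) (α 0 τ) :=
  covDeriv nabla (Ioo (-ε) ε) (fun r => α r τ) (fun r => velocity (Icc 0 T) (α r) τ) 0

variable {nabla : CovariantDerivative 𝓘(ℝ, E) E (fun p : M => TangentSpace 𝓘(ℝ, E) p)}
  {T ε a b : ℝ} {α : ℝ → ℝ → M}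

lemma velocity_eq_variationField (hε : 0 < ε) (τ : ℝ) :
    velocity (Ioo (-ε) ε) (fun r => α r τ) 0 = variationField (E := E) α τ := by
  have h : Ioo (-ε) ε =ᶠ[𝓝 (0 : ℝ)] univ :=
    eventuallyEq_univ.2 (Ioo_mem_nhds (by linarith) hε)
  rw [velocity_congr_set h]
  unfold velocity variationField
  rw [mfderivWithin_univ]

lemma dirVelocity_eq_variationField (hε : 0 < ε)
    (hf : ContMDiffOn 𝓘(ℝ, ℝ × ℝ) 𝓘(ℝ, E) ∞ (fun p : ℝ × ℝ => α p.1 p.2)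
      (Ioo (-ε) ε ×ˢ Icc a b)) {τ : ℝ} (hτ : τ ∈ Icc a b) :
    dirVelocity (E := E) (Ioo (-ε) ε ×ˢ Icc a b) (fun p : ℝ × ℝ => α p.1 p.2) (1, 0) (0, τ) =
      variationField α τ := by
  have h0 : (0 : ℝ) ∈ Ioo (-ε) ε := ⟨by linarith, hε⟩
  rw [← velocity_eq_variationField hε]
  exact (velocity_comp (f := fun p : ℝ × ℝ => α p.1 p.2)
    (hasDerivWithinAt_mk_right 0 τ (Ioo (-ε) ε))
    (fun r hr => (⟨hr, hτ⟩ : ((r, τ) : ℝ × ℝ) ∈ Ioo (-ε) ε ×ˢ Icc a b))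
    (uniqueDiffOn_Ioo _ _ 0 h0)
    ((hf _ ⟨h0, hτ⟩).mdifferentiableWithinAt (by simp))).symm

variable [FiniteDimensional ℝ E] [T2Space M]

lemma smoothAlong_variationField (hε : 0 < ε) (hab : a < b)
    (hf : ContMDiffOn 𝓘(ℝ, ℝ × ℝ) 𝓘(ℝ, E) ∞ (fun p : ℝ × ℝ => α p.1 p.2)
      (Ioo (-ε) ε ×ˢ Icc a b)) : SmoothAlong (Icc a b) (α 0) (variationField (E := E) α) := by
  have h0 : (0 : ℝ) ∈ Ioo (-ε) ε := ⟨by linarith, hε⟩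
  have h1 := smoothAlong_dirVelocity hf ((uniqueDiffOn_Ioo _ _).prod (uniqueDiffOn_Icc hab)) (1, 0)
  have h2 : ContMDiffOn 𝓘(ℝ, ℝ) 𝓘(ℝ, ℝ × ℝ) ∞ (fun τ : ℝ => ((0, τ) : ℝ × ℝ)) (Icc a b) :=
    (contDiff_const.prodMk contDiff_id).contMDiff.contMDiffOn
  refine (ContMDiffOn.comp h1 h2 fun τ hτ => ⟨h0, hτ⟩).congr fun τ hτ => ?_
  change (⟨α 0 τ, _⟩ : TangentBundle 𝓘(ℝ, E) M) = ⟨α 0 τ, _⟩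
  rw [dirVelocity_eq_variationField hε hf hτ]

lemma covDeriv_variationField_eq_covDerivAlong (hε : 0 < ε) (hab : a < b)
    (hf : ContMDiffOn 𝓘(ℝ, ℝ × ℝ) 𝓘(ℝ, E) ∞ (fun p : ℝ × ℝ => α p.1 p.2)
      (Ioo (-ε) ε ×ˢ Icc a b)) {τ : ℝ} (hτ : τ ∈ Icc a b) :
    covDeriv nabla (Icc a b) (α 0) (variationField α) τ =
      covDerivAlong nabla (Ioo (-ε) ε ×ˢ Icc a b) (fun p : ℝ × ℝ => α p.1 p.2)
        (dirVelocity (Ioo (-ε) ε ×ˢ Icc a b) (fun p : ℝ × ℝ => α p.1 p.2) (1, 0)) (0, 1) (0, τ) := by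
  have h0 : (0 : ℝ) ∈ Ioo (-ε) ε := ⟨by linarith, hε⟩
  have h1 := smoothAlong_dirVelocity hf ((uniqueDiffOn_Ioo _ _).prod (uniqueDiffOn_Icc hab)) (1, 0)
  have h2 : covDeriv nabla (Icc a b) (α 0) (variationField α) τ = covDeriv nabla (Icc a b) (α 0)
      (fun s => dirVelocity (Ioo (-ε) ε ×ˢ Icc a b) (fun p : ℝ × ℝ => α p.1 p.2) (1, 0) (0, s)) τ :=
    covDeriv_congr EventuallyEq.rfl (eventually_nhdsWithin_of_forall fun s hs =>
      (dirVelocity_eq_variationField hε hf hs).symm) (dirVelocity_eq_variationField hε hf hτ).symm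
  rw [h2]
  have h3 := h1.mdifferentiableWithinAt
    (⟨h0, hτ⟩ : ((0, τ) : ℝ × ℝ) ∈ Ioo (-ε) ε ×ˢ Icc a b)
  exact covDeriv_comp (f := fun p : ℝ × ℝ => α p.1 p.2)
    (W := dirVelocity (Ioo (-ε) ε ×ˢ Icc a b) (fun p : ℝ × ℝ => α p.1 p.2) (1, 0))
    (γ := fun s : ℝ => ((0, s) : ℝ × ℝ)) (hasDerivWithinAt_mk_left 0 τ (Icc a b))
    (fun s hs => (⟨h0, hs⟩ : ((0, s) : ℝ × ℝ) ∈ Ioo (-ε) ε ×ˢ Icc a b))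
    (uniqueDiffOn_Icc hab τ hτ) h3

/-- As `α r` is `C¹` on `[0, T]`, this also holds on the edges of the strip. Adjacent strips thus
see the same velocity at a common node. -/
lemma velocity_eq_dirVelocity
    (hf : ContMDiffOn 𝓘(ℝ, ℝ × ℝ) 𝓘(ℝ, E) ∞ (fun p : ℝ × ℝ => α p.1 p.2)
      (Ioo (-ε) ε ×ˢ Icc a b)) (hab : a < b) (ha : 0 ≤ a) (hb : b ≤ T) {r : ℝ}
    (hr : r ∈ Ioo (-ε) ε) (hαr : ContMDiffOn 𝓘(ℝ, ℝ) 𝓘(ℝ, E) 1 (α r) (Icc 0 T)) {τ : ℝ}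
    (hτ : τ ∈ Icc a b) :
    velocity (Icc 0 T) (α r) τ =
      dirVelocity (E := E) (Ioo (-ε) ε ×ˢ Icc a b) (fun p : ℝ × ℝ => α p.1 p.2) (0, 1) (r, τ) := by
  have hsub : Icc a b ⊆ Icc 0 T := Icc_subset_Icc ha hb
  rw [← velocity_mono ((hαr τ (hsub hτ)).mdifferentiableWithinAt one_ne_zero)
    (uniqueDiffOn_Icc hab τ hτ) hsub]
  exact velocity_comp (f := fun p : ℝ × ℝ => α p.1 p.2) (hasDerivWithinAt_mk_left r τ (Icc a b))
    (fun s hs => (⟨hr, hs⟩ : ((r, s) : ℝ × ℝ) ∈ Ioo (-ε) ε ×ˢ Icc a b))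
    (uniqueDiffOn_Icc hab τ hτ) ((hf _ ⟨hr, hτ⟩).mdifferentiableWithinAt (by simp))

/-- The derivatives `D/dr ∂α/∂t` and `D/dt ∂α/∂r` agree. -/
lemma covDeriv_variationField (ht : nabla.torsion = 0) (hε : 0 < ε) (hab : a < b)
    (ha : 0 ≤ a) (hb : b ≤ T)
    (hf : ContMDiffOn 𝓘(ℝ, ℝ × ℝ) 𝓘(ℝ, E) ∞ (fun p : ℝ × ℝ => α p.1 p.2)
      (Ioo (-ε) ε ×ˢ Icc a b))
    (hα : ∀ r ∈ Ioo (-ε) ε, ContMDiffOn 𝓘(ℝ, ℝ) 𝓘(ℝ, E) 1 (α r) (Icc 0 T)) {τ : ℝ}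
    (hτ : τ ∈ Icc a b) :
    covDeriv nabla (Icc a b) (α 0) (variationField α) τ = velocityVariation nabla T ε α τ := by
  have h0 : (0 : ℝ) ∈ Ioo (-ε) ε := ⟨by linarith, hε⟩
  have hS : UniqueDiffOn ℝ (Ioo (-ε) ε ×ˢ Icc a b) :=
    (uniqueDiffOn_Ioo _ _).prod (uniqueDiffOn_Icc hab)
  have hz : ((0, τ) : ℝ × ℝ) ∈ Ioo (-ε) ε ×ˢ Icc a b := ⟨h0, hτ⟩
  rw [covDeriv_variationField_eq_covDerivAlong hε hab hf hτ, covDerivAlong_dirVelocity_comm ht hf hS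
    hz (subset_closure_interior_strip hab hz)]
  have h1 := smoothAlong_dirVelocity hf hS (0, 1)
  have h2 : velocityVariation nabla T ε α τ = covDeriv nabla (Ioo (-ε) ε) (fun r => α r τ)
      (fun r => dirVelocity (Ioo (-ε) ε ×ˢ Icc a b) (fun p : ℝ × ℝ => α p.1 p.2) (0, 1) (r, τ))
        0 :=
    covDeriv_congr EventuallyEq.rfl (eventually_nhdsWithin_of_forall fun r hr =>
      velocity_eq_dirVelocity hf hab ha hb hr (hα r hr) hτ)
      (velocity_eq_dirVelocity hf hab ha hb h0 (hα 0 h0) hτ)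
  rw [h2]
  exact (covDeriv_comp (f := fun p : ℝ × ℝ => α p.1 p.2)
    (hasDerivWithinAt_mk_right 0 τ (Ioo (-ε) ε))
    (fun r hr => (⟨hr, hτ⟩ : ((r, τ) : ℝ × ℝ) ∈ Ioo (-ε) ε ×ˢ Icc a b))
    (uniqueDiffOn_Ioo _ _ 0 h0) (h1.mdifferentiableWithinAt hz)).symm

/-- Restricted to the open interval: at a break point the derivatives within `[0, T]` need not be
those of the piece. For the integrals the open interval is enough. -/
lemma timeDeriv_eq_curveDeriv (hn : nabla.ContMDiffCovariantDerivative ∞)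
    (hf : ContMDiffOn 𝓘(ℝ, ℝ × ℝ) 𝓘(ℝ, E) ∞ (fun p : ℝ × ℝ => α p.1 p.2)
      (Ioo (-ε) ε ×ˢ Icc a b)) (ha : 0 ≤ a) (hb : b ≤ T) {r : ℝ}
    (hr : r ∈ Ioo (-ε) ε) (k : ℕ) {τ : ℝ} (hτ : τ ∈ Ioo a b) :
    timeDeriv nabla (Ioo (-ε) ε ×ˢ Icc a b) (fun p : ℝ × ℝ => α p.1 p.2) k (r, τ) =
      curveDeriv nabla (Icc 0 T) (α r) k τ := by
  rw [← curveDeriv_Icc_of_mem_Ioo (α r) k hτ ⟨ha.trans_lt hτ.1, hτ.2.trans_le hb⟩]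
  exact (curveDeriv_eq_timeDeriv hn hf (uniqueDiffOn_Ioo _ _)
    (uniqueDiffOn_Icc (hτ.1.trans hτ.2)) hr k (Ioo_subset_Icc_self hτ)).symm

variable [RiemannianBundle (fun p : M => TangentSpace 𝓘(ℝ, E) p)]

lemma stripEnergy_eq_energyDensity (hn : nabla.ContMDiffCovariantDerivative ∞)
    (hf : ContMDiffOn 𝓘(ℝ, ℝ × ℝ) 𝓘(ℝ, E) ∞ (fun p : ℝ × ℝ => α p.1 p.2)
      (Ioo (-ε) ε ×ˢ Icc a b)) (ha : 0 ≤ a) (hb : b ≤ T) (σ : ℝ) (V : M → ℝ) {r : ℝ}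
    (hr : r ∈ Ioo (-ε) ε) {τ : ℝ} (hτ : τ ∈ Ioo a b) :
    stripEnergy nabla σ V (Ioo (-ε) ε ×ˢ Icc a b) (fun p : ℝ × ℝ => α p.1 p.2) (r, τ) =
      energyDensity nabla σ V T (α r) τ := by
  unfold stripEnergy energyDensity
  rw [timeDeriv_eq_curveDeriv hn hf ha hb hr 1 hτ, timeDeriv_eq_curveDeriv hn hf ha hb hr 0 hτ]

lemma stripEuler_eq_eulerField (hn : nabla.ContMDiffCovariantDerivative ∞) (hε : 0 < ε)
    (hf : ContMDiffOn 𝓘(ℝ, ℝ × ℝ) 𝓘(ℝ, E) ∞ (fun p : ℝ × ℝ => α p.1 p.2)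
      (Ioo (-ε) ε ×ˢ Icc a b)) (ha : 0 ≤ a) (hb : b ≤ T) (σ : ℝ) (V : M → ℝ)
    {τ : ℝ} (hτ : τ ∈ Ioo a b) :
    stripEuler nabla σ V (Ioo (-ε) ε ×ˢ Icc a b) (fun p : ℝ × ℝ => α p.1 p.2) (0, τ) =
      eulerField nabla σ V T (α 0) τ := by
  have h := fun k => timeDeriv_eq_curveDeriv hn hf ha hb
    (⟨by linarith, hε⟩ : (0 : ℝ) ∈ Ioo (-ε) ε) k hτ
  unfold stripEuler eulerField
  rw [h 3, h 1, h 0]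

variable [IsContMDiffRiemannianBundle 𝓘(ℝ, E) ∞ E (fun p : M => TangentSpace 𝓘(ℝ, E) p)]

/-- The boundary term at time `u`, with the derivatives of `α 0` of orders `2` and `3` taken
within `I`. -/
def boundaryTerm (nabla : CovariantDerivative 𝓘(ℝ, E) E (fun p : M => TangentSpace 𝓘(ℝ, E) p))
    (σ T ε : ℝ) (α : ℝ → ℝ → M) (I : Set ℝ) (u : ℝ) : ℝ :=
  inner ℝ (velocityVariation nabla T ε α u) (curveDeriv nabla I (α 0) 1 u) -
    inner ℝ (variationField α u) (curveDeriv nabla I (α 0) 2 u) +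
    σ * inner ℝ (variationField (E := E) α u) (velocity (E := E) (Icc 0 T) (α 0) u)

lemma boundaryTerm_congr_set (σ : ℝ) {I I' : Set ℝ} {u : ℝ} (h : I =ᶠ[𝓝 u] I') :
    boundaryTerm nabla σ T ε α I u = boundaryTerm nabla σ T ε α I' u := by
  unfold boundaryTerm
  rw [curveDeriv_congr_set 1 h, curveDeriv_congr_set 2 h]

/-- Rewriting `D_t Y` as `D_r` of the velocity removes the strip from every factor except the
derivatives of orders `2` and `3`, so boundary values from neighbouring strips become comparable. -/
lemma stripBoundary_eq_boundaryTerm (hn : nabla.ContMDiffCovariantDerivative ∞)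
    (ht : nabla.torsion = 0) (hε : 0 < ε)
    (hab : a < b) (ha : 0 ≤ a) (hb : b ≤ T)
    (hf : ContMDiffOn 𝓘(ℝ, ℝ × ℝ) 𝓘(ℝ, E) ∞ (fun p : ℝ × ℝ => α p.1 p.2)
      (Ioo (-ε) ε ×ˢ Icc a b))
    (hα : ∀ r ∈ Ioo (-ε) ε, ContMDiffOn 𝓘(ℝ, ℝ) 𝓘(ℝ, E) 1 (α r) (Icc 0 T)) (σ : ℝ) {τ : ℝ}
    (hτ : τ ∈ Icc a b) :
    stripBoundary nabla σ (Ioo (-ε) ε ×ˢ Icc a b) (fun p : ℝ × ℝ => α p.1 p.2) (0, τ) =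
      boundaryTerm nabla σ T ε α (Icc a b) τ := by
  have h0 : (0 : ℝ) ∈ Ioo (-ε) ε := ⟨by linarith, hε⟩
  have h1 := fun k => (curveDeriv_eq_timeDeriv hn hf (uniqueDiffOn_Ioo _ _)
    (uniqueDiffOn_Icc hab) h0 k hτ).symm
  have h2 := covDeriv_variationField_eq_covDerivAlong (nabla := nabla) hε hab hf hτ
  rw [covDeriv_variationField ht hε hab ha hb hf hα hτ] at h2
  unfold stripBoundary boundaryTerm
  rw [h1 1, h1 2, ← h2, dirVelocity_eq_variationField hε hf hτ,
    velocity_eq_dirVelocity hf hab ha hb h0 (hα 0 h0) hτ]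
  rfl

end Variation

/-! ### Summation over the strips and the change of partition -/

section FirstVariation

variable {E : Type*} [NormedAddCommGroup E] [NormedSpace ℝ E]
  {M : Type*} [TopologicalSpace M] [ChartedSpace E M] [IsManifold 𝓘(ℝ, E) ∞ M]
  {nabla : CovariantDerivative 𝓘(ℝ, E) E (fun p : M => TangentSpace 𝓘(ℝ, E) p)}
  {T ε : ℝ} {α : ℝ → ℝ → M} {P₀ P₁ : TangentBundle 𝓘(ℝ, E) M} {x : ℝ → M}

/-- Where position and velocity are prescribed, the variational field vanishes to first order. -/
lemma variationField_eq_zero (hε : 0 < ε) {P : TangentBundle 𝓘(ℝ, E) M} {u : ℝ}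
    (h : ∀ r ∈ Ioo (-ε) ε,
      (⟨α r u, velocity (Icc 0 T) (α r) u⟩ : TangentBundle 𝓘(ℝ, E) M) = P) :
    variationField (E := E) α u = 0 ∧ velocityVariation nabla T ε α u = 0 := by
  have h1 := covDeriv_eq_zero_of_const (nabla := nabla) h
    (⟨by linarith, hε⟩ : (0 : ℝ) ∈ Ioo (-ε) ε)
  exact ⟨(velocity_eq_variationField hε u).symm.trans h1.1, h1.2⟩

variable [FiniteDimensional ℝ E] [T2Space M]
  [RiemannianBundle (fun p : M => TangentSpace 𝓘(ℝ, E) p)]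
  [IsContMDiffRiemannianBundle 𝓘(ℝ, E) ∞ E (fun p : M => TangentSpace 𝓘(ℝ, E) p)]

lemma boundaryTerm_eq_zero (hε : 0 < ε) {P : TangentBundle 𝓘(ℝ, E) M} {u : ℝ}
    (h : ∀ r ∈ Ioo (-ε) ε,
      (⟨α r u, velocity (Icc 0 T) (α r) u⟩ : TangentBundle 𝓘(ℝ, E) M) = P) (σ : ℝ) (I : Set ℝ) :
    boundaryTerm nabla σ T ε α I u = 0 := by
  obtain ⟨h1, h2⟩ := variationField_eq_zero (nabla := nabla) hε h
  unfold boundaryTerm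
  rw [h1, h2]
  simp only [inner_zero_left]
  ring

/-- The `σ` term does not involve the interval and cancels; the other two leave only jumps. -/
lemma boundaryTerm_sub_boundaryTerm (σ : ℝ) (I I' : Set ℝ) (u : ℝ) :
    boundaryTerm nabla σ T ε α I u - boundaryTerm nabla σ T ε α I' u =
      -inner ℝ (velocityVariation nabla T ε α u)
          (curveDeriv nabla I' (α 0) 1 u - curveDeriv nabla I (α 0) 1 u) +
        inner ℝ (variationField α u)
          (curveDeriv nabla I' (α 0) 2 u - curveDeriv nabla I (α 0) 2 u) := by
  unfold boundaryTerm
  simp only [inner_sub_right]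
  ring

/-- The first variation formula, with the boundary terms at the break points of the variation. -/
lemma IsAdmissibleVariation.hasDerivAt_J (hnabla : IsRiemannianConnection nabla) (hT : 0 < T)
    (σ : ℝ) {U : Set M} (hU : IsOpen U) {V : M → ℝ} (hV : ContMDiffOn 𝓘(ℝ, E) 𝓘(ℝ, ℝ) 1 V U)
    (hα : IsAdmissibleVariation T P₀ P₁ ε x α) (hxU : ∀ t ∈ Icc 0 T, α 0 t ∈ U)
    {m : ℕ} {s : ℕ → ℝ} (hs : IsPartition T m s)
    (hf : ∀ j < m, ContMDiffOn 𝓘(ℝ, ℝ × ℝ) 𝓘(ℝ, E) ∞ (fun p : ℝ × ℝ => α p.1 p.2)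
      (Ioo (-ε) ε ×ˢ Icc (s j) (s (j + 1)))) :
    (∀ᶠ r in 𝓝 (0 : ℝ), IntervalIntegrable (energyDensity nabla σ V T (α r)) volume 0 T) ∧
    IntervalIntegrable (fun τ => inner ℝ (variationField α τ) (eulerField nabla σ V T (α 0) τ))
      volume 0 T ∧
    HasDerivAt (fun r => J nabla σ V T (α r))
      ((∫ τ in (0 : ℝ)..T, inner ℝ (variationField α τ) (eulerField nabla σ V T (α 0) τ)) +
        ∑ j ∈ Finset.Ico 1 m, (boundaryTerm nabla σ T ε α (Icc 0 (s j)) (s j) -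
          boundaryTerm nabla σ T ε α (Icc (s j) T) (s j))) 0 := by
  have hn := hnabla.smooth
  have hε := hα.pos
  have h0 : (0 : ℝ) ∈ Ioo (-ε) ε := ⟨by linarith, hε⟩
  have hC1 := fun r hr => (hα.mem r hr).contMDiffOn_one
  have hpos : ∀ j < m, 0 ≤ s j := fun j hj => hs.nonneg hj.le
  have hle : ∀ j < m, s (j + 1) ≤ T := fun j hj => hs.le_last hj
  have hm : 0 < m := Nat.pos_of_ne_zero fun h => by
    have := hs.last
    rw [h, hs.zero] at this
    exact hT.ne this
  have hstrip := fun j (hj : j < m) => hasDerivAt_integral_stripEnergy hnabla σ hε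
    (hs.lt_succ j hj) (hf j hj) hU hV fun t ht => hxU t ⟨(hpos j hj).trans ht.1, ht.2.trans (hle j hj)⟩
  have henergy : ∀ j (hj : j < m), ∀ r ∈ Ioo (-ε) ε, EqOn
      (fun τ => stripEnergy nabla σ V (Ioo (-ε) ε ×ˢ Icc (s j) (s (j + 1)))
        (fun p : ℝ × ℝ => α p.1 p.2) (r, τ))
      (energyDensity nabla σ V T (α r)) (uIoo (s j) (s (j + 1))) := fun j hj r hr τ hτ => by
    rw [uIoo_of_le (hs.lt_succ j hj).le] at hτ
    exact stripEnergy_eq_energyDensity hn (hf j hj) (hpos j hj) (hle j hj) σ V hr hτ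
  have heuler : ∀ j (hj : j < m), EqOn
      (fun τ => inner ℝ (dirVelocity (Ioo (-ε) ε ×ˢ Icc (s j) (s (j + 1)))
          (fun p : ℝ × ℝ => α p.1 p.2) (1, 0) (0, τ))
        (stripEuler nabla σ V (Ioo (-ε) ε ×ˢ Icc (s j) (s (j + 1)))
          (fun p : ℝ × ℝ => α p.1 p.2) (0, τ)))
      (fun τ => inner ℝ (variationField α τ) (eulerField nabla σ V T (α 0) τ))
      (uIoo (s j) (s (j + 1))) := fun j hj τ hτ => by
    rw [uIoo_of_le (hs.lt_succ j hj).le] at hτ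
    simp only [stripEuler_eq_eulerField hn hε (hf j hj) (hpos j hj) (hle j hj) σ V hτ,
      dirVelocity_eq_variationField hε (hf j hj) (Ioo_subset_Icc_self hτ)]
  have hintE : ∀ᶠ r in 𝓝 (0 : ℝ), r ∈ Ioo (-ε) ε ∧ ∀ j < m,
      IntervalIntegrable (energyDensity nabla σ V T (α r)) volume (s j) (s (j + 1)) := by
    have h1 : ∀ᶠ r in 𝓝 (0 : ℝ), ∀ j ∈ Finset.range m, IntervalIntegrable
        (fun τ => stripEnergy nabla σ V (Ioo (-ε) ε ×ˢ Icc (s j) (s (j + 1)))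
          (fun p : ℝ × ℝ => α p.1 p.2) (r, τ)) volume (s j) (s (j + 1)) :=
      (Filter.eventually_all_finset _).2 fun j hj => (hstrip j (Finset.mem_range.1 hj)).1
    filter_upwards [h1, Ioo_mem_nhds h0.1 h0.2] with r hr hrε
    exact ⟨hrε, fun j hj => (hr j (Finset.mem_range.2 hj)).congr_uIoo (henergy j hj r hrε)⟩
  have hintX : ∀ j < m, IntervalIntegrable
      (fun τ => inner ℝ (variationField α τ) (eulerField nabla σ V T (α 0) τ)) volume
      (s j) (s (j + 1)) := fun j hj => (hstrip j hj).2.1.congr_uIoo (heuler j hj)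
  have hall : ∀ {F : ℝ → ℝ}, (∀ j < m, IntervalIntegrable F volume (s j) (s (j + 1))) →
      IntervalIntegrable F volume 0 T := fun h => by
    have h1 := IntervalIntegrable.trans_iterate h
    rwa [hs.zero, hs.last] at h1
  have hsum : ∀ {F : ℝ → ℝ}, (∀ j < m, IntervalIntegrable F volume (s j) (s (j + 1))) →
      ∑ j ∈ Finset.range m, ∫ τ in (s j)..(s (j + 1)), F τ = ∫ τ in (0 : ℝ)..T, F τ := fun h => by
    have h1 := intervalIntegral.sum_integral_adjacent_intervals h
    rwa [hs.zero, hs.last] at h1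
  refine ⟨hintE.mono fun r hr => hall hr.2, hall hintX, ?_⟩
  have hder := HasDerivAt.fun_sum fun j (hj : j ∈ Finset.range m) =>
    (hstrip j (Finset.mem_range.1 hj)).2.2
  refine (hder.congr_of_eventuallyEq ?_).congr_deriv ?_
  · filter_upwards [hintE] with r hr
    unfold J
    rw [← hsum hr.2]
    exact Finset.sum_congr rfl fun j hj =>
      (intervalIntegral.integral_congr_uIoo (henergy j (Finset.mem_range.1 hj) r hr.1)).symm
  -- The sum over interior nodes is turned back into a sum over strips, to be compared strip by
  -- strip. The two goals left at the end are the vanishing of the boundary terms at `0` and `T`.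
  · rw [← hsum hintX, ← sum_range_sub_eq_sum_Ico hm
      (fun j => boundaryTerm nabla σ T ε α (Icc (s j) T) (s j))
      (fun j => boundaryTerm nabla σ T ε α (Icc 0 (s j)) (s j)), ← Finset.sum_add_distrib]
    · refine Finset.sum_congr rfl fun j hj => ?_
      have hj := Finset.mem_range.1 hj
      have hab := hs.lt_succ j hj
      rw [intervalIntegral.integral_congr_uIoo (heuler j hj),
        stripBoundary_eq_boundaryTerm hn hnabla.torsion_free hε hab (hpos j hj) (hle j hj)
          (hf j hj) hC1 σ (left_mem_Icc.2 hab.le),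
        stripBoundary_eq_boundaryTerm hn hnabla.torsion_free hε hab (hpos j hj) (hle j hj)
          (hf j hj) hC1 σ (right_mem_Icc.2 hab.le),
        boundaryTerm_congr_set σ
          (Icc_eventuallyEq_of_lt_right hab (hab.trans_le (hle j hj))),
        boundaryTerm_congr_set σ
          (Icc_eventuallyEq_of_lt_left hab ((hpos j hj).trans_lt hab))]
    · simp only [hs.zero]
      exact boundaryTerm_eq_zero hε (fun r hr => (hα.mem r hr).left_end) σ _
    · simp only [hs.last]
      exact boundaryTerm_eq_zero hε (fun r hr => (hα.mem r hr).right_end) σ _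

/-- On each of the two adjacent strips the one-sided derivative is `velocityVariation`, an
expression that does not refer to the strip; equal one-sided derivatives then glue. -/
lemma IsAdmissibleVariation.covDeriv_variationField_break
    (hnabla : IsRiemannianConnection nabla)
    (hα : IsAdmissibleVariation T P₀ P₁ ε x α) {m : ℕ} {s : ℕ → ℝ} (hs : IsPartition T m s)
    (hf : ∀ j < m, ContMDiffOn 𝓘(ℝ, ℝ × ℝ) 𝓘(ℝ, E) ∞ (fun p : ℝ × ℝ => α p.1 p.2)
      (Ioo (-ε) ε ×ˢ Icc (s j) (s (j + 1)))) {j : ℕ} (hj : j ∈ Finset.Ico 1 m) :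
    covDeriv nabla (Icc 0 T) (α 0) (variationField α) (s j) =
      velocityVariation nabla T ε α (s j) := by
  have hε := hα.pos
  have h0 : (0 : ℝ) ∈ Ioo (-ε) ε := ⟨by linarith, hε⟩
  have hu := hs.mem_Ioo hj
  have hC1 := fun r hr => (hα.mem r hr).contMDiffOn_one
  rw [Finset.mem_Ico] at hj
  obtain ⟨i, rfl⟩ := Nat.exists_eq_succ_of_ne_zero (Nat.one_le_iff_ne_zero.1 hj.1)
  have hi : i < m := (Nat.lt_succ_self i).trans hj.2
  have hl := hs.lt_succ i hi
  have hr := hs.lt_succ (i + 1) hj.2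
  have hli := hs.nonneg hi.le
  have hri : s (i + 1 + 1) ≤ T := hs.le_last hj.2
  have hset : Icc 0 T =ᶠ[𝓝 (s (i + 1))] Icc (s i) (s (i + 1 + 1)) :=
    (Icc_eventuallyEq_of_lt_right hu.2 hr).trans (Icc_eventuallyEq_of_lt_left hu.1 hl)
  have hxd : MDifferentiableWithinAt 𝓘(ℝ, ℝ) 𝓘(ℝ, E) (α 0) (Icc (s i) (s (i + 1 + 1)))
      (s (i + 1)) :=
    (((hC1 0 h0) _ ⟨hu.1.le, hu.2.le⟩).mdifferentiableWithinAt one_ne_zero).mono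
      (Icc_subset_Icc hli hri)
  refine (covDeriv_congr hset (Eventually.of_forall fun _ => rfl) rfl).trans ?_
  exact covDeriv_eq_of_left_right ⟨hl, hr⟩ hxd
    ((smoothAlong_variationField hε hl (hf i hi)).mdifferentiableWithinAt (right_mem_Icc.2 hl.le))
    ((smoothAlong_variationField hε hr (hf (i + 1) hj.2)).mdifferentiableWithinAt
      (left_mem_Icc.2 hr.le))
    (covDeriv_variationField hnabla.torsion_free hε hl hli (hs.le_last hj.2.le) (hf i hi) hC1
      (right_mem_Icc.2 hl.le))
    (covDeriv_variationField hnabla.torsion_free hε hr (hs.nonneg hj.2.le) hri (hf (i + 1) hj.2) hC1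
      (left_mem_Icc.2 hr.le))

/-- The first variation formula, with the boundary terms at the break points of the curve. -/
lemma IsAdmissibleVariation.hasDerivAt_J_of_partition (hnabla : IsRiemannianConnection nabla)
    (hT : 0 < T) (σ : ℝ) {U : Set M} (hU : IsOpen U) {V : M → ℝ}
    (hV : ContMDiffOn 𝓘(ℝ, E) 𝓘(ℝ, ℝ) 1 V U)
    (hα : IsAdmissibleVariation T P₀ P₁ ε x α) (hxU : ∀ t ∈ Icc 0 T, α 0 t ∈ U)
    {l : ℕ} {t : ℕ → ℝ} (ht : IsPartition T l t)
    (hxt : ∀ i < l, ContMDiffOn 𝓘(ℝ, ℝ) 𝓘(ℝ, E) ∞ (α 0) (Icc (t i) (t (i + 1)))) :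
    (∀ᶠ r in 𝓝 (0 : ℝ), IntervalIntegrable (energyDensity nabla σ V T (α r)) volume 0 T) ∧
    IntervalIntegrable (fun τ => inner ℝ (variationField α τ) (eulerField nabla σ V T (α 0) τ))
      volume 0 T ∧
    HasDerivAt (fun r => J nabla σ V T (α r))
      ((∫ τ in (0 : ℝ)..T, inner ℝ (variationField α τ) (eulerField nabla σ V T (α 0) τ))
        - ∑ i ∈ Finset.Ico 1 l,
            inner ℝ (covDeriv nabla (Icc 0 T) (α 0) (variationField α) (t i))
              (curveDeriv nabla (Icc (t i) T) (α 0) 1 (t i) -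
                curveDeriv nabla (Icc 0 (t i)) (α 0) 1 (t i))
        + ∑ i ∈ Finset.Ico 1 l, inner ℝ (variationField α (t i))
            (curveDeriv nabla (Icc (t i) T) (α 0) 2 (t i) -
              curveDeriv nabla (Icc 0 (t i)) (α 0) 2 (t i))) 0 := by
  obtain ⟨m, s, hs, hf⟩ := hα.piecewise_smooth
  have hn := hnabla.smooth
  have h0 : (0 : ℝ) ∈ Ioo (-ε) ε := ⟨by linarith [hα.pos], hα.pos⟩
  obtain ⟨h1, h2, h3⟩ := hα.hasDerivAt_J hnabla hT σ hU hV hxU hs hf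
  have hxs : ∀ j < m, ContMDiffOn 𝓘(ℝ, ℝ) 𝓘(ℝ, E) ∞ (α 0) (Icc (s j) (s (j + 1))) := by
    intro j hj
    exact (smoothAlong_variationField hα.pos (hs.lt_succ j hj) (hf j hj)).base
  have hjump : ∀ {n : ℕ} {b : ℕ → ℝ}, IsPartition T n b →
      (∀ i < n, ContMDiffOn 𝓘(ℝ, ℝ) 𝓘(ℝ, E) ∞ (α 0) (Icc (b i) (b (i + 1)))) →
      ∀ i < n, ∀ u ∈ Ioo (b i) (b (i + 1)), ∀ k,
        curveDeriv nabla (Icc u T) (α 0) k u = curveDeriv nabla (Icc 0 u) (α 0) k u :=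
    fun hb hxb i hi u hu k =>
      curveDeriv_right_eq_left hn hu (hb.nonneg hi.le) (hb.le_last hi) (hxb i hi) k
  -- Applied to the partition of the curve and to that of the variation: `x` is smooth on the pieces
  -- of both, so the nodes of one may be traded for those of the other.
  have hzero : ∀ {n : ℕ} {b : ℕ → ℝ}, IsPartition T n b →
      (∀ i < n, ContMDiffOn 𝓘(ℝ, ℝ) 𝓘(ℝ, E) ∞ (α 0) (Icc (b i) (b (i + 1)))) →
      ∀ i < n, ∀ u ∈ Ioo (b i) (b (i + 1)), boundaryTerm nabla σ T ε α (Icc 0 u) u -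
        boundaryTerm nabla σ T ε α (Icc u T) u = 0 := fun hb hxb i hi u hu => by
    rw [boundaryTerm_sub_boundaryTerm, hjump hb hxb i hi u hu 1, hjump hb hxb i hi u hu 2]
    simp only [sub_self, inner_zero_right, neg_zero, add_zero]
  refine ⟨h1, h2, h3.congr_deriv ?_⟩
  rw [← ht.sum_eq_sum hs (hzero ht hxt) (hzero hs hxs), sub_add, ← Finset.sum_sub_distrib,
    sub_eq_add_neg, ← Finset.sum_neg_distrib]
  refine congrArg _ (Finset.sum_congr rfl fun i hi => ?_)
  have key : inner ℝ (velocityVariation nabla T ε α (t i))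
      (curveDeriv nabla (Icc (t i) T) (α 0) 1 (t i) -
        curveDeriv nabla (Icc 0 (t i)) (α 0) 1 (t i)) =
      inner ℝ (covDeriv nabla (Icc 0 T) (α 0) (variationField α) (t i))
      (curveDeriv nabla (Icc (t i) T) (α 0) 1 (t i) -
        curveDeriv nabla (Icc 0 (t i)) (α 0) 1 (t i)) := by
    -- If `t i` is not a break point of the variation, then `x` is smooth there and the jump is
    -- zero, so the first factor is irrelevant.
    rcases hs.eq_or_mem_Ioo (ht.mem_Ioo hi) with ⟨j, hj, h⟩ | ⟨j, hj, h⟩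
    · rw [← h, hα.covDeriv_variationField_break hnabla hs hf hj]
    · rw [hjump hs hxs j hj _ h 1, sub_self, inner_zero_right, inner_zero_right]
  rw [boundaryTerm_sub_boundaryTerm, key]
  ring

lemma energyDensity_congr {y y' : ℝ → M} (h : EqOn y y' (Icc 0 T)) (σ : ℝ) (V : M → ℝ) :
    EqOn (energyDensity nabla σ V T y) (energyDensity nabla σ V T y') (Icc 0 T) := by
  intro τ hτ
  have key : ∀ k, ‖curveDeriv nabla (Icc 0 T) y k τ‖ = ‖curveDeriv nabla (Icc 0 T) y' k τ‖ :=
    fun k => congrArg (fun P : TangentBundle 𝓘(ℝ, E) M => ‖P.2‖)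
      (totalSpace_curveDeriv_congr h k hτ)
  unfold energyDensity
  rw [key 1, key 0, h hτ]

end FirstVariation

end ObstacleAvoidance

end

theorem theorem3p2
    {E : Type*} [NormedAddCommGroup E] [NormedSpace ℝ E] [FiniteDimensional ℝ E]
    {M : Type*} [TopologicalSpace M] [T2Space M] [ChartedSpace E M] [IsManifold 𝓘(ℝ, E) ∞ M]
    [RiemannianBundle (fun p : M => TangentSpace 𝓘(ℝ, E) p)]
    [IsContMDiffRiemannianBundle 𝓘(ℝ, E) ∞ E (fun p : M => TangentSpace 𝓘(ℝ, E) p)]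
    (nabla : CovariantDerivative 𝓘(ℝ, E) E (fun p : M => TangentSpace 𝓘(ℝ, E) p))
    (hnabla : ObstacleAvoidance.IsRiemannianConnection nabla)
    (T σ : ℝ) (hT : 0 < T) (hσ : 0 < σ)
    (P₀ P₁ : TangentBundle 𝓘(ℝ, E) M)
    -- the potential is `C¹` on an open set (the complement of the obstacle) that contains the curve
    (U : Set M) (hU : IsOpen U) (V : M → ℝ) (hV : ContMDiffOn 𝓘(ℝ, E) 𝓘(ℝ, ℝ) 1 V U)
    (x : ℝ → M) (hx : ObstacleAvoidance.IsAdmissibleCurve T P₀ P₁ x)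
    (hxU : ∀ t ∈ Icc 0 T, x t ∈ U)
    -- a partition of `[0, T]` such that `x` is smooth on each closed subinterval
    (l : ℕ) (t : ℕ → ℝ) (ht : ObstacleAvoidance.IsPartition T l t)
    (hxt : ∀ i < l, ContMDiffOn 𝓘(ℝ, ℝ) 𝓘(ℝ, E) ∞ x (Icc (t i) (t (i + 1))))
    (ε : ℝ) (α : ℝ → ℝ → M)
    (hα : ObstacleAvoidance.IsAdmissibleVariation T P₀ P₁ ε x α)
    (X : ∀ τ, TangentSpace 𝓘(ℝ, E) (x τ))
    (hX : ObstacleAvoidance.IsVariationalField T x α X) :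
    -- `J (α r)` is defined for `r` near `0`, and the integral in the formula converges
    (∀ᶠ r in 𝓝 (0 : ℝ), IntervalIntegrable
      (ObstacleAvoidance.energyDensity nabla σ V T (α r)) volume 0 T) ∧
    IntervalIntegrable
      (fun τ => inner ℝ (X τ) (ObstacleAvoidance.eulerField nabla σ V T x τ)) volume 0 T ∧
    -- the one-sided limits of `D²x/dt²` and `D³x/dt³` at the break points
    ∃ A_right A_left B_right B_left : ∀ i : ℕ, TangentSpace 𝓘(ℝ, E) (x (t i)),
      (∀ i ∈ Finset.Ico 1 l,
        Tendsto (fun τ => (⟨x τ, ObstacleAvoidance.curveDeriv nabla (Icc 0 T) x 1 τ⟩ :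
          TangentBundle 𝓘(ℝ, E) M)) (𝓝[>] (t i)) (𝓝 ⟨x (t i), A_right i⟩) ∧
        Tendsto (fun τ => (⟨x τ, ObstacleAvoidance.curveDeriv nabla (Icc 0 T) x 1 τ⟩ :
          TangentBundle 𝓘(ℝ, E) M)) (𝓝[<] (t i)) (𝓝 ⟨x (t i), A_left i⟩) ∧
        Tendsto (fun τ => (⟨x τ, ObstacleAvoidance.curveDeriv nabla (Icc 0 T) x 2 τ⟩ :
          TangentBundle 𝓘(ℝ, E) M)) (𝓝[>] (t i)) (𝓝 ⟨x (t i), B_right i⟩) ∧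
        Tendsto (fun τ => (⟨x τ, ObstacleAvoidance.curveDeriv nabla (Icc 0 T) x 2 τ⟩ :
          TangentBundle 𝓘(ℝ, E) M)) (𝓝[<] (t i)) (𝓝 ⟨x (t i), B_left i⟩)) ∧
      HasDerivAt (fun r => ObstacleAvoidance.J nabla σ V T (α r))
        ((∫ τ in (0 : ℝ)..T, inner ℝ (X τ) (ObstacleAvoidance.eulerField nabla σ V T x τ))
          - ∑ i ∈ Finset.Ico 1 l,
              inner ℝ (ObstacleAvoidance.covDeriv nabla (Icc 0 T) x X (t i))
                (A_right i - A_left i)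
          + ∑ i ∈ Finset.Ico 1 l, inner ℝ (X (t i)) (B_right i - B_left i))
        0 := by
  -- The given `α 0` agrees with `x` only on `[0, T]`. Replacing it by `x` makes `β 0` and `x` the
  -- same function, so that vector fields along them have the same type; on `[0, T]` nothing
  -- changes.
  obtain ⟨β, hβ0, hβr⟩ : ∃ β : ℝ → ℝ → M, β 0 = x ∧ ∀ r ≠ 0, β r = α r :=
    ⟨Function.update α 0 x, Function.update_self _ _ _, fun r hr => Function.update_of_ne hr _ _⟩
  subst hβ0
  have hβ : ∀ r, EqOn (α r) (β r) (Icc 0 T) := fun r τ hτ => by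
    by_cases hr : r = 0
    · rw [hr]
      exact hα.zero τ hτ
    · rw [hβr r hr]
  have hadm : ObstacleAvoidance.IsAdmissibleVariation T P₀ P₁ ε (β 0) β := by
    refine ⟨hα.pos, hα.contMDiffOn_one.congr fun p hp => (hβ p.1 hp.2).symm, ?_,
      fun _ _ => rfl, fun r hr => ?_⟩
    · obtain ⟨m, s, hs, hf⟩ := hα.piecewise_smooth
      exact ⟨m, s, hs, fun j hj => (hf j hj).congr fun p hp =>
        (hβ p.1 ⟨(hs.nonneg hj.le).trans hp.2.1, hp.2.2.trans (hs.le_last hj)⟩).symm⟩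
    · by_cases h : r = 0
      · rw [h]
        exact hx
      · rw [hβr r h]
        exact hα.mem r hr
  -- For `τ` in `[0, T]` the curves `r ↦ α r τ` and `r ↦ β r τ` are equal as functions, hence have
  -- the same derivative at `0`.
  have hXβ : ∀ τ ∈ Icc 0 T, X τ = ObstacleAvoidance.variationField β τ := fun τ hτ => by
    have h1 : ∀ g g' : ℝ → M, g = g' →
        (⟨g 0, mfderiv 𝓘(ℝ, ℝ) 𝓘(ℝ, E) g 0 (1 : ℝ)⟩ : TangentBundle 𝓘(ℝ, E) M) =
          ⟨g' 0, mfderiv 𝓘(ℝ, ℝ) 𝓘(ℝ, E) g' 0 (1 : ℝ)⟩ := by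
      rintro g _ rfl
      rfl
    exact TotalSpace.mk_inj.1 ((hX τ hτ).trans
      (h1 (fun r => α r τ) (fun r => β r τ) (funext fun r => hβ r hτ)))
  have hen : ∀ r, EqOn (ObstacleAvoidance.energyDensity nabla σ V T (β r))
      (ObstacleAvoidance.energyDensity nabla σ V T (α r)) (uIoo 0 T) := fun r τ hτ => by
    rw [uIoo_of_le hT.le] at hτ
    exact (ObstacleAvoidance.energyDensity_congr (hβ r) σ V (Ioo_subset_Icc_self hτ)).symm
  have hin : EqOn (fun τ => inner ℝ (ObstacleAvoidance.variationField β τ)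
        (ObstacleAvoidance.eulerField nabla σ V T (β 0) τ))
      (fun τ => inner ℝ (X τ) (ObstacleAvoidance.eulerField nabla σ V T (β 0) τ)) (uIoo 0 T) :=
    fun τ hτ => by
      rw [uIoo_of_le hT.le] at hτ
      simp only [hXβ τ (Ioo_subset_Icc_self hτ)]
  obtain ⟨h1, h2, h3⟩ :=
    hadm.hasDerivAt_J_of_partition hnabla hT σ hU hV hxU ht hxt
  refine ⟨h1.mono fun r hr => hr.congr_uIoo (hen r), h2.congr_uIoo hin,
    fun i => ObstacleAvoidance.curveDeriv nabla (Icc (t i) T) (β 0) 1 (t i),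
    fun i => ObstacleAvoidance.curveDeriv nabla (Icc 0 (t i)) (β 0) 1 (t i),
    fun i => ObstacleAvoidance.curveDeriv nabla (Icc (t i) T) (β 0) 2 (t i),
    fun i => ObstacleAvoidance.curveDeriv nabla (Icc 0 (t i)) (β 0) 2 (t i), ?_, ?_⟩
  · intro i hi
    obtain ⟨hi1, hi2⟩ := Finset.mem_Ico.1 hi
    have hr := fun k => ObstacleAvoidance.tendsto_curveDeriv_right hnabla.smooth
      (ht.lt_succ i hi2) (ht.nonneg hi2.le) (ht.le_last hi2) (hxt i hi2) k
    -- The left limit at an interior node comes from the preceding piece, whose index is one less.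
    obtain ⟨j, rfl⟩ := Nat.exists_eq_succ_of_ne_zero (Nat.one_le_iff_ne_zero.1 hi1)
    have hj : j < l := (Nat.lt_succ_self j).trans hi2
    have hl := fun k => ObstacleAvoidance.tendsto_curveDeriv_left hnabla.smooth
      (ht.lt_succ j hj) (ht.nonneg hj.le) (ht.le_last hj) (hxt j hj) k
    exact ⟨hr 1, hl 1, hr 2, hl 2⟩
  · have hJ : (fun r => ObstacleAvoidance.J nabla σ V T (α r)) =
        fun r => ObstacleAvoidance.J nabla σ V T (β r) :=
      funext fun r => (intervalIntegral.integral_congr_uIoo (hen r)).symm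
    rw [hJ]
    refine h3.congr_deriv ?_
    have hcov : ∀ i ∈ Finset.Ico 1 l, ObstacleAvoidance.covDeriv nabla (Icc 0 T) (β 0)
        (ObstacleAvoidance.variationField β) (t i) =
        ObstacleAvoidance.covDeriv nabla (Icc 0 T) (β 0) X (t i) := fun i hi =>
      ObstacleAvoidance.covDeriv_congr EventuallyEq.rfl
        (eventually_nhdsWithin_of_forall fun τ hτ => (hXβ τ hτ).symm)
        (hXβ (t i) (Ioo_subset_Icc_self (ht.mem_Ioo hi))).symm
    congr 1
    · congr 1
      · exact intervalIntegral.integral_congr_uIoo hin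
      · exact Finset.sum_congr rfl fun i hi => by rw [hcov i hi]
    · exact Finset.sum_congr rfl fun i hi => by
        rw [hXβ (t i) (Ioo_subset_Icc_self (ht.mem_Ioo hi))]
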